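/- **Conventions.** Let $k$ be an algebraically closed field. A *$k$-finitary* 2-category $\mathcal C$ is a strict 2-category with finitely many objects such that each category $\mathcal C(i,j)$ of 1-morphisms is additive, $k$-linear and idempotent complete, with finite-dimensional spaces of 2-morphisms and finitely many isomorphism classes of indecomposables, horizontal composition is $k$-bilinear, and every identity $1_i$ is indecomposable. It is *fiat* if it has a weak involution $*$ (a 2-functor that is the identity on objects, reverses 1- and 2-morphisms, and whose square is isomorphic to the identity) such that every 1-morphism $F$ is left adjoint to $F^*$. For 1-morphisms $F,G$ put $F\le_R G$ if $G$ is a direct summand of $H\circ F$ for some $H$; $F\le_L G$ if $G$ is a direct summand of $F\circ H$ for some $H$; and $F\le_{LR}G$ if $G$ is a direct summand of $H_2\circ F\circ H_1$ for some $H_1,H_2$. Right, left and two-sided cells are the equivalence classes of isomorphism classes of indecomposable 1-morphisms for these preorders. A two-sided cell $\mathcal Q$ is *strongly regular* if different right cells in $\mathcal Q$ are not comparable for $\le_R$, and every left cell and every right cell in $\mathcal Q$ have exactly one common element. Let $\mathcal I_{\mathcal Q}$ be the 2-ideal spanned by the 2-morphisms that factor through a direct sum of indecomposable 1-morphisms $H$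 with $H\not\le_{LR}\mathcal Q$, and let $\mathcal C_{\mathcal Q}$ be the 2-full 2-subcategory of $\mathcal C/\mathcal I_{\mathcal Q}$ whose 1-morphisms are generated by the identities and the elements of $\mathcal Q$ under composition, finite direct sums, direct summands and isomorphism. For $F\in\mathcal Q$ let $m_{F,F}$ be the number $m$ such that $F^*\circ F\cong G^{\oplus m}$ in $\mathcal C/\mathcal I_{\mathcal Q}$, where $G$ is the common element of the left cell of $F^*$ and the right cell of $F$. For an object $i$, let $\mathbf P_i(j)$ be the category of diagrams $X_1\to X_0$ in $\mathcal C(i,j)$ modulo homotopy (the abelian category whose category of projectives is $\mathcal C(i,j)$); $\mathcal C$ acts on these categories by horizontal composition. Write $P_F$ for the diagram $0\to F$ and, for $F$ indecomposable, $L_F$ for the simple top of $P_F$. Let $\mathcal R$ be a right cell whose elements have source $i$. Let $K_{\mathcal R}\subseteq P_{1_i}$ be the subobject such that every simple subquotient of $P_{1_i}/K_{\mathcal R}$ is annihilated by all $F\in\mathcal R$ and such that $K_{\mathcal R}$ has a simple top, of the form $L_{G_{\mathcal R}}$ with $G_{\mathcal R}$ indecomposable, which is annihilated by no $F\in\mathcal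 R$. The category $\mathbf C_{\mathcal R}(j)$ is the full subcategory of $\mathbf P_i(j)$ consisting of the objects $M$ with a presentation $X_1\to X_0\to M\to 0$, where $X_1,X_0$ are direct summands of finite direct sums of objects $F\,L_{G_{\mathcal R}}$ with $F\in\mathcal R$ of target $j$. The action of $\mathcal C$ on $\mathbf P_i$, restricted to the categories $\mathbf C_{\mathcal R}(j)$, is the cell 2-representation $\mathbf C_{\mathcal R}$. For a family of finite-dimensional $k$-algebras $(A_j)_{j\in\mathcal C}$ let $A=\bigoplus_j A_j$ and let $\mathcal C_A$ be the 2-category whose objects are the categories $A_j\text{-mod}$ of finitely generated modules, $j\in\mathcal C$, whose 1-morphisms are the functors generated, under composition, finite direct sums, direct summands and isomorphism, by the identities and the *projective functors* (the functors isomorphic to tensoring with a finitely generated projective bimodule), and whose 2-morphisms are all natural transformations. (The $A_j$ are allowed to be zero or disconnected.) **Proposition.** Let $\mathcal C$ be a fiat 2-category, $\mathcal Q$ a strongly regular two-sided cell of $\mathcal C$, and $\mathcal R$ a right cell in $\mathcal Q$, with elements of source $i$. Assume that the function $F\mapsto m_{F,F}$ is constant on the left cells of $\mathcal Q$. Then: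 1. The categories $\mathbf C_{\mathcal R}(j)$ are stable under the action of $\mathcal C$, and there are finite-dimensional $k$-algebras $A_j$ and $k$-linear equivalences $\mathbf C_{\mathcal R}(j)\cong A_j\text{-mod}$, for all objects $j$ of $\mathcal C$. 2. For every choice of finite-dimensional $k$-algebras $A_j$ and $k$-linear equivalences $\mathbf C_{\mathcal R}(j)\cong A_j\text{-mod}$, the algebra $A=\bigoplus_jA_j$ is self-injective and weakly symmetric (the top and the socle of every finitely generated projective $A$-module are isomorphic). 3. For every such choice, $\mathbf C_{\mathcal R}$ induces a 2-functor (pseudofunctor) $\Phi:\mathcal C_{\mathcal Q}\to\mathcal C_A$ with $\Phi(j)=A_j\text{-mod}$: for all 1-morphisms $F$ of $\mathcal C_{\mathcal Q}$, the functor $\mathbf C_{\mathcal R}(F)$ corresponds to $\Phi(F)$ under the chosen equivalences, via natural isomorphisms compatible with 2-morphisms (a 2-morphism of $\mathcal C$ acting through its class in $\mathcal C/\mathcal I_{\mathcal Q}$), identities and composition. Moreover $\Phi(F)$ is a projective functor for every $F\in\mathcal Q$. -/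

import Mathlib

open CategoryTheory Bicategory Limits

universe w v u t

namespace FiatCell

noncomputable section

/-! ### Locally full sub-bicategories and quotients by 2-ideals -/

/-- A class of 1-morphisms containing the identities and closed under composition. -/
structure OneCellClass (B : Type u) [Bicategory.{w, v} B] where
  mem (a b : B) : ObjectProperty (a ⟶ b)
  id_mem (a : B) : mem a a (𝟙 a)
  comp_mem {a b c : B} {f : a ⟶ b} {g : b ⟶ c} : mem a b f → mem b c g → mem a c (f ≫ g)

/-- The locally full 2-subcategory on a class of 1-morphisms: same objects, the 1-morphisms in the
class, and all 2-morphisms between them. -/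
structure OneCellClass.Sub {B : Type u} [Bicategory.{w, v} B] (P : OneCellClass B) where
  as : B

namespace OneCellClass.Sub

variable {B : Type u} [Bicategory.{w, v} B] {P : OneCellClass B}

instance : CategoryStruct P.Sub where
  Hom a b := (P.mem a.as b.as).FullSubcategory
  id a := ⟨𝟙 a.as, P.id_mem a.as⟩
  comp f g := ⟨f.obj ≫ g.obj, P.comp_mem f.property g.property⟩

instance (a b : P.Sub) : Category (a ⟶ b) :=
  inferInstanceAs (Category (P.mem a.as b.as).FullSubcategory)

/-- The 2-morphism of the ambient 2-category underlying a 2-morphism. -/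
def hom₂ {a b : P.Sub} {f g : a ⟶ b} (η : f ⟶ g) : f.obj ⟶ g.obj := InducedCategory.Hom.hom η

instance : Bicategory P.Sub where
  homCategory := inferInstance
  whiskerLeft f _ _ η := ObjectProperty.homMk (f.obj ◁ hom₂ η)
  whiskerRight η h := ObjectProperty.homMk (hom₂ η ▷ h.obj)
  associator f g h := ObjectProperty.isoMk _ (α_ f.obj g.obj h.obj)
  leftUnitor f := ObjectProperty.isoMk _ (λ_ f.obj)
  rightUnitor f := ObjectProperty.isoMk _ (ρ_ f.obj)
  whiskerLeft_id _ _ := ObjectProperty.hom_ext _ (Bicategory.whiskerLeft_id _ _)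
  whiskerLeft_comp _ _ _ _ _ _ := ObjectProperty.hom_ext _ (Bicategory.whiskerLeft_comp _ _ _)
  id_whiskerLeft _ := ObjectProperty.hom_ext _ (Bicategory.id_whiskerLeft _)
  comp_whiskerLeft _ _ _ _ _ := ObjectProperty.hom_ext _ (Bicategory.comp_whiskerLeft _ _ _)
  id_whiskerRight _ _ := ObjectProperty.hom_ext _ (Bicategory.id_whiskerRight _ _)
  comp_whiskerRight _ _ _ := ObjectProperty.hom_ext _ (Bicategory.comp_whiskerRight _ _ _)
  whiskerRight_id _ := ObjectProperty.hom_ext _ (Bicategory.whiskerRight_id _)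
  whiskerRight_comp _ _ _ := ObjectProperty.hom_ext _ (Bicategory.whiskerRight_comp _ _ _)
  whisker_assoc _ _ _ _ _ := ObjectProperty.hom_ext _ (Bicategory.whisker_assoc _ _ _)
  whisker_exchange _ _ := ObjectProperty.hom_ext _ (Bicategory.whisker_exchange _ _)
  pentagon _ _ _ _ := ObjectProperty.hom_ext _ (Bicategory.pentagon _ _ _ _)
  triangle _ _ := ObjectProperty.hom_ext _ (Bicategory.triangle _ _)

end OneCellClass.Sub

/-- Horizontal composition is biadditive. -/
class BiadditiveComp (B : Type u) [Bicategory.{w, v} B] [∀ a b : B, Preadditive (a ⟶ b)] :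
    Prop where
  whiskerLeft_add {a b c : B} (f : a ⟶ b) {g h : b ⟶ c} (η θ : g ⟶ h) :
    f ◁ (η + θ) = f ◁ η + f ◁ θ
  add_whiskerRight {a b c : B} {f g : a ⟶ b} (η θ : f ⟶ g) (h : b ⟶ c) :
    (η + θ) ▷ h = η ▷ h + θ ▷ h

section Biadditive

variable {B : Type u} [Bicategory.{w, v} B] [∀ a b : B, Preadditive (a ⟶ b)] [BiadditiveComp B]

/-- Whiskering on the left, as an additive map. -/
def whiskerLeftHom {a b c : B} (f : a ⟶ b) (g h : b ⟶ c) : (g ⟶ h) →+ (f ≫ g ⟶ f ≫ h) :=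
  AddMonoidHom.mk' (fun η => f ◁ η) (BiadditiveComp.whiskerLeft_add f)

/-- Whiskering on the right, as an additive map. -/
def whiskerRightHom {a b c : B} (f g : a ⟶ b) (h : b ⟶ c) : (f ⟶ g) →+ (f ≫ h ⟶ g ≫ h) :=
  AddMonoidHom.mk' (fun η => η ▷ h) (fun η θ => BiadditiveComp.add_whiskerRight η θ h)

lemma whiskerLeft_sub {a b c : B} (f : a ⟶ b) {g h : b ⟶ c} (η θ : g ⟶ h) :
    f ◁ (η - θ) = f ◁ η - f ◁ θ :=
  map_sub (whiskerLeftHom f g h) η θ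

lemma sub_whiskerRight {a b c : B} {f g : a ⟶ b} (η θ : f ⟶ g) (h : b ⟶ c) :
    (η - θ) ▷ h = η ▷ h - θ ▷ h :=
  map_sub (whiskerRightHom f g h) η θ

end Biadditive

/-- A 2-ideal: additive subgroups of the groups of 2-morphisms, stable under vertical composition
and under whiskering with arbitrary 2-morphisms and 1-morphisms. -/
structure TwoIdeal (B : Type u) [Bicategory.{w, v} B] [∀ a b : B, Preadditive (a ⟶ b)] where
  carrier {a b : B} (f g : a ⟶ b) : AddSubgroup (f ⟶ g)
  comp_left {a b : B} {f g h : a ⟶ b} (η : f ⟶ g) {θ : g ⟶ h} :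
    θ ∈ carrier g h → η ≫ θ ∈ carrier f h
  comp_right {a b : B} {f g h : a ⟶ b} {η : f ⟶ g} (θ : g ⟶ h) :
    η ∈ carrier f g → η ≫ θ ∈ carrier f h
  whiskerLeft {a b c : B} (f : a ⟶ b) {g h : b ⟶ c} {η : g ⟶ h} :
    η ∈ carrier g h → f ◁ η ∈ carrier (f ≫ g) (f ≫ h)
  whiskerRight {a b c : B} {f g : a ⟶ b} {η : f ⟶ g} (h : b ⟶ c) :
    η ∈ carrier f g → η ▷ h ∈ carrier (f ≫ h) (g ≫ h)

namespace TwoIdeal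

variable {B : Type u} [Bicategory.{w, v} B] [∀ a b : B, Preadditive (a ⟶ b)]

/-- Congruence of 2-morphisms modulo a 2-ideal. -/
def rel (I : TwoIdeal B) (a b : B) : HomRel (a ⟶ b) := fun f g η θ => η - θ ∈ I.carrier f g

instance (I : TwoIdeal B) (a b : B) : Congruence (I.rel a b) where
  equivalence :=
    { refl := fun η => by simp [rel]
      symm := fun {η θ} h => by simpa [rel] using neg_mem h
      trans := fun {η θ κ} h h' => by simpa [rel] using add_mem h h' }
  comp_left η _ _ h := by
    have := I.comp_left η h
    rwa [Preadditive.comp_sub] at this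
  comp_right η h := by
    have := I.comp_right η h
    rwa [Preadditive.sub_comp] at this

/-- The quotient 2-category `B/I`: same objects and 1-morphisms as `B`, and 2-morphisms are
taken modulo `I`. -/
structure Quot (I : TwoIdeal B) where
  as : B

instance (I : TwoIdeal B) : CategoryStruct I.Quot where
  Hom a b := CategoryTheory.Quotient (I.rel a.as b.as)
  id a := ⟨𝟙 a.as⟩
  comp f g := ⟨f.as ≫ g.as⟩

instance (I : TwoIdeal B) (a b : I.Quot) : Category (a ⟶ b) :=
  inferInstanceAs (Category (CategoryTheory.Quotient (I.rel a.as b.as)))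

instance (I : TwoIdeal B) (a b : I.Quot) : Preadditive (a ⟶ b) :=
  CategoryTheory.Quotient.preadditive (I.rel a.as b.as) (by
    intro f g η₁ η₂ θ₁ θ₂ h h'
    have := add_mem (show _ ∈ I.carrier _ _ from h) (show _ ∈ I.carrier _ _ from h')
    simpa only [rel, add_sub_add_comm] using this)

/-- The class of a 1-morphism in the quotient. -/
def one (I : TwoIdeal B) {a b : B} (f : a ⟶ b) : (⟨a⟩ : I.Quot) ⟶ ⟨b⟩ :=
  (⟨f⟩ : CategoryTheory.Quotient (I.rel a b))

/-- The class of a 2-morphism in the quotient. -/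
def two (I : TwoIdeal B) {a b : B} {f g : a ⟶ b} (η : f ⟶ g) : I.one f ⟶ I.one g :=
  (CategoryTheory.Quotient.functor (I.rel a b)).map η

variable [BiadditiveComp B]

/-- The class of an isomorphism in the quotient. -/
def twoIso (I : TwoIdeal B) {a b : B} {f g : a ⟶ b} (e : f ≅ g) : I.one f ≅ I.one g :=
  (CategoryTheory.Quotient.functor (I.rel a b)).mapIso e

/-- Whiskering on the left in the quotient. -/
def quotWhiskerLeft (I : TwoIdeal B) {a b : B} (f : a ⟶ b) (c : B) :
    CategoryTheory.Quotient (I.rel b c) ⥤ CategoryTheory.Quotient (I.rel a c) :=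
  CategoryTheory.Quotient.lift _ (precomp c f ⋙ CategoryTheory.Quotient.functor _)
    (fun g h η θ hr => CategoryTheory.Quotient.sound _ (by
      have := I.whiskerLeft f hr
      rwa [whiskerLeft_sub] at this))

/-- Whiskering on the right in the quotient. -/
def quotWhiskerRight (I : TwoIdeal B) {b c : B} (h : b ⟶ c) (a : B) :
    CategoryTheory.Quotient (I.rel a b) ⥤ CategoryTheory.Quotient (I.rel a c) :=
  CategoryTheory.Quotient.lift _ (postcomp a h ⋙ CategoryTheory.Quotient.functor _)
    (fun f g η θ hr => CategoryTheory.Quotient.sound _ (by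
      have := I.whiskerRight h hr
      rwa [sub_whiskerRight] at this))

instance (I : TwoIdeal B) : Bicategory I.Quot where
  homCategory := inferInstance
  whiskerLeft {a b c} f _ _ η := (I.quotWhiskerLeft f.as c.as).map η
  whiskerRight {a b c} _ _ η h := (I.quotWhiskerRight h.as a.as).map η
  associator f g h := I.twoIso (α_ f.as g.as h.as)
  leftUnitor f := I.twoIso (λ_ f.as)
  rightUnitor f := I.twoIso (ρ_ f.as)
  whiskerLeft_id _ _ := (I.quotWhiskerLeft _ _).map_id _
  whiskerLeft_comp _ _ _ _ _ _ := (I.quotWhiskerLeft _ _).map_comp _ _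
  id_whiskerLeft := by
    rintro _ _ _ _ ⟨η⟩
    exact congrArg I.two (Bicategory.id_whiskerLeft η)
  comp_whiskerLeft := by
    rintro _ _ _ _ f g _ _ ⟨η⟩
    exact congrArg I.two (Bicategory.comp_whiskerLeft f.as g.as η)
  id_whiskerRight _ _ := (I.quotWhiskerRight _ _).map_id _
  comp_whiskerRight _ _ _ := (I.quotWhiskerRight _ _).map_comp _ _
  whiskerRight_id := by
    rintro _ _ _ _ ⟨η⟩
    exact congrArg I.two (Bicategory.whiskerRight_id η)
  whiskerRight_comp := by
    rintro _ _ _ _ _ _ ⟨η⟩ g h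
    exact congrArg I.two (Bicategory.whiskerRight_comp η g.as h.as)
  whisker_assoc := by
    rintro _ _ _ _ f _ _ ⟨η⟩ h
    exact congrArg I.two (Bicategory.whisker_assoc f.as η h.as)
  whisker_exchange := by
    rintro _ _ _ _ _ _ _ ⟨η⟩ ⟨θ⟩
    exact congrArg I.two (Bicategory.whisker_exchange η θ)
  pentagon _ _ _ _ := congrArg I.two (Bicategory.pentagon _ _ _ _)
  triangle _ _ := congrArg I.two (Bicategory.triangle _ _)

end TwoIdeal

/-! ### Finitary 2-categories, involutions -/

attribute [local instance] hasBinaryBiproducts_of_finite_biproducts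

section Finitary

variable (k : Type*) [Field k] (C : Type u) [Bicategory.{w, v} C]
  [∀ i j : C, Preadditive (i ⟶ j)] [∀ i j : C, Linear k (i ⟶ j)]
  [∀ i j : C, HasFiniteBiproducts (i ⟶ j)]

/-- `C`, whose categories of 1-morphisms are additive and `k`-linear, with biadditive horizontal
composition, is a `k`-finitary 2-category. -/
structure IsFinitary : Prop where
  finite_obj : Finite C
  finiteDimensional {i j : C} (F G : i ⟶ j) : FiniteDimensional k (F ⟶ G)
  isIdempotentComplete (i j : C) : IsIdempotentComplete (i ⟶ j)
  finite_indecomposables (i j : C) : ∃ S : Set (i ⟶ j), S.Finite ∧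
    ∀ F : i ⟶ j, Indecomposable F → ∃ G ∈ S, Nonempty (F ≅ G)
  whiskerLeft_smul {i j l : C} (F : i ⟶ j) {G H : j ⟶ l} (c : k) (η : G ⟶ H) :
    F ◁ (c • η) = c • (F ◁ η)
  smul_whiskerRight {i j l : C} {F G : i ⟶ j} (c : k) (η : F ⟶ G) (H : j ⟶ l) :
    (c • η) ▷ H = c • (η ▷ H)
  indecomposable_id (i : C) : Indecomposable (𝟙 i)

end Finitary

/-- A weak involution on a 2-category: an object-preserving (up to coherent isomorphism)
2-functor reversing the direction of both 1-morphisms and 2-morphisms, whose square is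
isomorphic to the identity. -/
structure Involution (C : Type u) [Bicategory.{w, v} C] where
  star {i j : C} : (i ⟶ j) → (j ⟶ i)
  star₂ {i j : C} {F G : i ⟶ j} : (F ⟶ G) → (star G ⟶ star F)
  star₂_id {i j : C} (F : i ⟶ j) : star₂ (𝟙 F) = 𝟙 (star F)
  star₂_comp {i j : C} {F G H : i ⟶ j} (η : F ⟶ G) (θ : G ⟶ H) :
    star₂ (η ≫ θ) = star₂ θ ≫ star₂ η
  starId (i : C) : star (𝟙 i) ≅ 𝟙 i
  starComp {i j l : C} (F : i ⟶ j) (G : j ⟶ l) : star (F ≫ G) ≅ star G ≫ star F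
  starComp_natural_left {i j l : C} {F F' : i ⟶ j} (η : F ⟶ F') (G : j ⟶ l) :
    star₂ (η ▷ G) ≫ (starComp F G).hom = (starComp F' G).hom ≫ star G ◁ star₂ η
  starComp_natural_right {i j l : C} (F : i ⟶ j) {G G' : j ⟶ l} (θ : G ⟶ G') :
    star₂ (F ◁ θ) ≫ (starComp F G).hom = (starComp F G').hom ≫ star₂ θ ▷ star F
  starComp_assoc {i j l m : C} (F : i ⟶ j) (G : j ⟶ l) (H : l ⟶ m) :
    star₂ (α_ F G H).hom ≫ (starComp (F ≫ G) H).hom ≫ star H ◁ (starComp F G).hom =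
      (starComp F (G ≫ H)).hom ≫ (starComp G H).hom ▷ star F ≫
        (α_ (star H) (star G) (star F)).hom
  starComp_id_left {i j : C} (F : i ⟶ j) :
    star₂ (λ_ F).hom ≫ (starComp (𝟙 i) F).hom ≫ star F ◁ (starId i).hom ≫
      (ρ_ (star F)).hom = 𝟙 (star F)
  starComp_id_right {i j : C} (F : i ⟶ j) :
    star₂ (ρ_ F).hom ≫ (starComp F (𝟙 j)).hom ≫ (starId j).hom ▷ star F ≫
      (λ_ (star F)).hom = 𝟙 (star F)
  starStar {i j : C} (F : i ⟶ j) : star (star F) ≅ F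
  starStar_natural {i j : C} {F G : i ⟶ j} (η : F ⟶ G) :
    star₂ (star₂ η) ≫ (starStar G).hom = (starStar F).hom ≫ η
  starStar_id (i : C) : (starStar (𝟙 i)).hom = star₂ (starId i).inv ≫ (starId i).hom
  starStar_comp {i j l : C} (F : i ⟶ j) (G : j ⟶ l) :
    (starStar (F ≫ G)).hom = star₂ (starComp F G).inv ≫ (starComp (star G) (star F)).hom ≫
      (starStar F).hom ▷ star (star G) ≫ F ◁ (starStar G).hom

/-- The involution has adjunctions: every `F` is left adjoint to `F*`. -/
def Involution.HasAdjunctions {C : Type u} [Bicategory.{w, v} C] (τ : Involution C) : Prop :=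
  ∀ {i j : C} (F : i ⟶ j), Nonempty (Bicategory.Adjunction F (τ.star F))

/-! ### Cells -/

/-- The 1-morphisms of `C`, bundled with their source and target. -/
structure OneMor (C : Type u) [Bicategory.{w, v} C] where
  src : C
  tgt : C
  hom : src ⟶ tgt

namespace OneMor

variable {C : Type u} [Bicategory.{w, v} C]

/-- Isomorphism of 1-morphisms (with the same source and target). -/
inductive Isom : OneMor C → OneMor C → Prop
  | mk {i j : C} {F G : i ⟶ j} (e : F ≅ G) : Isom ⟨i, j, F⟩ ⟨i, j, G⟩

/-- `F ≤_R G`: `G` is a direct summand of `H ∘ F` for some `H`.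
Note that `H ∘ F` is written `F ≫ H`. -/
inductive LeR : OneMor C → OneMor C → Prop
  | mk {i j l : C} (F : i ⟶ j) (H : j ⟶ l) (G : i ⟶ l) (r : Retract G (F ≫ H)) :
      LeR ⟨i, j, F⟩ ⟨i, l, G⟩

/-- `F ≤_L G`: `G` is a direct summand of `F ∘ H` for some `H`. -/
inductive LeL : OneMor C → OneMor C → Prop
  | mk {i j l : C} (F : i ⟶ j) (H : l ⟶ i) (G : l ⟶ j) (r : Retract G (H ≫ F)) :
      LeL ⟨i, j, F⟩ ⟨l, j, G⟩

/-- `F ≤_LR G`: `G` is a direct summand of `H₂ ∘ F ∘ H₁` for some `H₁`, `H₂`. -/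
def LeLR (F G : OneMor C) : Prop :=
  ∃ (H₁ : G.src ⟶ F.src) (H₂ : F.tgt ⟶ G.tgt), Nonempty (Retract G.hom (H₁ ≫ F.hom ≫ H₂))

variable [∀ i j : C, Preadditive (i ⟶ j)] [∀ i j : C, HasFiniteBiproducts (i ⟶ j)]

/-- The 1-morphism is indecomposable in its category of 1-morphisms. -/
def Indec (F : OneMor C) : Prop := Indecomposable F.hom

/-- The right cell of `F`, as an isomorphism-closed set of indecomposable 1-morphisms. -/
def rightCell (F : OneMor C) : Set (OneMor C) := {G | G.Indec ∧ LeR F G ∧ LeR G F}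

/-- The left cell of `F`. -/
def leftCell (F : OneMor C) : Set (OneMor C) := {G | G.Indec ∧ LeL F G ∧ LeL G F}

/-- The two-sided cell of `F`. -/
def twoSidedCell (F : OneMor C) : Set (OneMor C) := {G | G.Indec ∧ LeLR F G ∧ LeLR G F}

end OneMor

section Cells

variable {C : Type u} [Bicategory.{w, v} C]

/-- `H ≤_LR Q`, for a 1-morphism `H` and a two-sided cell `Q`. For decomposable `H` this means
that some indecomposable direct summand of `H` is `≤_LR Q`. -/
def LeCell {i j : C} (H : i ⟶ j) (Q : Set (OneMor C)) : Prop :=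
  ∃ F ∈ Q, OneMor.LeLR ⟨i, j, H⟩ F

lemma LeCell.of_comp_left {Q : Set (OneMor C)} {i j l : C} {F : i ⟶ j} {H : j ⟶ l}
    (h : LeCell (F ≫ H) Q) : LeCell H Q := by
  obtain ⟨G, hG, H₁, H₂, ⟨r⟩⟩ := h
  exact ⟨G, hG, H₁ ≫ F, H₂, ⟨r.trans (Retract.ofIso
    (whiskerLeftIso H₁ (α_ F H H₂) ≪≫ (α_ H₁ F (H ≫ H₂)).symm))⟩⟩

lemma LeCell.of_comp_right {Q : Set (OneMor C)} {i j l : C} {H : i ⟶ j} {F : j ⟶ l}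
    (h : LeCell (H ≫ F) Q) : LeCell H Q := by
  obtain ⟨G, hG, H₁, H₂, ⟨r⟩⟩ := h
  exact ⟨G, hG, H₁, F ≫ H₂, ⟨r.trans (Retract.ofIso (whiskerLeftIso H₁ (α_ H F H₂)))⟩⟩

variable [∀ i j : C, Preadditive (i ⟶ j)] [∀ i j : C, HasFiniteBiproducts (i ⟶ j)]

def IsRightCell (R : Set (OneMor C)) : Prop := ∃ F : OneMor C, F.Indec ∧ R = F.rightCell

def IsLeftCell (L : Set (OneMor C)) : Prop := ∃ F : OneMor C, F.Indec ∧ L = F.leftCell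

def IsTwoSidedCell (Q : Set (OneMor C)) : Prop := ∃ F : OneMor C, F.Indec ∧ Q = F.twoSidedCell

/-- A two-sided cell is strongly regular if different right cells in it are not comparable for
`≤_R`, and every left cell and every right cell in it have exactly one common element (up to
isomorphism). -/
structure IsStronglyRegular (Q : Set (OneMor C)) : Prop where
  isTwoSidedCell : IsTwoSidedCell Q
  regular : ∀ F ∈ Q, ∀ G ∈ Q, OneMor.LeR F G → OneMor.LeR G F
  inter : ∀ L R : Set (OneMor C), IsLeftCell L → IsRightCell R → L ⊆ Q → R ⊆ Q →
    ∃ F ∈ L ∩ R, ∀ G ∈ L ∩ R, OneMor.Isom F G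

variable [BiadditiveComp C]

/-- The 2-ideal `I_Q`: sums of 2-morphisms factoring through some 1-morphism `H` none of whose
indecomposable direct summands is `≤_LR Q`, i.e. 2-morphisms factoring through a direct sum of
indecomposable 1-morphisms which are not `≤_LR Q`. -/
def cellIdeal (Q : Set (OneMor C)) : TwoIdeal C where
  carrier {a b} f g := AddSubgroup.closure
    {η | ∃ (H : a ⟶ b) (α : f ⟶ H) (β : H ⟶ g), ¬ LeCell H Q ∧ η = α ≫ β}
  comp_left {a b f g h} η θ hθ := by
    induction hθ using AddSubgroup.closure_induction with
    | mem x hx =>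
      obtain ⟨H, α, β, hH, rfl⟩ := hx
      exact AddSubgroup.subset_closure ⟨H, η ≫ α, β, hH, by simp⟩
    | zero => simp
    | add x y _ _ hx hy => rw [Preadditive.comp_add]; exact add_mem hx hy
    | neg x _ hx => rw [Preadditive.comp_neg]; exact neg_mem hx
  comp_right {a b f g h} η θ hη := by
    induction hη using AddSubgroup.closure_induction with
    | mem x hx =>
      obtain ⟨H, α, β, hH, rfl⟩ := hx
      exact AddSubgroup.subset_closure ⟨H, α, β ≫ θ, hH, by simp⟩
    | zero => simp
    | add x y _ _ hx hy => rw [Preadditive.add_comp]; exact add_mem hx hy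
    | neg x _ hx => rw [Preadditive.neg_comp]; exact neg_mem hx
  whiskerLeft {a b c} f {g h η} hη := by
    change whiskerLeftHom f g h η ∈ _
    induction hη using AddSubgroup.closure_induction with
    | mem x hx =>
      obtain ⟨H, α, β, hH, rfl⟩ := hx
      exact AddSubgroup.subset_closure ⟨f ≫ H, f ◁ α, f ◁ β, fun h' => hH h'.of_comp_left,
        Bicategory.whiskerLeft_comp f α β⟩
    | zero => simp
    | add x y _ _ hx hy => rw [map_add]; exact add_mem hx hy
    | neg x _ hx => rw [map_neg]; exact neg_mem hx
  whiskerRight {a b c} {f g η} h hη := by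
    change whiskerRightHom f g h η ∈ _
    induction hη using AddSubgroup.closure_induction with
    | mem x hx =>
      obtain ⟨H, α, β, hH, rfl⟩ := hx
      exact AddSubgroup.subset_closure ⟨H ≫ h, α ▷ h, β ▷ h, fun h' => hH h'.of_comp_right,
        Bicategory.comp_whiskerRight α β h⟩
    | zero => simp
    | add x y _ _ hx hy => rw [map_add]; exact add_mem hx hy
    | neg x _ hx => rw [map_neg]; exact neg_mem hx

/-- The 1-morphisms of `C_Q`: those generated in `C/I_Q` by the identities and the elements
of `Q`, under composition, finite direct sums, direct summands and isomorphism. -/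
inductive CellGenerated (Q : Set (OneMor C)) :
    ∀ {a b : (cellIdeal Q).Quot}, (a ⟶ b) → Prop
  | id (a : (cellIdeal Q).Quot) : CellGenerated Q (𝟙 a)
  | mem {i j : C} (F : i ⟶ j) (hF : ⟨i, j, F⟩ ∈ Q) : CellGenerated Q ((cellIdeal Q).one F)
  | comp {a b c : (cellIdeal Q).Quot} (F : a ⟶ b) (G : b ⟶ c) :
      CellGenerated Q F → CellGenerated Q G → CellGenerated Q (F ≫ G)
  | zero {a b : (cellIdeal Q).Quot} (F : a ⟶ b) : IsZero F → CellGenerated Q F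
  | summand {a b : (cellIdeal Q).Quot} (F G H : a ⟶ b) (ι₁ : F ⟶ G) (π₁ : G ⟶ F)
      (ι₂ : F ⟶ H) (π₂ : H ⟶ F) : CellGenerated Q G → CellGenerated Q H →
      ι₁ ≫ π₁ + ι₂ ≫ π₂ = 𝟙 F → CellGenerated Q F

/-- The class of 1-morphisms of `C_Q`. -/
def cellClass (Q : Set (OneMor C)) : OneCellClass (cellIdeal Q).Quot where
  mem _ _ F := CellGenerated Q F
  id_mem := CellGenerated.id
  comp_mem hf hg := CellGenerated.comp _ _ hf hg

/-- The 2-category `C_Q` associated with the two-sided cell `Q`: the full 2-subcategory of `C/I_Q`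
generated by the identities and the elements of `Q`. -/
abbrev CellTwoCat (Q : Set (OneMor C)) := (cellClass Q).Sub

/-- An object of `C`, as an object of `C_Q`. -/
def CellTwoCat.obj (Q : Set (OneMor C)) (i : C) : CellTwoCat Q := ⟨⟨i⟩⟩

/-- The number `m_{F,F}`: the number `m` such that `F* ∘ F` is isomorphic in `C/I_Q` to a direct sum
of `m` copies of `G`, where `G` is the element in the intersection of the left cell
of `F*` and the right cell of `F`. -/
def mCoeff (τ : Involution C) (Q : Set (OneMor C)) (F : OneMor C) : ℕ :=
  sInf {m | ∃ G : F.src ⟶ F.src,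
    ⟨F.src, F.src, G⟩ ∈ OneMor.leftCell ⟨F.tgt, F.src, τ.star F.hom⟩ ∩ OneMor.rightCell F ∧
    Nonempty ((cellIdeal Q).one (F.hom ≫ τ.star F.hom) ≅
      (cellIdeal Q).one (⨁ fun _ : Fin m => G))}

/-- The function `F ↦ m_{F,F}` is constant on left cells of `Q`. -/
def ConstantOnLeftCells (τ : Involution C) (Q : Set (OneMor C)) : Prop :=
  ∀ F ∈ Q, ∀ F' ∈ Q, F' ∈ OneMor.leftCell F → mCoeff τ Q F = mCoeff τ Q F'

end Cells

/-! ### Principal and cell 2-representations -/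

section Linear

variable (k : Type*) [Field k] (V : Type*) [Category* V] [Preadditive V] [Linear k V]

instance : Linear k (Arrow V) where
  homModule X Y :=
    { smul := fun c f => Arrow.homMk (c • f.left) (c • f.right) (by simp)
      one_smul := fun f => by ext <;> exact one_smul k _
      mul_smul := fun a b f => by ext <;> exact mul_smul a b _
      smul_zero := fun a => by ext <;> exact smul_zero a
      smul_add := fun a f g => by ext <;> exact smul_add a _ _
      add_smul := fun a b f => by ext <;> exact add_smul a b _
      zero_smul := fun f => by ext <;> exact zero_smul k _ }
  smul_comp _ _ _ c f g := by ext <;> exact Linear.smul_comp _ _ _ c _ _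
  comp_smul _ _ _ f c g := by ext <;> exact Linear.comp_smul _ _ _ _ c _

instance : Linear k (Preadditive.RightFreyd V) :=
  letI : Preadditive (CategoryTheory.Quotient (Arrow.rightHomotopic V)) :=
    inferInstanceAs (Preadditive (Preadditive.RightFreyd V))
  haveI : (CategoryTheory.Quotient.functor (Arrow.rightHomotopic V)).Additive :=
    inferInstanceAs (Preadditive.RightFreyd.quotient V).Additive
  CategoryTheory.Quotient.linear k (Arrow.rightHomotopic V) (by
    rintro c X Y f g ⟨h⟩
    exact ⟨{ hom := c • h.hom
             comm := (smul_sub c _ _).symm.trans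
               ((congrArg (fun t => c • t) h.comm).trans (Linear.smul_comp _ _ _ c _ _).symm) }⟩)

end Linear

section Principal

open Preadditive (RightFreyd)

variable {C : Type u} [Bicategory.{w, v} C] [∀ i j : C, Preadditive (i ⟶ j)] [BiadditiveComp C]

/-- The action of `F : j ⟶ l` on diagrams `X₁ ⟶ X₀` of 1-morphisms `i ⟶ j`. -/
def prinMap (i : C) {j l : C} (F : j ⟶ l) : RightFreyd (i ⟶ j) ⥤ RightFreyd (i ⟶ l) :=
  CategoryTheory.Quotient.lift _ ((postcomp i F).mapArrow ⋙ RightFreyd.quotient _) (by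
    rintro X Y f g ⟨h⟩
    refine RightFreyd.eq_of_rightHomotopy _ _
      { hom := h.hom ▷ F
        comm := (sub_whiskerRight _ _ F).symm.trans
          ((congrArg (fun t => t ▷ F) h.comm).trans (comp_whiskerRight _ _ F)) })

/-- The action of a 2-morphism. -/
def prinMap₂ (i : C) {j l : C} {F G : j ⟶ l} (α : F ⟶ G) : prinMap i F ⟶ prinMap i G where
  app X := (RightFreyd.quotient _).map
    (Arrow.homMk (u := X.as.left ◁ α) (v := X.as.right ◁ α) (by
      exact (whisker_exchange X.as.hom α)))
  naturality := by
    rintro X Y ⟨f⟩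
    refine congrArg (RightFreyd.quotient _).map ?_
    ext
    · exact (whisker_exchange f.left α).symm
    · exact (whisker_exchange f.right α).symm

/-- The action of identities is isomorphic to the identity. -/
def prinId (i j : C) : prinMap i (𝟙 j) ≅ 𝟭 (RightFreyd (i ⟶ j)) :=
  NatIso.ofComponents
    (fun X => (RightFreyd.quotient _).mapIso
      (Arrow.isoMk (ρ_ X.as.left) (ρ_ X.as.right) (rightUnitor_naturality X.as.hom).symm))
    (by
      rintro X Y ⟨f⟩
      refine congrArg (RightFreyd.quotient _).map ?_
      ext
      · exact rightUnitor_naturality f.left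
      · exact rightUnitor_naturality f.right)

/-- The action is compatible with composition of 1-morphisms. -/
def prinComp (i : C) {j l m : C} (F : j ⟶ l) (G : l ⟶ m) :
    prinMap i (F ≫ G) ≅ prinMap i F ⋙ prinMap i G :=
  NatIso.ofComponents
    (fun X => (RightFreyd.quotient _).mapIso
      (Arrow.isoMk (α_ X.as.left F G).symm (α_ X.as.right F G).symm
        (associator_inv_naturality_left X.as.hom F G).symm))
    (by
      rintro X Y ⟨f⟩
      refine congrArg (RightFreyd.quotient _).map ?_
      ext
      · exact associator_inv_naturality_left f.left F G
      · exact associator_inv_naturality_left f.right F G)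

lemma RightFreyd.quotient_congr {V : Type*} [Category* V] [Preadditive V] {X Y : Arrow V}
    {f g : X ⟶ Y} (h₁ : f.left = g.left) (h₂ : f.right = g.right) :
    (RightFreyd.quotient V).map f = (RightFreyd.quotient V).map g := by
  congr 1
  ext
  · exact h₁
  · exact h₂

/-- The `i`-th principal 2-representation `P_i`: it sends `j` to the category of diagrams
`X₁ ⟶ X₀` of 1-morphisms `i ⟶ j` modulo homotopy, on which `C` acts by
horizontal composition. -/
def principal (i : C) : Pseudofunctor C Cat.{w, max w v} where
  obj j := Cat.of (RightFreyd (i ⟶ j))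
  map F := (prinMap i F).toCatHom
  map₂ α := (prinMap₂ i α).toCatHom₂
  map₂_id F := by
    ext X
    exact RightFreyd.quotient_congr (whiskerLeft_id _ _) (whiskerLeft_id _ _)
  map₂_comp α β := by
    ext X
    exact RightFreyd.quotient_congr (whiskerLeft_comp _ _ _) (whiskerLeft_comp _ _ _)
  mapId j := Cat.Hom.isoMk (prinId i j)
  mapComp F G := Cat.Hom.isoMk (prinComp i F G)
  map₂_whisker_left F G H η := by
    ext X
    have key : ∀ Y : i ⟶ _, Y ◁ F ◁ η =
        (α_ Y F G).inv ≫ (Y ≫ F) ◁ η ≫ (α_ Y F H).hom := fun Y => by simp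
    exact RightFreyd.quotient_congr (key _) (key _)
  map₂_whisker_right {_ _ _ F G} η H := by
    ext X
    have key : ∀ Y : i ⟶ _, Y ◁ η ▷ H =
        (α_ Y F H).inv ≫ (Y ◁ η) ▷ H ≫ (α_ Y G H).hom := fun Y => by simp
    exact RightFreyd.quotient_congr (key _) (key _)
  map₂_associator F G H := by
    ext X
    have key : ∀ Y : i ⟶ _, Y ◁ (α_ F G H).hom =
        (α_ Y (F ≫ G) H).inv ≫ (α_ Y F G).inv ▷ H ≫ 𝟙 _ ≫ (α_ (Y ≫ F) G H).hom ≫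
          (α_ Y F (G ≫ H)).hom := fun Y => by simp
    exact RightFreyd.quotient_congr (key _) (key _)
  map₂_left_unitor F := by
    ext X
    have key : ∀ Y : i ⟶ _, Y ◁ (λ_ F).hom =
        (α_ Y (𝟙 _) F).inv ≫ (ρ_ Y).hom ▷ F ≫ 𝟙 _ := fun Y => by simp
    exact RightFreyd.quotient_congr (key _) (key _)
  map₂_right_unitor F := by
    ext X
    have key : ∀ Y : i ⟶ _, Y ◁ (ρ_ F).hom =
        (α_ Y F (𝟙 _)).inv ≫ (ρ_ (Y ≫ F)).hom ≫ 𝟙 _ := fun Y => by simp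
    exact RightFreyd.quotient_congr (key _) (key _)

end Principal

section CellRep

open Preadditive (RightFreyd)

/-- The objects which are direct summands of finite direct sums of objects satisfying `S`. -/
def addClosure {V : Type*} [Category* V] [Preadditive V] (S : ObjectProperty V) :
    ObjectProperty V := fun X =>
  ∃ (n : ℕ) (Y : Fin n → V) (ι : ∀ t, X ⟶ Y t) (π : ∀ t, Y t ⟶ X),
    (∀ t, S (Y t)) ∧ ∑ t, ι t ≫ π t = 𝟙 X

variable {C : Type u} [Bicategory.{w, v} C] [∀ i j : C, Preadditive (i ⟶ j)]
  [∀ i j : C, HasFiniteBiproducts (i ⟶ j)]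

/-- The projective object `P_F`, i.e. the diagram `0 ⟶ F`. -/
def projObj {i j : C} (F : i ⟶ j) : RightFreyd (i ⟶ j) := (RightFreyd.functor _).obj F

variable [BiadditiveComp C]

/-- `S` is a subquotient of `N`. -/
def IsSubquotient {V : Type*} [Category* V] (S N : V) : Prop :=
  ∃ (M : V) (m : M ⟶ N) (e : M ⟶ S), Mono m ∧ Epi e

/-- `L` is the simple top of `K` via `e`: it is a simple quotient of `K` through which every
morphism from `K` to a simple object factors. -/
structure IsSimpleTop {V : Type*} [Category* V] [HasZeroMorphisms V] {K L : V} (e : K ⟶ L) :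
    Prop where
  simple : Simple L
  epi : Epi e
  factors (S : V) (hS : Simple S) (f : K ⟶ S) : ∃ g : L ⟶ S, f = e ≫ g

/-- `L` is the simple top `L_{G_R}` of the subobject `K_R` of `P_{𝟙 i}`: every simple subquotient
of `P_{𝟙 i}/K_R` is annihilated by all elements of `R`, and `K_R` has a simple top, of the form
`L_G` (the simple top of `P_G`) with `G` indecomposable, which is not annihilated by any element
of `R`. -/
def IsCellTop (R : Set (OneMor C)) (i : C) (L : RightFreyd (i ⟶ i)) : Prop :=
  ∃ (K N : RightFreyd (i ⟶ i)) (ι : K ⟶ projObj (𝟙 i)) (π : projObj (𝟙 i) ⟶ N) (hw : ι ≫ π = 0),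
    Mono ι ∧ Nonempty (IsColimit (CokernelCofork.ofπ π hw)) ∧
    (∀ S : RightFreyd (i ⟶ i), Simple S → IsSubquotient S N →
      ∀ (j : C) (F : i ⟶ j), ⟨i, j, F⟩ ∈ R → IsZero ((prinMap i F).obj S)) ∧
    (∃ e : K ⟶ L, IsSimpleTop e) ∧
    (∃ (G : i ⟶ i) (p : projObj G ⟶ L), Indecomposable G ∧ IsSimpleTop p) ∧
    ∀ (j : C) (F : i ⟶ j), ⟨i, j, F⟩ ∈ R → ¬ IsZero ((prinMap i F).obj L)

open Classical in
/-- The simple object `L_{G_R}` (with a junk value if there is none). -/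
def cellTop (R : Set (OneMor C)) (i : C) : RightFreyd (i ⟶ i) :=
  if h : ∃ L, IsCellTop R i L then h.choose else projObj (𝟙 i)

/-- The objects `F L_{G_R}`, for `F` in `R` and with target `j`. -/
def cellGenerators (R : Set (OneMor C)) (i j : C) : ObjectProperty (RightFreyd (i ⟶ j)) :=
  fun X => ∃ F : i ⟶ j, ⟨i, j, F⟩ ∈ R ∧ X = (prinMap i F).obj (cellTop R i)

/-- The objects `M` of `P_i(j)` with a presentation `X₁ ⟶ X₀ ⟶ M ⟶ 0`, where `X₁` and `X₀` are
direct summands of finite direct sums of objects `F L_{G_R}`, for `F` in `R`. -/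
def cellObjects (R : Set (OneMor C)) (i j : C) : ObjectProperty (RightFreyd (i ⟶ j)) :=
  fun M => ∃ (X₁ X₀ : RightFreyd (i ⟶ j)) (f : X₁ ⟶ X₀) (g : X₀ ⟶ M) (hw : f ≫ g = 0),
    addClosure (cellGenerators R i j) X₁ ∧ addClosure (cellGenerators R i j) X₀ ∧
      Nonempty (IsColimit (CokernelCofork.ofπ g hw))

/-- The full subcategories `C_R(j)` of the `P_i(j)`, for `R` a right cell whose elements have source
`i`. If they are stable under the action of `C`, then `(cellProp R i).fullsubcategory` is the cell
2-representation `C_R`, obtained from `P_i` by restriction. -/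
def cellProp (R : Set (OneMor C)) (i : C) : (principal i).ObjectProperty where
  prop j := cellObjects R i j

instance (R : Set (OneMor C)) (i j : C) : Preadditive ((cellProp R i).Obj j) :=
  inferInstanceAs (Preadditive (cellObjects R i j).FullSubcategory)

instance (k : Type*) [Field k] [∀ i j : C, Linear k (i ⟶ j)] (R : Set (OneMor C)) (i j : C) :
    Linear k ((cellProp R i).Obj j) :=
  inferInstanceAs (Linear k (cellObjects R i j).FullSubcategory)

end CellRep

/-! ### Finite dimensional algebras and projective functors -/

section Algebras

open TensorProduct MulOpposite

/-- The socle of a module: the sum of its simple submodules. -/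
def socle (A : Type*) [Ring A] (M : Type*) [AddCommGroup M] [Module A M] : Submodule A M :=
  sSup {N | IsSimpleModule A N}

/-- The top and the socle of every finitely generated projective module are isomorphic. -/
def IsWeaklySymmetric (A : Type t) [Ring A] : Prop :=
  ∀ (P : Type t) [AddCommGroup P] [Module A P] [Module.Finite A P] [Module.Projective A P],
    Nonempty ((P ⧸ Module.jacobson A P) ≃ₗ[A] socle A P)

section Tensor

variable (R S : Type t) [Ring R] [Ring S] (B : Type t) [AddCommGroup B] [Module S B] [Module Rᵐᵒᵖ B]

/-- The submodule of `B ⊗_ℤ M` generated by the elements `b r ⊗ m - b ⊗ r m`. -/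
def balancedRel (M : Type t) [AddCommGroup M] [Module R M] : Submodule S (B ⊗[ℤ] M) :=
  Submodule.span S {x | ∃ (b : B) (r : R) (m : M), x = (op r • b) ⊗ₜ[ℤ] m - b ⊗ₜ[ℤ] (r • m)}

/-- The functor `B ⊗_R -` from left `R`-modules to left `S`-modules, for an `S`-`R`-bimodule `B`. -/
def tensorFunctor : ModuleCat.{t} R ⥤ ModuleCat.{t} S where
  obj M := ModuleCat.of S ((B ⊗[ℤ] M) ⧸ balancedRel R S B M)
  map {M N} f := ModuleCat.ofHom (Submodule.mapQ _ _
    (AlgebraTensorModule.lTensor S B (f.hom.toAddMonoidHom.toIntLinearMap)) (by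
      rw [balancedRel, Submodule.span_le]
      rintro _ ⟨b, r, m, rfl⟩
      refine Submodule.subset_span ⟨b, r, f.hom m, ?_⟩
      simp))
  map_id M := by
    refine ModuleCat.hom_ext (LinearMap.ext fun y => ?_)
    obtain ⟨x, rfl⟩ := Submodule.Quotient.mk_surjective _ y
    induction x with
    | zero => simp
    | tmul b m => rfl
    | add x y hx hy => rw [Submodule.Quotient.mk_add, map_add, map_add, hx, hy]
  map_comp f g := by
    refine ModuleCat.hom_ext (LinearMap.ext fun y => ?_)
    obtain ⟨x, rfl⟩ := Submodule.Quotient.mk_surjective _ y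
    induction x with
    | zero => simp
    | tmul b m => rfl
    | add x y hx hy => rw [Submodule.Quotient.mk_add, map_add, map_add, hx, hy]

end Tensor

variable (k : Type*) [Field k]

/-- `B` is a (finitely generated) projective `S`-`R`-bimodule (on which `k` acts centrally), i.e.
a finitely generated projective left module over `S ⊗ₖ Rᵒᵖ`. -/
def IsProjectiveBimodule (R S : Type t) [Ring R] [Ring S] [Algebra k R] [Algebra k S] (B : Type t)
    [AddCommGroup B] [Module k B] [Module S B] [Module Rᵐᵒᵖ B] [IsScalarTower k S B]
    [IsScalarTower k Rᵐᵒᵖ B] [SMulCommClass S Rᵐᵒᵖ B] : Prop :=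
  letI : Module (S ⊗[k] Rᵐᵒᵖ) B := TensorProduct.Algebra.module
  Module.Finite (S ⊗[k] Rᵐᵒᵖ) B ∧ Module.Projective (S ⊗[k] Rᵐᵒᵖ) B

/-- A projective functor `R-mod ⥤ S-mod`: a functor isomorphic to tensoring with a projective
`S`-`R`-bimodule. -/
def IsProjectiveFunctor {R S : Type t} [Ring R] [Ring S] [Algebra k R] [Algebra k S]
    (Φ : FGModuleCat.{t} R ⥤ FGModuleCat.{t} S) : Prop :=
  ∃ (B : Type t) (_ : AddCommGroup B) (_ : Module k B) (_ : Module S B) (_ : Module Rᵐᵒᵖ B)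
    (_ : IsScalarTower k S B) (_ : IsScalarTower k Rᵐᵒᵖ B) (_ : SMulCommClass S Rᵐᵒᵖ B),
    IsProjectiveBimodule k R S B ∧
      Nonempty (Φ ⋙ (ModuleCat.isFG S).ι ≅ (ModuleCat.isFG R).ι ⋙ tensorFunctor R S B)

variable {I : Type u} (A : I → Type t) [∀ i, Ring (A i)] [∀ i, Algebra k (A i)]

/-- The functors between the categories `A_i-mod` generated, under composition, finite direct sums,
direct summands and isomorphism, by the identities and the projective functors. -/
inductive ProjGenerated : ∀ {i j : I}, (FGModuleCat.{t} (A i) ⥤ FGModuleCat.{t} (A j)) → Prop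
  | id (i : I) : ProjGenerated (𝟭 (FGModuleCat.{t} (A i)))
  | proj {i j : I} (Φ : FGModuleCat.{t} (A i) ⥤ FGModuleCat.{t} (A j)) :
      IsProjectiveFunctor k Φ → ProjGenerated Φ
  | comp {i j l : I} (Φ : FGModuleCat.{t} (A i) ⥤ FGModuleCat.{t} (A j))
      (Ψ : FGModuleCat.{t} (A j) ⥤ FGModuleCat.{t} (A l)) :
      ProjGenerated Φ → ProjGenerated Ψ → ProjGenerated (Φ ⋙ Ψ)
  | zero {i j : I} (Φ : FGModuleCat.{t} (A i) ⥤ FGModuleCat.{t} (A j)) :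
      IsZero Φ → ProjGenerated Φ
  | summand {i j : I} (Φ Ψ Θ : FGModuleCat.{t} (A i) ⥤ FGModuleCat.{t} (A j))
      (ι₁ : Φ ⟶ Ψ) (π₁ : Ψ ⟶ Φ) (ι₂ : Φ ⟶ Θ) (π₂ : Θ ⟶ Φ) : ProjGenerated Ψ → ProjGenerated Θ →
      ι₁ ≫ π₁ + ι₂ ≫ π₂ = 𝟙 Φ → ProjGenerated Φ

/-- The 2-category of the categories `A_i-mod`, `i ∈ I`, all functors between them and all natural
transformations. -/
abbrev ModTwoCat (I : Type u) (A : I → Type t) [∀ i, Ring (A i)] :=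
  InducedBicategory Cat.{t, t + 1} (fun i : I => Cat.of (FGModuleCat.{t} (A i)))

/-- The class of 1-morphisms of `C_A`. -/
def projClass : OneCellClass (ModTwoCat I A) where
  mem a b f := ProjGenerated k A (i := a) (j := b) f.hom.toFunctor
  id_mem a := ProjGenerated.id (k := k) (A := A) a
  comp_mem hf hg := ProjGenerated.comp _ _ hf hg

/-- The 2-category `C_A`: its objects are (symbols for) the categories `A_i-mod`, its 1-morphisms are
the functors generated by the identities and the projective functors, and its 2-morphisms are all
natural transformations. -/
abbrev ProjTwoCat := (projClass k A).Sub

/-- The object of `C_A` given by the category `A_i-mod`. -/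
def ProjTwoCat.obj (i : I) : ProjTwoCat k A := ⟨i⟩

variable {k A}

/-- The index of an object of `C_A`. -/
def ProjTwoCat.idx (a : ProjTwoCat k A) : I := a.as

/-- The functor underlying a 1-morphism of `C_A`. -/
def ProjTwoCat.functor {a b : ProjTwoCat k A} (f : a ⟶ b) :
    FGModuleCat.{t} (A a.idx) ⥤ FGModuleCat.{t} (A b.idx) :=
  f.obj.hom.toFunctor

/-- The natural transformation underlying a 2-morphism of `C_A`. -/
def ProjTwoCat.natTrans {a b : ProjTwoCat k A} {f g : a ⟶ b} (η : f ⟶ g) :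
    ProjTwoCat.functor f ⟶ ProjTwoCat.functor g :=
  (InducedBicategory.Hom₂.hom (OneCellClass.Sub.hom₂ η)).toNatTrans

variable (A) in
/-- The identity functor of `A_x-mod`, as a functor to `A_y-mod`, if `x = y`. -/
def castFunctor {x y : I} (h : x = y) : FGModuleCat.{t} (A x) ⥤ FGModuleCat.{t} (A y) :=
  h ▸ 𝟭 (FGModuleCat.{t} (A x))

end Algebras

/-! ### Comparison of 2-functors with cell 2-representations -/

section Comparison

variable {k : Type*} [Field k] {C : Type u} [Bicategory.{w, v} C] [∀ i j : C, Preadditive (i ⟶ j)]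
  [∀ i j : C, HasFiniteBiproducts (i ⟶ j)] [BiadditiveComp C]

namespace CellTwoCat

variable {Q : Set (OneMor C)}

/-- The object of `C` underlying an object of `C_Q`. -/
def under (a : CellTwoCat Q) : C := a.as.as

/-- A 1-morphism of `C` underlying a 1-morphism of `C_Q`. -/
def rep {a b : CellTwoCat Q} (F : a ⟶ b) : a.under ⟶ b.under := F.obj.as

/-- The 2-morphism of `C_Q` given by a 2-morphism of `C`. -/
def two {a b : CellTwoCat Q} {F G : a ⟶ b} (η : rep F ⟶ rep G) : F ⟶ G :=
  ObjectProperty.homMk ((cellIdeal Q).two η)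

/-- The 1-morphism of `C_Q` given by an element of `Q`. -/
def ofMem {i j : C} (F : i ⟶ j) (hF : ⟨i, j, F⟩ ∈ Q) : obj Q i ⟶ obj Q j :=
  ⟨(cellIdeal Q).one F, CellGenerated.mem F hF⟩

end CellTwoCat

open CellTwoCat ProjTwoCat

variable (R : Set (OneMor C)) (i : C) [(cellProp R i).IsClosedUnderMapObj]
  {A : C → Type t} [∀ j, Ring (A j)] [∀ j, Algebra k (A j)]
  (E : ∀ j, (cellProp R i).Obj j ⥤ FGModuleCat.{t} (A j))

/-- The functor `E j`, with its codomain `A_j-mod` written as `A_x-mod` if `j = x`. -/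
def identification {j x : C} (h : j = x) : (cellProp R i).Obj j ⥤ FGModuleCat.{t} (A x) :=
  E j ⋙ castFunctor A h

variable (k) (Q : Set (OneMor C))

/-- A 2-functor `Φ` from `C_Q` to `C_A` which is the identity on objects and which is, under the
identifications `E j : C_R(j) ≌ A_j-mod`, induced by the cell 2-representation `C_R`: for every
1-morphism `F` of `C_Q` the functor `Φ(F)` corresponds to `C_R(F)` via a natural isomorphism, and
these isomorphisms are compatible with 2-morphisms, identities and composition. -/
structure InducedTwoFunctor where
  Φ : Pseudofunctor (CellTwoCat Q) (ProjTwoCat k A)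
  obj_eq (a : CellTwoCat Q) : a.under = (Φ.obj a).idx
  θ {a b : CellTwoCat Q} (F : a ⟶ b) :
    (cellProp R i).map (rep F) ⋙ identification R i E (obj_eq b) ≅
      identification R i E (obj_eq a) ⋙ functor (Φ.map F)
  natural {a b : CellTwoCat Q} {F G : a ⟶ b} (η : rep F ⟶ rep G)
      (M : (cellProp R i).Obj a.under) :
    (identification R i E (obj_eq b)).map (((cellProp R i).map₂ η).app M) ≫ (θ G).hom.app M =
      (θ F).hom.app M ≫
        (natTrans (Φ.map₂ (two η))).app ((identification R i E (obj_eq a)).obj M)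
  map_id (a : CellTwoCat Q) (M : (cellProp R i).Obj a.under) :
    (θ (𝟙 a)).hom.app M ≫
        (natTrans (Φ.mapId a).hom).app ((identification R i E (obj_eq a)).obj M) =
      (identification R i E (obj_eq a)).map (((cellProp R i).mapId a.under).hom.app M)
  map_comp {a b c : CellTwoCat Q} (F : a ⟶ b) (G : b ⟶ c) (M : (cellProp R i).Obj a.under) :
    (θ (F ≫ G)).hom.app M ≫
        (natTrans (Φ.mapComp F G).hom).app ((identification R i E (obj_eq a)).obj M) =
      (identification R i E (obj_eq c)).map
          (((cellProp R i).mapComp (rep F) (rep G)).hom.app M) ≫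
        (θ G).hom.app (((cellProp R i).map (rep F)).obj M) ≫
          (functor (Φ.map G)).map ((θ F).hom.app M)

end Comparison

end

end FiatCell

open FiatCell

namespace FiatCell

noncomputable section

attribute [local instance] hasBinaryBiproducts_of_finite_biproducts

/-! ### Direct summands of direct sums, local objects -/

section AddClosure

variable {V : Type*} [Category* V] [Preadditive V]

/-! Write `L` for `cellTop R i`, the simple top of `K = K_R`. On the abelian categories `P_i(j)`
every 1-morphism `F` acts exactly, because `F*` is both left and right adjoint to it. An element `F`
of `R` kills `P_1 / K`, so `F K ≅ P_F`, and `F L` is a nonzero quotient of the local projective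
object `P_F`.

The cell is controlled by the projective cover `P_G` of `L`. A nonzero morphism `P_Y → X L`
transposes to a nonzero morphism `P_{X* Y} → L`, which forces `G` to be a summand of `X* Y`.
Together with strong regularity this yields `G ∈ R`, `G ≅ G*`, and `F* H L ∈ add (G L)` for `F`, `H`
in `R` (`G_mem`, `nonempty_iso_star`, `addClosure_act_star`). By adjunction, every morphism `F K → H
L` factors through `F L` (`factor`). As `F K` is projective, `F L` is projective relative to
quotients of sums of such objects, so the sum of the `F L` over the finitely many `F` of target `j`
is a progenerator of `C_R(j)`, and `Hom` out of it identifies `C_R(j)` with a module category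
(`exists_isProgenerator`).

Let `T` be the simple top of `G L` in `C_R(i)`. For `H` in `R` one has `H T ≅ H L` (`exists_top`),
while `H` kills all other simple objects. Dévissage shows that `H`, and then every element of `Q`,
sends all objects to projective ones (`projective_cellMap`). Self-injectivity follows: `H*` turns a
monomorphism into a split one, its cokernel being projective, so morphisms into `H T` extend by
adjunction. For weak symmetry, a simple subobject `S` of `H L` has `H* S ≠ 0`, hence receives a
nonzero morphism from some `H Y L ∈ add (H L)`, so it is the top of `H L`; over an algebraically
closed field the injective object `H L`, whose endomorphism ring is local, contains it only once.

An element `F` of `Q` kills all simple objects of `C_R(j)` except possibly the top `S₀` of `Y L`,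
where `Y` is the common element of `R` and the left cell of `F*`. Exactness then gives `F ≅ F S₀ ⊗
Hom(Y L, -)` by the five lemma (`bijective_evalMap`). This is tensoring with a projective bimodule,
since `F S₀` and `Y L` are projective.

Finally, a 1-morphism that is not `≤_LR Q` acts by zero (`isZero_cellMap_of_not_leCell`), so the
action descends to `C/I_Q`; conjugating it by the equivalences with module categories gives the
2-functor (`inducedTwoFunctor`). -/

lemma addClosure.of_fintype {S : ObjectProperty V} {X : V} {T : Type*} [Fintype T] (Y : T → V)
    (a : ∀ t, X ⟶ Y t) (b : ∀ t, Y t ⟶ X) (hY : ∀ t, S (Y t)) (h : ∑ t, a t ≫ b t = 𝟙 X) :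
    addClosure S X := by
  let e := Fintype.equivFin T
  refine ⟨Fintype.card T, fun t => Y (e.symm t), fun t => a _, fun t => b _, fun t => hY _, ?_⟩
  rw [← h]
  exact e.symm.sum_comp (fun t => a t ≫ b t)

lemma addClosure.of_mem {S : ObjectProperty V} {X : V} (h : S X) : addClosure S X :=
  addClosure.of_fintype (T := Unit) (fun _ => X) (fun _ => 𝟙 X) (fun _ => 𝟙 X) (fun _ => h)
    (by simp)

lemma addClosure.of_isZero {S : ObjectProperty V} {X : V} (h : IsZero X) : addClosure S X :=
  addClosure.of_fintype (T := Empty) (fun _ => X) (fun _ => 𝟙 X) (fun _ => 𝟙 X) (fun t => t.elim)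
    (h.eq_of_src _ _)

lemma addClosure.retract {S : ObjectProperty V} {X Y : V} (r : Retract X Y)
    (h : addClosure S Y) : addClosure S X := by
  obtain ⟨n, Z, a, b, hZ, hs⟩ := h
  refine ⟨n, Z, fun t => r.i ≫ a t, fun t => b t ≫ r.r, hZ, ?_⟩
  have : ∑ t, (r.i ≫ a t) ≫ b t ≫ r.r = r.i ≫ (∑ t, a t ≫ b t) ≫ r.r := by
    simp [Preadditive.comp_sum, Preadditive.sum_comp]
  rw [this, hs]
  simp

lemma addClosure.of_iso {S : ObjectProperty V} {X Y : V} (e : X ≅ Y)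
    (h : addClosure S Y) : addClosure S X := h.retract (Retract.ofIso e)

lemma addClosure.trans {S T : ObjectProperty V} {X : V} (h : addClosure S X)
    (hST : ∀ Y, S Y → addClosure T Y) : addClosure T X := by
  obtain ⟨n, Z, a, b, hZ, hs⟩ := h
  choose m W c d hW hm using fun t => hST _ (hZ t)
  refine addClosure.of_fintype (T := Σ t : Fin n, Fin (m t)) (fun p => W p.1 p.2)
    (fun p => a p.1 ≫ c p.1 p.2) (fun p => d p.1 p.2 ≫ b p.1) (fun p => hW _ _) ?_
  rw [Fintype.sum_sigma, ← hs]
  refine Finset.sum_congr rfl fun t _ => ?_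
  have : ∑ s, (a t ≫ c t s) ≫ d t s ≫ b t = a t ≫ (∑ s, c t s ≫ d t s) ≫ b t := by
    simp [Preadditive.comp_sum, Preadditive.sum_comp]
  rw [this, hm]
  simp

lemma addClosure.mono {S T : ObjectProperty V} {X : V} (h : addClosure S X)
    (hST : ∀ Y, S Y → T Y) : addClosure T X :=
  h.trans fun Y hY => .of_mem (hST Y hY)

lemma addClosure.map {W : Type*} [Category* W] [Preadditive W] (F : V ⥤ W) [F.Additive]
    {S : ObjectProperty V} {T : ObjectProperty W} {X : V} (h : addClosure S X)
    (hST : ∀ Y, S Y → T (F.obj Y)) : addClosure T (F.obj X) := by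
  obtain ⟨n, Z, a, b, hZ, hs⟩ := h
  refine ⟨n, fun t => F.obj (Z t), fun t => F.map (a t), fun t => F.map (b t),
    fun t => hST _ (hZ t), ?_⟩
  simp_rw [← F.map_comp, ← F.map_sum, hs, F.map_id]

lemma addClosure.biprod [HasBinaryBiproducts V] {S : ObjectProperty V} {X Y : V}
    (hX : addClosure S X) (hY : addClosure S Y) : addClosure S (X ⊞ Y) := by
  refine addClosure.trans (S := addClosure S) ?_ (fun _ h => h)
  refine addClosure.of_fintype (T := Bool) (fun b => if b then X else Y)
    (fun b => match b with | true => biprod.fst | false => biprod.snd)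
    (fun b => match b with | true => biprod.inl | false => biprod.inr) (by simp [hX, hY]) ?_
  simp [biprod.total]

/-- A morphism out of a direct summand of a direct sum vanishes if it does so on all summands. -/
lemma addClosure.hom_ext {S : ObjectProperty V} {X Y : V} (h : addClosure S X) {f g : X ⟶ Y}
    (hfg : ∀ Z (b : Z ⟶ X), S Z → b ≫ f = b ≫ g) : f = g := by
  obtain ⟨n, Z, a, b, hZ, hs⟩ := h
  rw [← Category.id_comp f, ← Category.id_comp g, ← hs, Preadditive.sum_comp,
    Preadditive.sum_comp]
  refine Finset.sum_congr rfl fun t _ => ?_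
  rw [Category.assoc, Category.assoc, hfg _ _ (hZ t)]

/-- A property of morphisms out of the summands which is stable under sums and composition holds
for all morphisms. -/
lemma addClosure.hom_lift {S : ObjectProperty V} {X M N : V} (h : addClosure S X) (g : M ⟶ N)
    (hS : ∀ Z, S Z → ∀ f : Z ⟶ N, ∃ f', f' ≫ g = f) (f : X ⟶ N) : ∃ f', f' ≫ g = f := by
  obtain ⟨n, Z, a, b, hZ, hs⟩ := h
  choose f' hf' using fun t => hS (Z t) (hZ t) (b t ≫ f)
  refine ⟨∑ t, a t ≫ f' t, ?_⟩
  rw [Preadditive.sum_comp]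
  simp_rw [Category.assoc, hf', ← Category.assoc, ← Preadditive.sum_comp, hs, Category.id_comp]

lemma addClosure.map_eq {S : ObjectProperty V} {X M N : V} (h : addClosure S X) (p : M ⟶ N)
    (hS : ∀ Z, S Z → ∀ f : M ⟶ Z, ∃ f', f = p ≫ f') (f : M ⟶ X) : ∃ f', f = p ≫ f' := by
  obtain ⟨n, Z, a, b, hZ, hs⟩ := h
  choose f' hf' using fun t => hS (Z t) (hZ t) (f ≫ a t)
  refine ⟨∑ t, f' t ≫ b t, ?_⟩
  rw [Preadditive.comp_sum]
  simp_rw [← Category.assoc, ← hf', Category.assoc, ← Preadditive.comp_sum, hs, Category.comp_id]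

lemma addClosure.exists_summand {S : ObjectProperty V} {X Y : V} (h : addClosure S X)
    {f : X ⟶ Y} (hf : f ≠ 0) : ∃ Z, S Z ∧ ∃ b : Z ⟶ X, b ≫ f ≠ 0 := by
  by_contra! H
  exact hf (h.hom_ext fun Z b hZ => by rw [H Z hZ b, comp_zero])

/-- A nonzero object, all of whose endomorphisms are isomorphisms or nilpotent. -/
structure IsLocalObj (X : V) : Prop where
  not_isZero : ¬ IsZero X
  isIso_or_isNilpotent (f : X ⟶ X) : IsIso f ∨ IsNilpotent (End.of f)

/-- After normalising the sum to the identity, if one summand is nilpotent then the other is `1`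
minus a nilpotent. -/
lemma IsLocalObj.isIso_of_add {X : V} (hX : IsLocalObj X) {f g : X ⟶ X} (h : IsIso (f + g)) :
    IsIso f ∨ IsIso g := by
  have key : ∀ f' g' : X ⟶ X, f' + g' = 𝟙 X → IsIso f' ∨ IsIso g' := by
    intro f' g' h'
    rcases hX.isIso_or_isNilpotent f' with h1 | h1
    · exact .inl h1
    · right
      have h2 : (1 : End X) - End.of f' = End.of g' := by
        rw [sub_eq_iff_eq_add, add_comm]; exact h'.symm
      have h3 := h1.isUnit_one_sub
      rw [h2] at h3
      exact (isUnit_iff_isIso g').1 h3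
  have := key (inv (f + g) ≫ f) (inv (f + g) ≫ g) (by
    rw [← Preadditive.comp_add, IsIso.inv_hom_id])
  rcases this with h1 | h1
  · exact .inl (IsIso.of_isIso_comp_left (inv (f + g)) f)
  · exact .inr (IsIso.of_isIso_comp_left (inv (f + g)) g)

end AddClosure

/-! ### Krull–Schmidt: indecomposable objects are local, and objects decompose. -/

section Local

/-- Fitting's lemma in the commutative Artinian algebra `k[a]`: the powers of `a` stabilise up to a
factor `y`, and `a ^ n * y ^ n` is an idempotent, which is `0` exactly in the nilpotent case and `1`
exactly in the invertible case. -/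
lemma isUnit_or_isNilpotent_of_idempotents (k : Type*) [Field k] {A : Type*} [Ring A] [Algebra k A]
    [FiniteDimensional k A] (h : ∀ e : A, e * e = e → e = 0 ∨ e = 1) (a : A) :
    IsUnit a ∨ IsNilpotent a := by
  let B := Algebra.adjoin k {a}
  have : IsMulCommutative B := Algebra.isMulCommutative_adjoin k (by simp)
  let _ : CommRing B := inferInstance
  have : FiniteDimensional k B := inferInstanceAs (FiniteDimensional k B.toSubmodule)
  have : IsArtinianRing B := IsArtinianRing.of_finite k B
  let r : B := ⟨a, Algebra.self_mem_adjoin_singleton k a⟩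
  obtain ⟨n, y, hy⟩ := IsArtinian.exists_pow_succ_smul_dvd r (1 : B)
  simp only [smul_eq_mul, mul_one] at hy
  have hpow : ∀ m : ℕ, r ^ n = r ^ n * (r ^ m * y ^ m) := by
    intro m
    induction m with
    | zero => simp
    | succ m ih =>
      calc r ^ n = r ^ n * (r ^ m * y ^ m) := ih
        _ = (r ^ (n + 1) * y) * (r ^ m * y ^ m) := by rw [hy]
        _ = _ := by ring
  have he : (r ^ n * y ^ n) * (r ^ n * y ^ n) = r ^ n * y ^ n := by
    calc _ = (r ^ n * (r ^ n * y ^ n)) * y ^ n := by ring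
      _ = _ := by rw [← hpow]
  rcases h ((r ^ n * y ^ n : B) : A) (by exact_mod_cast congrArg Subtype.val he) with h0 | h1
  · right
    refine ⟨n, ?_⟩
    have h0' : r ^ n * y ^ n = 0 := Subtype.ext h0
    have := hpow n
    rw [h0', mul_zero] at this
    exact congrArg Subtype.val this
  · left
    have h1' : r ^ n * y ^ n = 1 := Subtype.ext h1
    have hr : IsUnit r := by
      rcases n with _ | n
      · exact IsUnit.of_mul_eq_one y (by simpa using hy)
      · exact IsUnit.of_mul_eq_one (r ^ n * y ^ (n + 1)) (by rw [← h1']; ring)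
    exact hr.map B.val

variable {V : Type*} [Category* V] [Preadditive V]

/-- Splitting both `e` and `1 - e` exhibits `X` as the biproduct of their images. -/
lemma Indecomposable.idempotent [HasBinaryBiproducts V] [IsIdempotentComplete V] {X : V}
    (hX : Indecomposable X) (e : X ⟶ X) (he : e ≫ e = e) : e = 0 ∨ e = 𝟙 X := by
  obtain ⟨Y, i, p, h1, h2⟩ := IsIdempotentComplete.idempotents_split X e he
  obtain ⟨Z, j, q, h3, h4⟩ := IsIdempotentComplete.idempotents_split X (𝟙 X - e) (by simp [he])
  have hiq : i ≫ q = 0 := by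
    have : i ≫ q = i ≫ (p ≫ i) ≫ (q ≫ j) ≫ q := by simp [h3, reassoc_of% h1]
    rw [this, h2, h4]; simp [he, reassoc_of% he]
  have hjp : j ≫ p = 0 := by
    have : j ≫ p = j ≫ (q ≫ j) ≫ (p ≫ i) ≫ p := by simp [h1, reassoc_of% h3]
    rw [this, h2, h4]; simp [he, reassoc_of% he]
  let iso : X ≅ Y ⊞ Z :=
    { hom := biprod.lift p q
      inv := biprod.desc i j
      hom_inv_id := by simp [h2, h4]
      inv_hom_id := by ext <;> simp [h1, h3, hiq, hjp] }
  rcases hX.2 Y Z iso with h | h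
  · left; rw [← h2, h.eq_of_tgt p 0, zero_comp]
  · right
    have : 𝟙 X - e = 0 := by rw [← h4, h.eq_of_tgt q 0, zero_comp]
    exact (sub_eq_zero.1 this).symm

lemma indecomposable_of_idempotents [HasBinaryBiproducts V] {X : V} (h0 : ¬ IsZero X)
    (h : ∀ e : X ⟶ X, e ≫ e = e → e = 0 ∨ e = 𝟙 X) : Indecomposable X := by
  refine ⟨h0, fun Y Z iso => ?_⟩
  rcases h (iso.hom ≫ biprod.fst ≫ biprod.inl ≫ iso.inv) (by simp) with h1 | h1
  · left
    rw [IsZero.iff_id_eq_zero]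
    have : 𝟙 Y = biprod.inl ≫ iso.inv ≫ (iso.hom ≫ biprod.fst ≫ biprod.inl ≫ iso.inv) ≫ iso.hom ≫
      biprod.fst := by simp
    rw [this, h1]; simp
  · right
    rw [IsZero.iff_id_eq_zero]
    have : 𝟙 Z = biprod.inr ≫ iso.inv ≫ 𝟙 X ≫ iso.hom ≫ biprod.snd := by simp
    rw [this, ← h1]; simp

variable (k : Type*) [Field k] [Linear k V]

lemma isLocalObj_of_idempotents {X : V} [FiniteDimensional k (X ⟶ X)] (h0 : ¬ IsZero X)
    (h : ∀ e : X ⟶ X, e ≫ e = e → e = 0 ∨ e = 𝟙 X) : IsLocalObj X := by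
  refine ⟨h0, fun f => ?_⟩
  have : FiniteDimensional k (End X) := inferInstanceAs (FiniteDimensional k (X ⟶ X))
  rcases isUnit_or_isNilpotent_of_idempotents k (A := End X) h f with h1 | h1
  · exact .inl ((isUnit_iff_isIso _).1 h1)
  · exact .inr h1

lemma Indecomposable.isLocalObj [HasBinaryBiproducts V] [IsIdempotentComplete V] {X : V}
    [FiniteDimensional k (X ⟶ X)] (hX : Indecomposable X) : IsLocalObj X :=
  isLocalObj_of_idempotents k hX.1 (Indecomposable.idempotent hX)

/-- Induction on `dim End X`: as `End Y × End Z` embeds in `End (Y ⊞ Z)`, both factors of a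
nontrivial decomposition have smaller endomorphism algebras. -/
lemma addClosure_indecomposable [HasBinaryBiproducts V]
    (hfd : ∀ X Y : V, FiniteDimensional k (X ⟶ Y)) (X : V) :
    addClosure (fun Y : V => Indecomposable Y ∧ Nonempty (Retract Y X)) X := by
  induction hn : Module.finrank k (X ⟶ X) using Nat.strong_induction_on generalizing X with
  | _ n ih =>
  subst hn
  by_cases h0 : IsZero X
  · exact .of_isZero h0
  by_cases hX : Indecomposable X
  · exact .of_mem ⟨hX, ⟨Retract.refl X⟩⟩
  simp only [Indecomposable, not_and, not_forall, not_or] at hX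
  obtain ⟨Y, Z, iso, hY, hZ⟩ := hX h0
  have key : ∀ Y Z : V, (X ≅ Y ⊞ Z) → ¬ IsZero Z →
      Module.finrank k (Y ⟶ Y) < Module.finrank k (X ⟶ X) := by
    intro Y Z iso hZ
    let φ : ((Y ⟶ Y) × (Z ⟶ Z)) →ₗ[k] (X ⟶ X) :=
      { toFun := fun p => iso.hom ≫ biprod.map p.1 p.2 ≫ iso.inv
        map_add' := fun p q => by
          rw [← Preadditive.comp_add, ← Preadditive.add_comp]
          congr 2
          ext <;> simp
        map_smul' := fun c p => by
          rw [RingHom.id_apply, ← Linear.comp_smul, ← Linear.smul_comp]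
          congr 2
          ext <;> simp }
    have hφ : Function.Injective φ := by
      rw [← LinearMap.ker_eq_bot, LinearMap.ker_eq_bot']
      rintro ⟨a, b⟩ h
      change iso.hom ≫ biprod.map a b ≫ iso.inv = 0 at h
      have h' : biprod.map a b = 0 := by
        have : biprod.map a b = iso.inv ≫ (iso.hom ≫ biprod.map a b ≫ iso.inv) ≫ iso.hom := by simp
        rw [this, h]; simp
      refine Prod.ext ?_ ?_
      · have : a = biprod.inl ≫ biprod.map a b ≫ biprod.fst := by simp
        rw [this, h']; simp
      · have : b = biprod.inr ≫ biprod.map a b ≫ biprod.snd := by simp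
        rw [this, h']; simp
    have := LinearMap.finrank_le_finrank_of_injective hφ
    rw [Module.finrank_prod] at this
    have hpos : 0 < Module.finrank k (Z ⟶ Z) := by
      have : Nontrivial (Z ⟶ Z) := ⟨𝟙 Z, 0, fun h => hZ ((IsZero.iff_id_eq_zero Z).2 h)⟩
      exact Module.finrank_pos
    omega
  refine .of_iso iso (.biprod ((ih _ (key Y Z iso hZ) Y rfl).mono fun W hW => ⟨hW.1, ?_⟩)
    ((ih _ (key Z Y (iso ≪≫ biprod.braiding Y Z) hY) Z rfl).mono fun W hW => ⟨hW.1, ?_⟩))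
  · obtain ⟨r⟩ := hW.2
    exact ⟨(r.trans ⟨biprod.inl, biprod.fst, biprod.inl_fst⟩).trans (Retract.ofIso iso.symm)⟩
  · obtain ⟨r⟩ := hW.2
    exact ⟨(r.trans ⟨biprod.inr, biprod.snd, biprod.inr_snd⟩).trans (Retract.ofIso iso.symm)⟩

end Local

/-! ### Categories with a progenerator are module categories -/

section Progenerator

variable (k : Type*) [Field k] {D : Type*} [Category.{w} D] [Preadditive D] [Linear k D]

/-- `X` behaves like a progenerator: every object has a finite presentation by copies of `X` on which
`Hom(X, -)` is exact, and every finite matrix over `End X` has a cokernel of this kind. -/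
structure IsProgenerator (X : D) : Prop where
  finiteDimensional (M : D) : FiniteDimensional k (X ⟶ M)
  presentation (M : D) : ∃ (n : ℕ) (g : Fin n → (X ⟶ M)),
    (∀ x : X ⟶ M, ∃ a : Fin n → (X ⟶ X), x = ∑ t, a t ≫ g t) ∧
    (∀ (N : D) (u v : M ⟶ N), (∀ t, g t ≫ u = g t ≫ v) → u = v) ∧
    ∀ (N : D) (u : Fin n → (X ⟶ N)),
      (∀ a : Fin n → (X ⟶ X), ∑ t, a t ≫ g t = 0 → ∑ t, a t ≫ u t = 0) →
        ∃ w : M ⟶ N, ∀ t, g t ≫ w = u t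
  exists_cokernel {m n : ℕ} (f : Fin m → Fin n → (X ⟶ X)) : ∃ (M : D) (g : Fin n → (X ⟶ M)),
    (∀ s, ∑ t, f s t ≫ g t = 0) ∧
    (∀ x : X ⟶ M, ∃ a : Fin n → (X ⟶ X), x = ∑ t, a t ≫ g t) ∧
    ∀ a : Fin n → (X ⟶ X), ∑ t, a t ≫ g t = 0 →
      ∃ b : Fin m → (X ⟶ X), ∀ t, a t = ∑ s, b s ≫ f s t

variable {k} {X : D} (hX : IsProgenerator k X)

include hX in
lemma IsProgenerator.finite_hom (M : D) : Module.Finite (End X)ᵐᵒᵖ (X ⟶ M) := by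
  obtain ⟨n, g, h, -, -⟩ := hX.presentation M
  classical
  refine ⟨⟨Finset.univ.image g, eq_top_iff.2 fun x _ => ?_⟩⟩
  obtain ⟨a, rfl⟩ := h x
  refine Submodule.sum_mem _ fun t _ => ?_
  exact Submodule.smul_mem _ (MulOpposite.op (End.of (a t)))
    (Submodule.subset_span (by simp))

/-- The functor `Hom(X, -)` to finitely generated modules over the (opposite of the) endomorphism
algebra. -/
def IsProgenerator.functor : D ⥤ FGModuleCat.{w} (End X)ᵐᵒᵖ :=
  ObjectProperty.lift _ (preadditiveCoyonedaObj X) (fun M => hX.finite_hom M)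

include hX in
lemma IsProgenerator.finiteDimensional_end : FiniteDimensional k (End X)ᵐᵒᵖ :=
  have : FiniteDimensional k (End X) := hX.finiteDimensional X
  Module.Finite.equiv (MulOpposite.opLinearEquiv k : End X ≃ₗ[k] (End X)ᵐᵒᵖ)

instance : hX.functor.Additive where
  map_add {_ _ f g} := by
    ext x
    exact Preadditive.comp_add _ _ _ x f g

instance : hX.functor.Linear k where
  map_smul {M N} f c := by
    ext x
    have key : ∀ y : X ⟶ M, y ≫ (c • f) = (c • 𝟙 X) ≫ y ≫ f := fun y => by simp
    exact key x

instance : hX.functor.Faithful where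
  map_injective {M N f f'} h := by
    obtain ⟨n, g, -, h2, -⟩ := hX.presentation M
    refine h2 _ _ _ fun t => ?_
    exact congrArg (fun φ => φ.hom.hom (g t)) h

/-- A module map is determined by the images of the generators `g t`. These satisfy the relations of
the `g t`, so the last clause of `presentation` provides the morphism. -/
instance : hX.functor.Full where
  map_surjective {M N} φ := by
    obtain ⟨n, g, h1, h2, h3⟩ := hX.presentation M
    let φ' : (X ⟶ M) →ₗ[(End X)ᵐᵒᵖ] (X ⟶ N) := φ.hom.hom
    have key : ∀ a : Fin n → (X ⟶ X), φ' (∑ t, a t ≫ g t) = ∑ t, a t ≫ φ' (g t) := by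
      intro a
      rw [map_sum]
      exact Finset.sum_congr rfl fun t _ => φ'.map_smul (MulOpposite.op (End.of (a t))) (g t)
    obtain ⟨w, hw⟩ := h3 N (fun t => φ' (g t)) (fun a ha => by rw [← key, ha, map_zero])
    refine ⟨w, ?_⟩
    ext x
    obtain ⟨a, rfl⟩ := h1 x
    refine Eq.trans ?_ (key a).symm
    change (∑ t, a t ≫ g t) ≫ w = _
    rw [Preadditive.sum_comp]
    simp [hw]

/-- A finite presentation of the module `N` is a matrix over `End X`; the cokernel provided by
`exists_cokernel` has the same generators and relations. -/
lemma IsProgenerator.essSurj : hX.functor.EssSurj where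
  mem_essImage N := by
    have := hX.finiteDimensional_end
    have : IsNoetherianRing (End X)ᵐᵒᵖ := IsNoetherianRing.of_finite k _
    let A := (End X)ᵐᵒᵖ
    obtain ⟨n, π, hπ⟩ := Module.Finite.exists_fin' A N
    obtain ⟨m, f, hf⟩ := Submodule.fg_iff_exists_fin_generating_family.1
      (IsNoetherian.noetherian (LinearMap.ker π))
    obtain ⟨M, g, h1, h2, h3⟩ := hX.exists_cokernel (fun s t => (f s t).unop)
    let ψ : (Fin n → A) →ₗ[A] (X ⟶ M) := Fintype.linearCombination A g
    have hψ : ∀ a, ψ a = ∑ t, (a t).unop ≫ g t := fun a => rfl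
    have hψs : Function.Surjective ψ := fun x => by
      obtain ⟨a, rfl⟩ := h2 x
      exact ⟨fun t => MulOpposite.op (a t), rfl⟩
    have hker : LinearMap.ker ψ = LinearMap.ker π := by
      rw [← hf]
      refine le_antisymm (fun a ha => ?_) ?_
      · obtain ⟨b, hb⟩ := h3 (fun t => (a t).unop) (by rw [← hψ]; exact ha)
        have : a = ∑ s, MulOpposite.op (End.of (b s)) • f s := by
          funext t
          apply MulOpposite.unop_injective
          rw [hb t, Finset.sum_apply]
          exact (map_sum (MulOpposite.opAddEquiv (α := End X)).symm _ _).symm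
        rw [this]
        exact Submodule.sum_mem _ fun s _ => Submodule.smul_mem _ _
          (Submodule.subset_span ⟨s, rfl⟩)
      · rw [Submodule.span_le]
        rintro _ ⟨s, rfl⟩
        exact (hψ (f s)).trans (h1 s)
    let e : (X ⟶ M) ≃ₗ[A] N := (ψ.quotKerEquivOfSurjective hψs).symm ≪≫ₗ
      Submodule.quotEquivOfEq _ _ hker ≪≫ₗ π.quotKerEquivOfSurjective hπ
    have : Module.Finite A (X ⟶ M) := hX.finite_hom M
    exact ⟨M, ⟨(ModuleCat.isFG A).isoMk (LinearEquiv.toModuleIso e)⟩⟩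

instance : hX.functor.IsEquivalence where
  essSurj := hX.essSurj

end Progenerator

/-! ### Abelian categories with a projective generator -/

section FiniteLength

variable (k : Type*) [Field k] {D : Type*} [Category.{w} D] [Abelian D] [Linear k D]

/-- `X` is a projective generator with finite dimensional spaces of morphisms to all objects. -/
structure IsProjGenerator (X : D) : Prop where
  finiteDimensional (M : D) : FiniteDimensional k (X ⟶ M)
  projective : Projective X
  isZero (M : D) : (∀ f : X ⟶ M, f = 0) → IsZero M

variable {k} {X : D} (hX : IsProjGenerator k X)

include hX

/-- The dimension of `Hom(X, -)` replaces the length of an object: it is finite and drops strictly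
along proper subobjects and quotients, which drives the inductions below. -/
lemma IsProjGenerator.finrank_lt_of_mono {M N : D} (f : M ⟶ N) [Mono f] (h : ¬ IsIso f) :
    Module.finrank k (X ⟶ M) < Module.finrank k (X ⟶ N) := by
  have := hX.finiteDimensional M
  have := hX.finiteDimensional N
  by_contra hle
  apply h
  have hinj : Function.Injective (Linear.rightComp k X f) := fun a b hab => (cancel_mono f).1 hab
  have hsurj := (LinearMap.injective_iff_surjective_of_finrank_eq_finrank
    (le_antisymm (LinearMap.finrank_le_finrank_of_injective hinj) (not_lt.1 hle))).1 hinj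
  have : Epi f := by
    refine Preadditive.epi_of_isZero_cokernel f (hX.isZero _ fun x => ?_)
    have := hX.projective
    obtain ⟨a, ha⟩ := hsurj (Projective.factorThru x (cokernel.π f))
    rw [← Projective.factorThru_comp x (cokernel.π f), ← ha]
    simp
  exact isIso_of_mono_of_epi f

lemma IsProjGenerator.finrank_lt_of_epi {M N : D} (f : M ⟶ N) [Epi f] (h : ¬ IsIso f) :
    Module.finrank k (X ⟶ N) < Module.finrank k (X ⟶ M) := by
  have := hX.finiteDimensional M
  have := hX.finiteDimensional N
  have := hX.projective
  by_contra hle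
  apply h
  have hsurj : Function.Surjective (Linear.rightComp k X f) := fun x =>
    ⟨Projective.factorThru x f, Projective.factorThru_comp x f⟩
  have hinj := (LinearMap.injective_iff_surjective_of_finrank_eq_finrank
    (le_antisymm (not_lt.1 hle) (LinearMap.finrank_le_finrank_of_surjective hsurj))).2 hsurj
  have : Mono f := by
    refine Preadditive.mono_of_isZero_kernel f (hX.isZero _ fun x => ?_)
    rw [← cancel_mono (kernel.ι f), zero_comp]
    exact hinj (by simp [Linear.rightComp])
  exact isIso_of_mono_of_epi f

lemma IsProjGenerator.exists_simple_quotient {M : D} (hM : ¬ IsZero M) :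
    ∃ (S : D) (p : M ⟶ S), Simple S ∧ Epi p := by
  induction hn : Module.finrank k (X ⟶ M) using Nat.strong_induction_on generalizing M with
  | _ n ih =>
  subst hn
  by_cases hs : Simple M
  · exact ⟨M, 𝟙 M, hs, inferInstance⟩
  obtain ⟨Y, f, hf, h0, hiso⟩ : ∃ (Y : D) (f : Y ⟶ M), Mono f ∧ f ≠ 0 ∧ ¬ IsIso f := by
    by_contra! H
    refine hs ⟨fun {Y} f hf => ⟨fun hi h0 => hM ?_, fun h => H Y f hf h⟩⟩
    subst h0
    rw [IsZero.iff_id_eq_zero]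
    rw [← IsIso.inv_hom_id (0 : Y ⟶ M), comp_zero]
  have hc : ¬ IsZero (cokernel f) := fun h => hiso (by
    have := Preadditive.epi_of_isZero_cokernel f h
    exact isIso_of_mono_of_epi f)
  have hi : ¬ IsIso (cokernel.π f) := fun h => h0 (by
    rw [← cancel_mono (cokernel.π f), cokernel.condition, zero_comp])
  obtain ⟨S, p, hS, hp⟩ := ih _ (hX.finrank_lt_of_epi (cokernel.π f) hi) hc rfl
  exact ⟨S, cokernel.π f ≫ p, hS, epi_comp _ _⟩

lemma IsProjGenerator.exists_simple_sub {M : D} (hM : ¬ IsZero M) :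
    ∃ (S : D) (i : S ⟶ M), Simple S ∧ Mono i := by
  induction hn : Module.finrank k (X ⟶ M) using Nat.strong_induction_on generalizing M with
  | _ n ih =>
  subst hn
  by_cases hs : Simple M
  · exact ⟨M, 𝟙 M, hs, inferInstance⟩
  obtain ⟨Y, f, hf, h0, hiso⟩ : ∃ (Y : D) (f : Y ⟶ M), Mono f ∧ f ≠ 0 ∧ ¬ IsIso f := by
    by_contra! H
    refine hs ⟨fun {Y} f hf => ⟨fun hi h0 => hM ?_, fun h => H Y f hf h⟩⟩
    subst h0
    rw [IsZero.iff_id_eq_zero]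
    rw [← IsIso.inv_hom_id (0 : Y ⟶ M), comp_zero]
  obtain ⟨S, p, hS, hp⟩ := ih _ (hX.finrank_lt_of_mono f hiso) (fun h => h0 (h.eq_of_src _ _)) rfl
  exact ⟨S, p ≫ f, hS, mono_comp _ _⟩

/-- Devissage: a property of objects which holds for zero objects and is inherited from a quotient by
a simple subobject holds for all objects. -/
lemma IsProjGenerator.devissage (C : D → Prop) (h0 : ∀ M, IsZero M → C M)
    (h1 : ∀ (S M : D) (i : S ⟶ M), Simple S → Mono i → C (cokernel i) → C M) (M : D) : C M := by
  induction hn : Module.finrank k (X ⟶ M) using Nat.strong_induction_on generalizing M with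
  | _ n ih =>
  subst hn
  by_cases hM : IsZero M
  · exact h0 M hM
  obtain ⟨S, i, hS, hi⟩ := hX.exists_simple_sub hM
  refine h1 S M i hS hi (ih _ (hX.finrank_lt_of_epi (cokernel.π i) fun h => ?_) _ rfl)
  refine id_nonzero S ?_
  have : i = 0 := by rw [← cancel_mono (cokernel.π i), cokernel.condition, zero_comp]
  rw [← cancel_mono i, this]; simp

end FiniteLength

/-! ### Objects with a simple top -/

section Hollow

variable {D : Type*} [Category* D] [Abelian D]

/-- If the sum of the kernels of two nonzero morphisms to simple objects is not everything, the
two morphisms agree up to an isomorphism of the simple objects. -/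
lemma exists_factor_of_not_epi {N S T : D} [Simple S] [Simple T] {f : N ⟶ S} {g : N ⟶ T}
    (hf : f ≠ 0) (h : ¬ Epi (biprod.desc (kernel.ι f) (kernel.ι g))) : ∃ c, g = f ≫ c := by
  by_cases hg : g = 0
  · exact ⟨0, by simp [hg]⟩
  have := epi_of_nonzero_to_simple hf
  have := epi_of_nonzero_to_simple hg
  -- The quotient of `N` by `ker f + ker g` is a nonzero common quotient of `S` and `T`; simplicity
  -- of `T` makes the induced `c2` invertible.
  set c := cokernel.π (biprod.desc (kernel.ι f) (kernel.ι g)) with hc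
  have hcond : biprod.desc (kernel.ι f) (kernel.ι g) ≫ c = 0 := cokernel.condition _
  have h1 : kernel.ι f ≫ c = 0 := by
    have := congrArg (fun t => biprod.inl ≫ t) hcond
    simpa using this
  have h2 : kernel.ι g ≫ c = 0 := by
    have := congrArg (fun t => biprod.inr ≫ t) hcond
    simpa using this
  have hc0 : c ≠ 0 := fun h0 => h (Preadditive.epi_of_cokernel_zero h0)
  let c1 := Abelian.epiDesc f c h1
  have e1 : f ≫ c1 = c := Abelian.comp_epiDesc _ _ _
  let c2 := Abelian.epiDesc g c h2
  have e2 : g ≫ c2 = c := Abelian.comp_epiDesc _ _ _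
  have : Epi (g ≫ c2) := by rw [e2]; infer_instance
  have : Epi c2 := epi_of_epi g c2
  have : IsIso c2 := isIso_of_epi_of_nonzero (fun h0 => hc0 (by rw [← e2, h0, comp_zero]))
  exact ⟨c1 ≫ inv c2, by rw [← Category.assoc, e1, ← e2]; simp⟩

/-- The sum of two proper subobjects is proper. -/
structure IsHollow (N : D) : Prop where
  not_isZero : ¬ IsZero N
  epi_or_epi {Y Z : D} (f : Y ⟶ N) (g : Z ⟶ N) : Epi (biprod.desc f g) → Epi f ∨ Epi g

/-- Lifting `p` to `Y ⊞ Z` writes it as a sum of a part through `f` and a part through `g`. These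
parts lift to endomorphisms `α`, `β` of `P`, and locality makes one of them invertible. -/
lemma IsLocalObj.isHollow {P N : D} [Projective P] (hP : IsLocalObj P) (p : P ⟶ N) [Epi p]
    (hN : ¬ IsZero N) : IsHollow N := by
  refine ⟨hN, fun {Y Z} f g h => ?_⟩
  let l := Projective.factorThru p (biprod.desc f g)
  have hl : (l ≫ biprod.fst) ≫ f + (l ≫ biprod.snd) ≫ g = p := by
    have h1 : l ≫ biprod.desc f g = p := Projective.factorThru_comp _ _
    rw [← h1, Category.assoc, Category.assoc, ← Preadditive.comp_add]
    congr 1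
    ext <;> simp
  let α := Projective.factorThru ((l ≫ biprod.fst) ≫ f) p
  let β := Projective.factorThru ((l ≫ biprod.snd) ≫ g) p
  have hα : α ≫ p = (l ≫ biprod.fst) ≫ f := Projective.factorThru_comp _ _
  have hβ : β ≫ p = (l ≫ biprod.snd) ≫ g := Projective.factorThru_comp _ _
  -- The remainder `1 - (α + β)` composes with `p` to zero, so it cannot be the invertible term.
  have hsum : IsIso ((α + β) + (𝟙 P - (α + β))) := by
    rw [add_sub_cancel]; infer_instance
  rcases hP.isIso_of_add hsum with h1 | h1
  · rcases hP.isIso_of_add h1 with h2 | h2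
    · left
      have : Epi ((l ≫ biprod.fst) ≫ f) := by rw [← hα]; infer_instance
      exact epi_of_epi (l ≫ biprod.fst) f
    · right
      have : Epi ((l ≫ biprod.snd) ≫ g) := by rw [← hβ]; infer_instance
      exact epi_of_epi (l ≫ biprod.snd) g
  · exfalso
    have h2 : (𝟙 P - (α + β)) ≫ p = 0 := by
      rw [Preadditive.sub_comp, Preadditive.add_comp, hα, hβ, hl]; simp
    have h3 : p = 0 := by rw [← cancel_epi (𝟙 P - (α + β)), h2, comp_zero]
    refine hN ((IsZero.iff_id_eq_zero N).2 ?_)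
    rw [← cancel_epi p, h3]; simp

lemma not_epi_kernel_ι {N S : D} {f : N ⟶ S} (hf : f ≠ 0) : ¬ Epi (kernel.ι f) := fun h =>
  hf (by rw [← cancel_epi (kernel.ι f), kernel.condition, comp_zero])

lemma IsHollow.exists_factor {N S T : D} (hN : IsHollow N) [Simple S] [Simple T] {f : N ⟶ S}
    (hf : f ≠ 0) (g : N ⟶ T) : ∃ c, g = f ≫ c := by
  by_cases hg : g = 0
  · exact ⟨0, by simp [hg]⟩
  refine exists_factor_of_not_epi hf fun h => ?_
  rcases hN.epi_or_epi _ _ h with h1 | h1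
  · exact not_epi_kernel_ι hf h1
  · exact not_epi_kernel_ι hg h1

lemma IsHollow.isSimpleTop {N S : D} (hN : IsHollow N) [Simple S] {f : N ⟶ S} (hf : f ≠ 0) :
    IsSimpleTop f where
  simple := inferInstance
  epi := epi_of_nonzero_to_simple hf
  factors _ _ g := hN.exists_factor hf g

/-- The kernel of a nonzero morphism from a hollow object to a simple object is superfluous. -/
lemma IsHollow.epi_of_comp_ne_zero {Y N S : D} (hN : IsHollow N) [Simple S] {s : N ⟶ S}
    (f : Y ⟶ N) (h : f ≫ s ≠ 0) : Epi f := by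
  have hs : s ≠ 0 := fun h0 => h (by rw [h0, comp_zero])
  have := epi_of_nonzero_to_simple hs
  have := epi_of_nonzero_to_simple h
  have hd : Epi (biprod.desc f (kernel.ι s)) := by
    rw [Preadditive.epi_iff_cancel_zero]
    intro Z c hc
    have h1 : f ≫ c = 0 := by simpa using congrArg (fun t => biprod.inl ≫ t) hc
    have h2 : kernel.ι s ≫ c = 0 := by simpa using congrArg (fun t => biprod.inr ≫ t) hc
    let c1 := Abelian.epiDesc s c h2
    have e1 : s ≫ c1 = c := Abelian.comp_epiDesc _ _ _
    have : (f ≫ s) ≫ c1 = 0 := by rw [Category.assoc, e1, h1]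
    have h3 : c1 = 0 := by rw [← cancel_epi (f ≫ s), this, comp_zero]
    rw [← e1, h3, comp_zero]
  rcases hN.epi_or_epi _ _ hd with h1 | h1
  · exact h1
  · exact absurd h1 (not_epi_kernel_ι hs)

end Hollow

/-! ### Abelian structures as a property -/

/-- The preadditive category `D` is abelian. -/
class IsAbelianCat (D : Type*) [Category* D] [Preadditive D] : Prop where
  hasFiniteProducts : HasFiniteProducts D
  hasKernels : HasKernels D
  hasCokernels : HasCokernels D
  isIso_comparison {X Y : D} (f : X ⟶ Y) : IsIso (Abelian.coimageImageComparison f)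

/-- The abelian structure on a preadditive category which is abelian. -/
@[reducible]
def IsAbelianCat.abelian (D : Type*) [Category* D] [Preadditive D] [h : IsAbelianCat D] :
    Abelian D :=
  have := h.hasFiniteProducts
  have := h.hasKernels
  have := h.hasCokernels
  have : ∀ {X Y : D} (f : X ⟶ Y), IsIso (Abelian.coimageImageComparison f) := h.isIso_comparison
  Abelian.ofCoimageImageComparisonIsIso

/-- Requiring `A` to induce the given addition keeps the linear structures on morphisms valid for
the abelian structure recovered by `IsAbelianCat.abelian`. -/
lemma IsAbelianCat.of_abelian (D : Type*) [Category* D] [P : Preadditive D] (A : Abelian D)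
    (h : A.toPreadditive = P) : IsAbelianCat D := by
  subst h
  exact
    { hasFiniteProducts := inferInstance
      hasKernels := inferInstance
      hasCokernels := inferInstance
      isIso_comparison := fun f => inferInstance }

lemma IsAbelianCat.of_equivalence {D : Type*} [Category* D] [Preadditive D] [HasFiniteProducts D]
    {E : Type*} [Category* E] [Abelian E] (F : D ⥤ E) [F.IsEquivalence] : IsAbelianCat D :=
  .of_abelian D (abelianOfEquivalence F) rfl

/-! ### Progenerators of full subcategories given by presentations -/

section Presentations

lemma hom_sum {P : Type*} [Category* P] [Preadditive P] {W : ObjectProperty P}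
    {M N : W.FullSubcategory} {T : Type*} (s : Finset T)
    (f : T → (M ⟶ N)) : (∑ t ∈ s, f t).hom = ∑ t ∈ s, (f t).hom :=
  map_sum (W.ι.mapAddHom (X := M) (Y := N)) f s

variable {k : Type*} [Field k] {P : Type*} [Category.{w} P] [Preadditive P] [Linear k P]
  [HasFiniteBiproducts P] [HasCokernels P]

/-- `X` is a progenerator of a full subcategory consisting of the cokernels of morphisms between
direct summands of finite direct sums of copies of `X`, if `Hom(X, -)` is exact on these. -/
lemma IsProgenerator.of_presentations (X : P) (W : ObjectProperty P) (hXW : W X)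
    (hfin : ∀ M N : P, FiniteDimensional k (M ⟶ N))
    (hW : ∀ M, W M → ∃ (X₁ X₀ : P) (f : X₁ ⟶ X₀) (g : X₀ ⟶ M) (hw : f ≫ g = 0),
      addClosure (fun Y => Y = X) X₁ ∧ addClosure (fun Y => Y = X) X₀ ∧
        Nonempty (IsColimit (CokernelCofork.ofπ g hw)))
    (hW' : ∀ {X₁ X₀ : P} (f : X₁ ⟶ X₀), addClosure (fun Y => Y = X) X₁ →
      addClosure (fun Y => Y = X) X₀ → W (cokernel f))
    (hlift : ∀ {X₁ X₀ M : P} (f : X₁ ⟶ X₀) (g : X₀ ⟶ M) (hw : f ≫ g = 0),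
      addClosure (fun Y => Y = X) X₁ → addClosure (fun Y => Y = X) X₀ →
      IsColimit (CokernelCofork.ofπ g hw) →
        (∀ x : X ⟶ M, ∃ y, y ≫ g = x) ∧ ∀ y : X ⟶ X₀, y ≫ g = 0 → ∃ z, z ≫ f = y) :
    IsProgenerator k (⟨X, hXW⟩ : W.FullSubcategory) where
  finiteDimensional M := by
    have := hfin X M.obj
    exact Module.Finite.equiv
      ({ toFun := fun f : X ⟶ M.obj =>
           (ObjectProperty.homMk f : (⟨X, hXW⟩ : W.FullSubcategory) ⟶ M)
         invFun := fun f => f.hom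
         left_inv := fun (f : X ⟶ M.obj) => rfl
         right_inv := fun (f : (⟨X, hXW⟩ : W.FullSubcategory) ⟶ M) => rfl
         map_add' := fun _ _ => rfl
         map_smul' := fun _ _ => rfl } : (X ⟶ M.obj) ≃ₗ[k] ((⟨X, hXW⟩ : W.FullSubcategory) ⟶ M))
  presentation M := by
    obtain ⟨X₁, X₀, f, g, hw, h1, h0, ⟨hc⟩⟩ := hW M.obj M.property
    obtain ⟨l1, l2⟩ := hlift f g hw h1 h0 hc
    have hepi : Epi g := epi_of_isColimit_cofork hc
    obtain ⟨n, Y, a, b, hY, hs⟩ := h0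
    obtain rfl : Y = fun _ => X := funext hY
    refine ⟨n, fun t => ObjectProperty.homMk (b t ≫ g), ?_, ?_, ?_⟩
    · intro x
      obtain ⟨y, hy⟩ := l1 x.hom
      refine ⟨fun t => ObjectProperty.homMk (y ≫ a t), ObjectProperty.hom_ext _ ?_⟩
      have : y ≫ (∑ t, a t ≫ b t) ≫ g = x.hom := by rw [hs]; simpa using hy
      rw [← this]
      simp only [Preadditive.comp_sum, Preadditive.sum_comp, Category.assoc]
      rw [hom_sum]
      exact Finset.sum_congr rfl fun t _ => (Category.assoc _ _ _).symm
    · intro N u v huv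
      refine ObjectProperty.hom_ext _ ?_
      rw [← cancel_epi g, ← Category.id_comp g, ← hs, Preadditive.sum_comp, Preadditive.sum_comp,
        Preadditive.sum_comp]
      refine Finset.sum_congr rfl fun t _ => ?_
      have := congrArg (fun φ => a t ≫ φ.hom) (huv t)
      simpa using this
    · intro N u hu
      have hu' : ∀ c : Fin n → (X ⟶ X), ∑ t, c t ≫ b t ≫ g = 0 → ∑ t, c t ≫ (u t).hom = 0 := by
        intro c hc
        have := hu (fun t => ObjectProperty.homMk (c t)) (ObjectProperty.hom_ext _ (by
          refine (hom_sum _ _).trans hc))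
        have := congrArg (fun φ => φ.hom) this
        exact (hom_sum _ _).symm.trans this
      -- Tested on a copy of `X` mapping to `X₁`, the composite with `f` has coordinates forming a
      -- relation among the generators, and `u` respects relations.
      have h : f ≫ ∑ t, a t ≫ (u t).hom = 0 := by
        refine h1.hom_ext fun Z b' hZ => ?_
        subst hZ
        rw [comp_zero]
        have := hu' (fun t => b' ≫ f ≫ a t) (by
          have : ∑ t, (b' ≫ f ≫ a t) ≫ b t ≫ g = b' ≫ f ≫ (∑ t, a t ≫ b t) ≫ g := by
            simp [Preadditive.comp_sum, Preadditive.sum_comp]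
          rw [this, hs]; simp [hw])
        simpa [Preadditive.comp_sum] using this
      let wd := hc.desc (CokernelCofork.ofπ _ h)
      have hwd : g ≫ wd = ∑ t, a t ≫ (u t).hom := hc.fac (CokernelCofork.ofπ _ h)
        WalkingParallelPair.one
      refine ⟨ObjectProperty.homMk wd, fun t => ObjectProperty.hom_ext _ ?_⟩
      change (b t ≫ g) ≫ wd = (u t).hom
      rw [Category.assoc, hwd, Preadditive.comp_sum]
      -- `X₀` is only a summand of `X ^ n`. The idempotent matrix `b t ≫ a s` differs from the
      -- identity matrix by relations among the generators, which `u` kills.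
      have := hu' (fun s => b t ≫ a s - if s = t then 𝟙 X else 0) (by
        simp only [Preadditive.sub_comp, Finset.sum_sub_distrib, sub_eq_zero]
        have : ∑ s, (b t ≫ a s) ≫ b s ≫ g = b t ≫ (∑ t, a t ≫ b t) ≫ g := by
          simp [Preadditive.comp_sum, Preadditive.sum_comp]
        rw [this, hs, Finset.sum_eq_single t]
        · simp
        · intro s _ hs; simp [hs]
        · simp)
      simp only [Preadditive.sub_comp, Finset.sum_sub_distrib, sub_eq_zero] at this
      simp only [Category.assoc] at this
      refine this.trans ?_
      rw [Finset.sum_eq_single t]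
      · simp
      · intro s _ hs; simp [hs]
      · simp
  exists_cokernel {m n} f := by
    have hb : ∀ n : ℕ, addClosure (fun Y => Y = X) (⨁ fun _ : Fin n => X) := fun n =>
      ⟨n, fun _ => X, fun t => biproduct.π (fun _ => X) t, fun t => biproduct.ι (fun _ => X) t,
        fun _ => rfl, biproduct.total⟩
    let F : (⨁ fun _ : Fin m => X) ⟶ (⨁ fun _ : Fin n => X) :=
      biproduct.matrix fun s t => (f s t).hom
    obtain ⟨l1, l2⟩ := hlift F (cokernel.π F) (cokernel.condition F) (hb m) (hb n)
      (cokernelIsCokernel F)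
    refine ⟨⟨cokernel F, hW' F (hb m) (hb n)⟩,
      fun t => ObjectProperty.homMk (biproduct.ι (fun _ : Fin n => X) t ≫ cokernel.π F), ?_, ?_, ?_⟩
    · intro s
      refine ObjectProperty.hom_ext _
        ((hom_sum _ _).trans ?_)
      change ∑ t, (f s t).hom ≫ biproduct.ι (fun _ : Fin n => X) t ≫ cokernel.π F = 0
      have h := congrArg (fun φ => biproduct.ι (fun _ : Fin m => X) s ≫ φ) (cokernel.condition F)
      simp only [comp_zero] at h
      rw [← h, ← Category.assoc, biproduct.ι_matrix, biproduct.lift_eq, Preadditive.sum_comp]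
      simp
    · intro x
      obtain ⟨y, hy⟩ := l1 x.hom
      refine ⟨fun t => ObjectProperty.homMk (y ≫ biproduct.π _ t), ObjectProperty.hom_ext _ ?_⟩
      refine Eq.trans ?_ (hom_sum _ _).symm
      change _ = ∑ t, (y ≫ biproduct.π _ t) ≫ biproduct.ι (fun _ : Fin n => X) t ≫ cokernel.π F
      have : y ≫ (∑ t, biproduct.π _ t ≫ biproduct.ι (fun _ : Fin n => X) t) ≫ cokernel.π F =
        x.hom := by rw [biproduct.total]; simpa using hy
      rw [← this]
      simp only [Preadditive.comp_sum, Preadditive.sum_comp, Category.assoc]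
    · intro a ha
      have ha' : (∑ t, (a t).hom ≫ biproduct.ι (fun _ : Fin n => X) t) ≫ cokernel.π F = 0 := by
        have := congrArg (fun φ => φ.hom) ha
        have := (hom_sum _ _).symm.trans this
        rw [Preadditive.sum_comp]
        simpa using this
      obtain ⟨z, hz⟩ := l2 _ ha'
      refine ⟨fun s => ObjectProperty.homMk (z ≫ biproduct.π _ s), fun t =>
        ObjectProperty.hom_ext _ ?_⟩
      refine Eq.trans ?_ (hom_sum _ _).symm
      change _ = ∑ s, (z ≫ biproduct.π _ s) ≫ (f s t).hom
      have h := congrArg (fun φ => φ ≫ biproduct.π (fun _ : Fin n => X) t) hz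
      simp only [Preadditive.sum_comp, Category.assoc, biproduct.ι_π] at h
      rw [Finset.sum_eq_single t (by intro s _ hs; simp [hs]) (by simp)] at h
      simp only [dite_true, eqToHom_refl, Category.comp_id] at h
      rw [← h, ← Category.id_comp F, ← biproduct.total, Preadditive.sum_comp]
      simp [Preadditive.comp_sum, Preadditive.sum_comp, F]

end Presentations

/-! ### Freyd categories -/

section Freyd

open Preadditive (RightFreyd)
open ZeroObject

variable {V : Type*} [Category.{w} V] [Preadditive V]

section ZeroObj

variable [HasZeroObject V]

lemma exists_quotient_obj (M : RightFreyd V) : ∃ m, (RightFreyd.quotient V).obj m = M :=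
  ⟨CategoryTheory.Quotient.as M, rfl⟩

/-- The canonical epimorphism from `P_{X₀}` to the diagram `X₁ ⟶ X₀`. -/
def freydπ (m : Arrow V) : (RightFreyd.functor V).obj m.right ⟶ (RightFreyd.quotient V).obj m :=
  (RightFreyd.quotient V).map (Arrow.homMk (f := (RightFreyd.rightFunctor V).obj m.right)
    (u := (0 : 0 ⟶ m.left)) (v := 𝟙 m.right) ((isZero_zero V).eq_of_src _ _))

instance (m : Arrow V) : Epi (freydπ m) := by
  have : IsIso ((Arrow.homMk (f := (RightFreyd.rightFunctor V).obj m.right) (g := m)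
      (u := (0 : 0 ⟶ m.left)) (v := 𝟙 m.right) ((isZero_zero V).eq_of_src _ _)).right) :=
    inferInstanceAs (IsIso (𝟙 m.right))
  exact RightFreyd.epi_of_isIso_right _

lemma exists_freydπ {X : V} {m : Arrow V}
    (f : (RightFreyd.functor V).obj X ⟶ (RightFreyd.quotient V).obj m) :
    ∃ x : X ⟶ m.right, (RightFreyd.functor V).map x ≫ freydπ m = f := by
  obtain ⟨f, rfl⟩ := (RightFreyd.quotient V).map_surjective f
  obtain ⟨g, hg⟩ : ∃ g : X ⟶ m.right, g = f.right := ⟨_, rfl⟩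
  refine ⟨g, ?_⟩
  rw [freydπ, Functor.comp_map, ← Functor.map_comp]
  refine RightFreyd.quotient_congr ?_ ?_
  · exact (isZero_zero V).eq_of_src _ _
  · exact (Category.comp_id g).trans hg

/-- A null-homotopy of a morphism from `0 ⟶ X` to the diagram `m` is precisely a lift of `x` through
`m.hom`. -/
lemma functor_map_comp_freydπ_eq_zero {X : V} {m : Arrow V} (x : X ⟶ m.right) :
    (RightFreyd.functor V).map x ≫ freydπ m = 0 ↔ ∃ y : X ⟶ m.left, y ≫ m.hom = x := by
  rw [freydπ, Functor.comp_map, ← Functor.map_comp, RightFreyd.quotient_map_eq_zero_iff]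
  constructor
  · rintro ⟨h⟩
    refine ⟨h.hom, ?_⟩
    have := h.comm
    exact ((sub_zero _).symm.trans this).symm.trans (Category.comp_id x)
  · rintro ⟨y, rfl⟩
    exact ⟨{ hom := y, comm := by
              refine (sub_zero _).trans (Category.comp_id _) }⟩

lemma freyd_condition (m : Arrow V) :
    (RightFreyd.functor V).map m.hom ≫ freydπ m = 0 :=
  (functor_map_comp_freydπ_eq_zero _).2 ⟨𝟙 _, Category.id_comp _⟩

/-- Every object of the Freyd category is the cokernel of the corresponding morphism of projective
objects. -/
lemma nonempty_isColimit_freydπ (m : Arrow V) :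
    Nonempty (IsColimit (CokernelCofork.ofπ (freydπ m) (freyd_condition m))) := by
  refine ⟨CokernelCofork.IsColimit.ofπ' _ _ fun {N} g hg => Nonempty.some ?_⟩
  obtain ⟨n, rfl⟩ := exists_quotient_obj N
  obtain ⟨x, rfl⟩ := exists_freydπ g
  rw [← Category.assoc, ← Functor.map_comp, functor_map_comp_freydπ_eq_zero] at hg
  obtain ⟨y, hy⟩ := hg
  refine ⟨(RightFreyd.quotient V).map (Arrow.homMk (f := m) (u := y) (v := x) hy), ?_⟩
  rw [freydπ, freydπ, Functor.comp_map, ← Functor.map_comp, ← Functor.map_comp]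
  refine RightFreyd.quotient_congr ?_ ?_
  · exact (isZero_zero V).eq_of_src _ _
  · exact (Category.id_comp x).trans (Category.comp_id x).symm

instance : HasZeroObject (RightFreyd V) :=
  ⟨(RightFreyd.functor V).obj 0, (RightFreyd.functor V).map_isZero (isZero_zero V)⟩

lemma freydπ_comp_map {m n : Arrow V} (e : n ⟶ m) :
    freydπ n ≫ (RightFreyd.quotient V).map e = (RightFreyd.functor V).map e.right ≫ freydπ m := by
  rw [freydπ, freydπ, Functor.comp_map, ← Functor.map_comp, ← Functor.map_comp]
  refine RightFreyd.quotient_congr ?_ ?_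
  · exact (isZero_zero V).eq_of_src _ _
  · exact (Category.id_comp e.right).trans (Category.comp_id e.right).symm

end ZeroObj

variable [HasFiniteBiproducts V]

attribute [local instance] hasZeroObject_of_hasFiniteBiproducts

/-- `Hom(P_X, -)` is exact at the cokernel of a morphism. -/
lemma exists_lift_of_cokernel {X : V} {M N : RightFreyd V} (e : N ⟶ M)
    (y : (RightFreyd.functor V).obj X ⟶ M) (hy : ∀ {K : RightFreyd V} (g : M ⟶ K),
      e ≫ g = 0 → y ≫ g = 0) : ∃ z, z ≫ e = y := by
  obtain ⟨m, rfl⟩ := exists_quotient_obj M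
  obtain ⟨n, rfl⟩ := exists_quotient_obj N
  obtain ⟨e, rfl⟩ := (RightFreyd.quotient V).map_surjective e
  obtain ⟨x, rfl⟩ := exists_freydπ y
  -- The test morphism is the explicit cokernel of `e`, with source `m.left ⊞ n.right`. A
  -- null-homotopy into it has two components: the second gives the lift, the first is absorbed by
  -- the relations of `m`.
  have h0 := hy ((RightFreyd.quotient V).map (RightFreyd.Candidate.π e))
    (RightFreyd.eq_of_rightHomotopy _ _ (RightFreyd.Candidate.condition e))
  rw [Category.assoc, freydπ_comp_map, ← Category.assoc, ← Functor.map_comp,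
    functor_map_comp_freydπ_eq_zero] at h0
  obtain ⟨h, hh⟩ := h0
  replace hh : h ≫ biprod.desc m.hom e.right = x := hh.trans (Category.comp_id x)
  have hc : (h ≫ biprod.fst) ≫ m.hom + (h ≫ biprod.snd) ≫ e.right = x := by
    rw [← hh, Category.assoc, Category.assoc, ← Preadditive.comp_add, ← biprod.desc_eq]
  refine ⟨(RightFreyd.functor V).map (h ≫ biprod.snd) ≫ freydπ n, ?_⟩
  rw [Category.assoc, freydπ_comp_map, ← Category.assoc, ← Functor.map_comp, ← sub_eq_zero,
    ← Preadditive.sub_comp, ← Functor.map_sub, functor_map_comp_freydπ_eq_zero]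
  refine ⟨-(h ≫ biprod.fst), ?_⟩
  rw [← hc]
  simp

lemma exists_lift_of_epi {X : V} {M N : RightFreyd V} (e : N ⟶ M) [Epi e]
    (f : (RightFreyd.functor V).obj X ⟶ M) : ∃ f', f' ≫ e = f :=
  exists_lift_of_cokernel e f fun g hg => by
    rw [show g = 0 by rw [← cancel_epi e, hg, comp_zero], comp_zero]

instance (X : V) : Projective ((RightFreyd.functor V).obj X) where
  factors f e _ := exists_lift_of_epi e f

instance : HasBinaryBiproducts (RightFreyd V) where
  has_binary_biproduct M N := by
    obtain ⟨m, rfl⟩ := exists_quotient_obj M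
    obtain ⟨n, rfl⟩ := exists_quotient_obj N
    let Q := RightFreyd.quotient V
    let B : Arrow V := Arrow.mk (biprod.map m.hom n.hom)
    let i1 : m ⟶ B := Arrow.homMk (u := biprod.inl) (v := biprod.inl) (by simp [B])
    let i2 : n ⟶ B := Arrow.homMk (u := biprod.inr) (v := biprod.inr) (by simp [B])
    let p1 : B ⟶ m := Arrow.homMk (u := biprod.fst) (v := biprod.fst) (by simp [B])
    let p2 : B ⟶ n := Arrow.homMk (u := biprod.snd) (v := biprod.snd) (by simp [B])
    have e1 : i1 ≫ p1 = 𝟙 _ := by ext <;> simp [i1, p1]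
    have e2 : i2 ≫ p2 = 𝟙 _ := by ext <;> simp [i2, p2]
    have e3 : i1 ≫ p2 = 0 := by ext <;> simp [i1, p2]
    have e4 : i2 ≫ p1 = 0 := by ext <;> simp [i2, p1]
    have e5 : p1 ≫ i1 + p2 ≫ i2 = 𝟙 B := by ext <;> simp [i1, i2, p1, p2, B]
    let b : BinaryBicone (Q.obj m) (Q.obj n) :=
      { pt := Q.obj B
        fst := Q.map p1
        snd := Q.map p2
        inl := Q.map i1
        inr := Q.map i2
        inl_fst := (Q.map_comp _ _).symm.trans ((congrArg Q.map e1).trans (Q.map_id _))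
        inl_snd := (Q.map_comp _ _).symm.trans ((congrArg Q.map e3).trans (Q.map_zero _ _))
        inr_fst := (Q.map_comp _ _).symm.trans ((congrArg Q.map e4).trans (Q.map_zero _ _))
        inr_snd := (Q.map_comp _ _).symm.trans ((congrArg Q.map e2).trans (Q.map_id _)) }
    refine HasBinaryBiproduct.mk ⟨b, isBinaryBilimitOfTotal b ?_⟩
    change Q.map p1 ≫ Q.map i1 + Q.map p2 ≫ Q.map i2 = 𝟙 (Q.obj B)
    rw [← Q.map_comp, ← Q.map_comp, ← Q.map_add, e5, Q.map_id]

instance : HasFiniteBiproducts (RightFreyd V) :=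
  have : HasFiniteProducts (RightFreyd V) := hasFiniteProducts_of_has_binary_and_terminal
  HasFiniteBiproducts.of_hasFiniteProducts

variable (k : Type*) [Field k] [Linear k V]

instance : (RightFreyd.quotient V).Linear k where
  map_smul _ _ := rfl

variable (hfd : ∀ X Y : V, FiniteDimensional k (X ⟶ Y))

include hfd

lemma finiteDimensional_freyd (M N : RightFreyd V) : FiniteDimensional k (M ⟶ N) := by
  obtain ⟨m, rfl⟩ := exists_quotient_obj M
  obtain ⟨n, rfl⟩ := exists_quotient_obj N
  have : FiniteDimensional k (m ⟶ n) := by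
    have := hfd m.left n.left
    have := hfd m.right n.right
    refine FiniteDimensional.of_injective
      ({ toFun := fun f => (f.left, f.right)
         map_add' := fun _ _ => rfl
         map_smul' := fun _ _ => rfl } :
        (m ⟶ n) →ₗ[k] (m.left ⟶ n.left) × (m.right ⟶ n.right)) ?_
    intro f g h
    ext
    · exact congrArg Prod.fst h
    · exact congrArg Prod.snd h
  exact Module.Finite.of_surjective ((RightFreyd.quotient V).mapLinearMap k (X := m) (Y := n))
    (RightFreyd.quotient V).map_surjective

/-- The Freyd category of a finitary category with a finite set of indecomposables is abelian. -/
lemma isAbelianCat_freyd (Z : V) (hZ : ∀ X : V, addClosure (fun Y => Y = Z) X) :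
    IsAbelianCat (RightFreyd V) ∧ ∀ M : RightFreyd V,
      (∀ f : (RightFreyd.functor V).obj Z ⟶ M, f = 0) → IsZero M := by
  have hP : ∀ X : V, addClosure (fun Y => Y = (RightFreyd.functor V).obj Z)
      ((RightFreyd.functor V).obj X) := fun X => (hZ X).map _ (by rintro _ rfl; rfl)
  refine ⟨?_, fun M h => ?_⟩
  -- The criterion for full subcategories is applied to the subcategory of all objects; abelianness
  -- is then transported from finitely generated modules over a Noetherian ring.
  · have H : IsProgenerator k (D := (⊤ : ObjectProperty (RightFreyd V)).FullSubcategory)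
        ⟨(RightFreyd.functor V).obj Z, trivial⟩ := by
      refine IsProgenerator.of_presentations _ ⊤ trivial (finiteDimensional_freyd k hfd)
        (fun M _ => by
          obtain ⟨m, rfl⟩ := exists_quotient_obj M
          exact ⟨_, _, _, _, freyd_condition m, hP _, hP _, nonempty_isColimit_freydπ m⟩)
        (fun _ _ _ => trivial) ?_
      intro X₁ X₀ M f g hw h1 h0 hc
      have : Epi g := epi_of_isColimit_cofork hc
      refine ⟨fun x => exists_lift_of_epi g x, fun y hy => ?_⟩
      refine exists_lift_of_cokernel f y fun g' hg' => ?_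
      have h : g ≫ hc.desc (CokernelCofork.ofπ g' hg') = g' :=
        hc.fac (CokernelCofork.ofπ g' hg') WalkingParallelPair.one
      rw [← h, ← Category.assoc, hy, zero_comp]
    let F : RightFreyd V ⥤ (⊤ : ObjectProperty (RightFreyd V)).FullSubcategory :=
      ObjectProperty.lift _ (𝟭 _) (fun _ => trivial)
    have : F.IsEquivalence := 
      { faithful := inferInstance
        full := inferInstance
        essSurj := ⟨fun M => ⟨M.obj, ⟨Iso.refl _⟩⟩⟩ }
    have := H.finiteDimensional_end
    have : IsNoetherianRing (End (⟨(RightFreyd.functor V).obj Z, trivial⟩ :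
      (⊤ : ObjectProperty (RightFreyd V)).FullSubcategory))ᵐᵒᵖ := IsNoetherianRing.of_finite k _
    exact IsAbelianCat.of_equivalence (F ⋙ H.functor)
  · obtain ⟨m, rfl⟩ := exists_quotient_obj M
    rw [IsZero.iff_id_eq_zero, ← cancel_epi (freydπ m), comp_zero, Category.comp_id]
    exact (hP _).hom_ext (by rintro _ b rfl; rw [h (b ≫ freydπ m), comp_zero])

end Freyd

open Preadditive (RightFreyd)

instance (V : Type*) [Category* V] [Preadditive V] [IsAbelianCat (RightFreyd V)] :
    Abelian (RightFreyd V) := IsAbelianCat.abelian _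

lemma isZero_of_retract {D : Type*} [Category* D] [HasZeroMorphisms D] {X Y : D} (r : Retract X Y)
    (h : IsZero Y) : IsZero X := by
  rw [IsZero.iff_id_eq_zero, ← r.retract, h.eq_of_tgt r.i 0, zero_comp]

/-! ### Exactness of the action on principal 2-representations, and the involution. -/

section Action

variable {k : Type*} [Field k] {C : Type u} [Bicategory.{w, v} C]
  [∀ i j : C, Preadditive (i ⟶ j)]

section NoLinear

variable [BiadditiveComp C]

instance (i : C) {j l : C} (F : j ⟶ l) : (prinMap i F).Additive where
  map_add {X Y f g} := by
    obtain ⟨f, rfl⟩ := (RightFreyd.quotient _).map_surjective f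
    obtain ⟨g, rfl⟩ := (RightFreyd.quotient _).map_surjective g
    exact RightFreyd.quotient_congr (BiadditiveComp.add_whiskerRight _ _ _)
      (BiadditiveComp.add_whiskerRight _ _ _)

/-- The action of the 1-morphisms on an object of a principal 2-representation. -/
def actOn {i j : C} (M : RightFreyd (i ⟶ j)) (l : C) : (j ⟶ l) ⥤ RightFreyd (i ⟶ l) where
  obj F := (prinMap i F).obj M
  map α := (prinMap₂ i α).app M
  map_id F := RightFreyd.quotient_congr (whiskerLeft_id _ _) (whiskerLeft_id _ _)
  map_comp α β := RightFreyd.quotient_congr (whiskerLeft_comp _ _ _) (whiskerLeft_comp _ _ _)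

instance {i j : C} (M : RightFreyd (i ⟶ j)) (l : C) : (actOn M l).Additive where
  map_add := RightFreyd.quotient_congr (BiadditiveComp.whiskerLeft_add _ _ _)
    (BiadditiveComp.whiskerLeft_add _ _ _)

/-- The action of a composite. -/
def actComp (i : C) {j l m : C} (F : j ⟶ l) (G : l ⟶ m) (M : RightFreyd (i ⟶ j)) :
    (prinMap i (F ≫ G)).obj M ≅ (prinMap i G).obj ((prinMap i F).obj M) :=
  (prinComp i F G).app M

/-- The action of an adjunction. -/
def prinAdj (i : C) {j l : C} {F : j ⟶ l} {G : l ⟶ j} (adj : Bicategory.Adjunction F G) :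
    prinMap i F ⊣ prinMap i G :=
  CategoryTheory.Adjunction.ofCat ((principal i).mapAdjunction adj)

instance (i : C) {j l : C} (F : j ⟶ l) : (postcomp i F).Additive where
  map_add := BiadditiveComp.add_whiskerRight _ _ _

/-- `F` acts on the projective object `P_X`. -/
lemma nonempty_prinMap_projObj [∀ i j : C, HasFiniteBiproducts (i ⟶ j)] {i j l : C} (X : i ⟶ j)
    (F : j ⟶ l) : Nonempty ((prinMap i F).obj (projObj X) ≅ projObj (X ≫ F)) := by
  let _ := hasZeroObject_of_hasFiniteBiproducts (i ⟶ j)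
  let _ := hasZeroObject_of_hasFiniteBiproducts (i ⟶ l)
  have hz := (postcomp i F).map_isZero (isZero_zero (i ⟶ j))
  exact ⟨(RightFreyd.quotient _).mapIso (Arrow.isoMk
    (f := (postcomp i F).mapArrow.obj ((RightFreyd.rightFunctor (i ⟶ j)).obj X))
    (g := (RightFreyd.rightFunctor (i ⟶ l)).obj (X ≫ F))
    (hz.iso (isZero_zero _)) (Iso.refl (X ≫ F)) (hz.eq_of_src _ _))⟩

/-- Isomorphic 1-morphisms act by isomorphic functors. -/
def prinIso (i : C) {j l : C} {F G : j ⟶ l} (e : F ≅ G) : prinMap i F ≅ prinMap i G :=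
  Cat.Hom.toNatIso ((principal i).map₂Iso e)

lemma prinMap_isZero_of_retract {i j l : C} {F G : j ⟶ l} (r : Retract G F) {M : RightFreyd (i ⟶ j)}
    (h : IsZero ((prinMap i F).obj M)) : IsZero ((prinMap i G).obj M) :=
  isZero_of_retract (r.map (actOn M l)) h

section Star

variable (τ : Involution C) (hτ : τ.HasAdjunctions)

include hτ

lemma nonempty_adj_star (i : C) {j l : C} (F : j ⟶ l) :
    Nonempty (prinMap i F ⊣ prinMap i (τ.star F)) := by
  obtain ⟨adj⟩ := hτ F
  exact ⟨prinAdj i adj⟩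

/-- The adjunction `F* ⊣ F**` becomes `F* ⊣ F` through `F** ≅ F`; thus `F` is a right adjoint as
well as a left adjoint, and acts exactly. -/
lemma nonempty_star_adj (i : C) {j l : C} (F : j ⟶ l) :
    Nonempty (prinMap i (τ.star F) ⊣ prinMap i F) := by
  obtain ⟨adj⟩ := hτ (τ.star F)
  exact ⟨(prinAdj i adj).ofNatIsoRight (prinIso i (τ.starStar F))⟩

lemma prinMap_preservesFiniteLimits (i : C) {j l : C} (F : j ⟶ l) :
    PreservesFiniteLimits (prinMap i F) := by
  obtain ⟨adj⟩ := nonempty_star_adj τ hτ i F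
  have := adj.rightAdjoint_preservesLimits
  exact PreservesLimits.preservesFiniteLimits _

lemma prinMap_preservesFiniteColimits (i : C) {j l : C} (F : j ⟶ l) :
    PreservesFiniteColimits (prinMap i F) := by
  obtain ⟨adj⟩ := nonempty_adj_star τ hτ i F
  have := adj.leftAdjoint_preservesColimits
  exact PreservesColimits.preservesFiniteColimits _

end Star

end NoLinear

/-! ### Involutions and the cell orders -/

namespace Involution

variable (τ : Involution C)

lemma star₂_injective {i j : C} {F G : i ⟶ j} {η θ : F ⟶ G} (h : τ.star₂ η = τ.star₂ θ) :
    η = θ := by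
  rw [← cancel_epi (τ.starStar F).hom, ← τ.starStar_natural, ← τ.starStar_natural, h]

lemma star₂_surjective {i j : C} {F G : i ⟶ j} (θ : τ.star G ⟶ τ.star F) :
    ∃ η : F ⟶ G, τ.star₂ η = θ := by
  refine ⟨(τ.starStar F).inv ≫ τ.star₂ θ ≫ (τ.starStar G).hom, τ.star₂_injective ?_⟩
  rw [← cancel_mono (τ.starStar G).hom, τ.starStar_natural]
  simp

/-- The involution is not assumed additive on 2-morphisms. Since `star₂` is surjective, some `ζ` has
image zero, and `0 = ζ ≫ 0`. -/
lemma star₂_zero {i j : C} (F G : i ⟶ j) : τ.star₂ (0 : F ⟶ G) = 0 := by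
  obtain ⟨ζ, hζ⟩ := τ.star₂_surjective (0 : τ.star F ⟶ τ.star F)
  have : (0 : F ⟶ G) = ζ ≫ 0 := comp_zero.symm
  rw [this, τ.star₂_comp, hζ, comp_zero]

/-- The involution maps retracts to retracts. -/
def starRetract {i j : C} {F G : i ⟶ j} (r : Retract F G) : Retract (τ.star F) (τ.star G) where
  i := τ.star₂ r.r
  r := τ.star₂ r.i
  retract := by rw [← τ.star₂_comp, r.retract, τ.star₂_id]

lemma star_indecomposable [∀ i j : C, HasFiniteBiproducts (i ⟶ j)] {i j : C}
    [IsIdempotentComplete (i ⟶ j)] {F : i ⟶ j}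
    (hF : Indecomposable F) : Indecomposable (τ.star F) := by
  refine indecomposable_of_idempotents (fun h => hF.1 ?_) fun e he => ?_
  · rw [IsZero.iff_id_eq_zero]
    apply τ.star₂_injective
    exact h.eq_of_src _ _
  · obtain ⟨η, rfl⟩ := τ.star₂_surjective e
    have : η ≫ η = η := τ.star₂_injective (by rw [τ.star₂_comp, he])
    rcases Indecomposable.idempotent hF η this with rfl | rfl
    · exact .inl (τ.star₂_zero F F)
    · exact .inr (τ.star₂_id F)

end Involution

namespace OneMor

lemma leR_iff {i j l : C} {F : i ⟶ j} {G : i ⟶ l} :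
    LeR ⟨i, j, F⟩ ⟨i, l, G⟩ ↔ ∃ H : j ⟶ l, Nonempty (Retract G (F ≫ H)) :=
  ⟨fun h => by cases h with | mk _ H _ r => exact ⟨H, ⟨r⟩⟩, fun ⟨H, ⟨r⟩⟩ => .mk F H G r⟩

lemma leL_iff {i j l : C} {F : i ⟶ j} {G : l ⟶ j} :
    LeL ⟨i, j, F⟩ ⟨l, j, G⟩ ↔ ∃ H : l ⟶ i, Nonempty (Retract G (H ≫ F)) :=
  ⟨fun h => by cases h with | mk _ H _ r => exact ⟨H, ⟨r⟩⟩, fun ⟨H, ⟨r⟩⟩ => .mk F H G r⟩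

lemma LeR.of_retract {i j : C} {F G : i ⟶ j} (r : Retract G F) : LeR ⟨i, j, F⟩ ⟨i, j, G⟩ :=
  .mk _ (𝟙 j) _ (r.trans (Retract.ofIso (ρ_ F).symm))

lemma LeL.of_retract {i j : C} {F G : i ⟶ j} (r : Retract G F) : LeL ⟨i, j, F⟩ ⟨i, j, G⟩ :=
  .mk _ (𝟙 i) _ (r.trans (Retract.ofIso (λ_ F).symm))

lemma LeL.refl (F : OneMor C) : LeL F F := .of_retract (Retract.refl _)

lemma LeR.trans {F G H : OneMor C} (h : LeR F G) (h' : LeR G H) : LeR F H := by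
  cases h with | mk F X G r =>
  cases h' with | mk _ Y H r' =>
  exact .mk F (X ≫ Y) H (r'.trans ((r.map (postcomp _ Y)).trans (Retract.ofIso (α_ F X Y))))

lemma LeL.trans {F G H : OneMor C} (h : LeL F G) (h' : LeL G H) : LeL F H := by
  cases h with | mk F X G r =>
  cases h' with | mk _ Y H r' =>
  exact .mk F (Y ≫ X) H (r'.trans ((r.map (precomp _ Y)).trans (Retract.ofIso (α_ Y X F).symm)))

lemma LeR.leLR {F G : OneMor C} (h : LeR F G) : LeLR F G := by
  cases h with | mk F X G r => exact ⟨𝟙 _, X, ⟨r.trans (Retract.ofIso (λ_ _).symm)⟩⟩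

lemma LeL.leLR {F G : OneMor C} (h : LeL F G) : LeLR F G := by
  cases h with | mk F X G r =>
  exact ⟨X, 𝟙 _, ⟨r.trans (Retract.ofIso (whiskerLeftIso X (ρ_ F).symm))⟩⟩

lemma LeLR.trans {F G H : OneMor C} (h : LeLR F G) (h' : LeLR G H) : LeLR F H := by
  obtain ⟨X₁, X₂, ⟨r⟩⟩ := h
  obtain ⟨Y₁, Y₂, ⟨r'⟩⟩ := h'
  refine ⟨Y₁ ≫ X₁, X₂ ≫ Y₂, ⟨r'.trans (((r.map (postcomp _ Y₂)).map (precomp _ Y₁)).trans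
    (Retract.ofIso ?_))⟩⟩
  exact whiskerLeftIso Y₁ (α_ X₁ (F.hom ≫ X₂) Y₂ ≪≫ whiskerLeftIso X₁ (α_ F.hom X₂ Y₂)) ≪≫
    (α_ Y₁ X₁ _).symm

lemma Isom.leR {F G : OneMor C} (h : Isom F G) : LeR F G := by
  cases h with | mk e => exact .of_retract (Retract.ofIso e.symm)

lemma Isom.leL {F G : OneMor C} (h : Isom F G) : LeL F G := by
  cases h with | mk e => exact .of_retract (Retract.ofIso e.symm)

lemma Isom.symm {F G : OneMor C} (h : Isom F G) : Isom G F := by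
  cases h with | mk e => exact .mk e.symm

variable (τ : Involution C)

/-- The image of a 1-morphism under the involution. -/
def star (F : OneMor C) : OneMor C := ⟨F.tgt, F.src, τ.star F.hom⟩

variable {τ}

lemma star_star_isom (F : OneMor C) : Isom ((F.star τ).star τ) F := .mk (τ.starStar F.hom)

lemma LeR.star {F G : OneMor C} (h : LeR F G) : LeL (F.star τ) (G.star τ) := by
  cases h with | mk F X G r =>
  exact .mk _ (τ.star X) _ ((τ.starRetract r).trans (Retract.ofIso (τ.starComp F X)))

lemma LeL.star {F G : OneMor C} (h : LeL F G) : LeR (F.star τ) (G.star τ) := by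
  cases h with | mk F X G r =>
  exact .mk _ (τ.star X) _ ((τ.starRetract r).trans (Retract.ofIso (τ.starComp X F)))

end OneMor

end Action

attribute [local instance 2000] CategoryStruct.toQuiver Bicategory.homCategory

/-! ### Finitary 2-categories and the combinatorics of a strongly regular cell. -/

section Setup

variable {k : Type*} [Field k] {C : Type u} [Bicategory.{w, v} C]
  [∀ i j : C, Preadditive (i ⟶ j)] [∀ i j : C, Linear k (i ⟶ j)]
  [∀ i j : C, HasFiniteBiproducts (i ⟶ j)]

namespace IsFinitary

variable (hC : IsFinitary k C)
include hC

lemma exists_generator (i j : C) : ∃ Z : i ⟶ j, ∀ X : i ⟶ j, addClosure (fun Y => Y = Z) X := by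
  obtain ⟨S, hS, h⟩ := hC.finite_indecomposables i j
  have := hS.to_subtype
  let _ := Fintype.ofFinite S
  refine ⟨⨁ fun s : S => s.1, fun X => (addClosure_indecomposable k
    (fun X Y => hC.finiteDimensional X Y) X).trans fun Y hY => ?_⟩
  obtain ⟨G, hG, ⟨e⟩⟩ := h Y hY.1
  exact .of_iso e (.retract (⟨biproduct.ι (fun s : S => s.1) ⟨G, hG⟩,
    biproduct.π (fun s : S => s.1) ⟨G, hG⟩, by simp⟩) (.of_mem rfl))

lemma isAbelianCat (i j : C) : IsAbelianCat (RightFreyd (i ⟶ j)) := by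
  obtain ⟨Z, hZ⟩ := hC.exists_generator i j
  exact (isAbelianCat_freyd k (fun X Y => hC.finiteDimensional X Y) Z hZ).1

lemma finiteDimensional_hom {i j : C} (M N : RightFreyd (i ⟶ j)) : FiniteDimensional k (M ⟶ N) :=
  finiteDimensional_freyd k (fun X Y => hC.finiteDimensional X Y) M N

lemma exists_projGenerator [∀ i j : C, IsAbelianCat (RightFreyd (i ⟶ j))] (i j : C) :
    ∃ Z : i ⟶ j, IsProjGenerator k (projObj Z) := by
  obtain ⟨Z, hZ⟩ := hC.exists_generator i j
  exact ⟨Z, fun M => hC.finiteDimensional_hom _ M,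
    inferInstanceAs (Projective ((RightFreyd.functor _).obj Z)),
    (isAbelianCat_freyd k (fun X Y => hC.finiteDimensional X Y) Z hZ).2⟩

lemma isLocalObj {i j : C} {F : i ⟶ j} (hF : Indecomposable F) : IsLocalObj F :=
  have := hC.isIdempotentComplete i j
  have := hC.finiteDimensional F F
  Indecomposable.isLocalObj k hF

lemma decomposition {i j : C} (F : i ⟶ j) :
    addClosure (fun Y : i ⟶ j => Indecomposable Y ∧ Nonempty (Retract Y F)) F :=
  addClosure_indecomposable k (fun X Y => hC.finiteDimensional X Y) F

lemma isLocalObj_projObj {i j : C} {F : i ⟶ j} (hF : Indecomposable F) :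
    IsLocalObj (projObj F) := by
  have hl := hC.isLocalObj hF
  refine ⟨fun h => hl.not_isZero ?_, fun f => ?_⟩
  · rw [IsZero.iff_id_eq_zero] at h ⊢
    apply (RightFreyd.functor _).map_injective
    rw [CategoryTheory.Functor.map_id, Functor.map_zero]
    exact h
  · obtain ⟨f, rfl⟩ := (RightFreyd.functor (i ⟶ j)).map_surjective f
    rcases hl.isIso_or_isNilpotent f with h | ⟨n, hn⟩
    · exact .inl (Functor.map_isIso (RightFreyd.functor (i ⟶ j)) f)
    · refine .inr ⟨n, ?_⟩
      have h1 := congrArg (fun x => (RightFreyd.functor (i ⟶ j)).map x) hn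
      exact ((map_pow ((RightFreyd.functor (i ⟶ j)).mapEnd F) (End.of f) n).symm.trans h1).trans
        (Functor.map_zero _ _ _)

end IsFinitary

instance {i j : C} (F : i ⟶ j) : Projective (projObj F) :=
  inferInstanceAs (Projective ((RightFreyd.functor _).obj F))

lemma exists_epi_projObj {i j : C} (M : RightFreyd (i ⟶ j)) :
    ∃ (X : i ⟶ j) (f : projObj X ⟶ M), Epi f := by
  obtain ⟨m, rfl⟩ := exists_quotient_obj M
  let _ := hasZeroObject_of_hasFiniteBiproducts (i ⟶ j)
  exact ⟨m.right, freydπ m, inferInstanceAs (Epi (freydπ m))⟩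

/-- The standing assumptions on a right cell of a strongly regular two-sided cell. -/
structure CellSetup (k : Type*) [Field k] {C : Type u} [Bicategory.{w, v} C]
    [∀ i j : C, Preadditive (i ⟶ j)] [∀ i j : C, Linear k (i ⟶ j)]
    [∀ i j : C, HasFiniteBiproducts (i ⟶ j)] (τ : Involution C) (Q R : Set (OneMor C)) (i : C) :
    Prop where
  fin : IsFinitary k C
  adj : τ.HasAdjunctions
  reg : IsStronglyRegular Q
  isRightCell : IsRightCell R
  sub : R ⊆ Q
  src : ∃ F ∈ R, F.src = i

namespace CellSetup

open OneMor

variable {τ : Involution C} {Q R : Set (OneMor C)} {i : C} (hs : CellSetup k τ Q R i)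

include hs

lemma indec {F : OneMor C} (hF : F ∈ R) : F.Indec := by
  obtain ⟨F₀, -, rfl⟩ := hs.isRightCell
  exact hF.1

lemma leR {F G : OneMor C} (hF : F ∈ R) (hG : G ∈ R) : LeR F G := by
  obtain ⟨F₀, -, rfl⟩ := hs.isRightCell
  exact hF.2.2.trans hG.2.1

lemma mem_of_leR_leR {F G : OneMor C} (hF : F ∈ R) (hG : G.Indec) (h : LeR F G) (h' : LeR G F) :
    G ∈ R := by
  obtain ⟨F₀, -, rfl⟩ := hs.isRightCell
  exact ⟨hG, hF.2.1.trans h, h'.trans hF.2.2⟩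

lemma src_eq {F : OneMor C} (hF : F ∈ R) : F.src = i := by
  obtain ⟨G, hG, rfl⟩ := hs.src
  cases hs.leR hF hG
  rfl

lemma indec_Q {F : OneMor C} (hF : F ∈ Q) : F.Indec := by
  obtain ⟨F₀, -, rfl⟩ := hs.reg.isTwoSidedCell
  exact hF.1

lemma mem_Q_of_leLR {F G H : OneMor C} (hF : F ∈ Q) (hH : H ∈ Q) (hG : G.Indec) (h : LeLR F G)
    (h' : LeLR G H) : G ∈ Q := by
  obtain ⟨F₀, -, rfl⟩ := hs.reg.isTwoSidedCell
  exact ⟨hG, hF.2.1.trans h, h'.trans hH.2.2⟩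

lemma mem_of_leR {F G : OneMor C} (hF : F ∈ R) (hG : G ∈ Q) (h : LeR F G) : G ∈ R :=
  hs.mem_of_leR_leR hF (hs.indec_Q hG) h (hs.reg.regular _ (hs.sub hF) _ hG h)

/-- The triangle identity exhibits `F` as a direct summand of `F F* F`. -/
lemma leLR_star (F : OneMor C) : LeLR (F.star τ) F := by
  obtain ⟨adj⟩ := hs.adj F.hom
  refine ⟨F.hom, F.hom, ⟨⟨(λ_ _).inv ≫ adj.unit ▷ F.hom ≫ (α_ _ _ _).hom,
    F.hom ◁ adj.counit ≫ (ρ_ _).hom, ?_⟩⟩⟩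
  have := adj.left_triangle
  simp only [leftZigzag, bicategoricalComp] at this
  simp at this
  have h := congrArg (fun t => (λ_ F.hom).inv ≫ t ≫ (ρ_ F.hom).hom) this
  simp only [Category.assoc, Iso.inv_hom_id_assoc, Iso.inv_hom_id, Category.comp_id] at h
  rw [Category.assoc]
  exact (congrArg (fun t => (λ_ F.hom).inv ≫ t) (Category.assoc _ _ _)).trans h

lemma indec_star {F : OneMor C} (hF : F.Indec) : (F.star τ).Indec :=
  have := hs.fin.isIdempotentComplete F.src F.tgt
  τ.star_indecomposable hF

lemma star_mem_Q {F : OneMor C} (hF : F ∈ Q) : F.star τ ∈ Q := by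
  refine hs.mem_Q_of_leLR hF hF (hs.indec_star (hs.indec_Q hF)) ?_ (hs.leLR_star F)
  exact (star_star_isom F).symm.leR.leLR.trans (hs.leLR_star (F.star τ))

/-- Regularity is assumed only for the right order. The involution preserves `Q` and exchanges the
two orders, which gives the statement for the left order. -/
lemma leL_symm {F G : OneMor C} (hF : F ∈ Q) (hG : G ∈ Q) (h : LeL F G) : LeL G F := by
  have h1 := hs.reg.regular _ (hs.star_mem_Q hF) _ (hs.star_mem_Q hG) h.star
  exact (star_star_isom G).symm.leL.trans (h1.star.trans (star_star_isom F).leL)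

lemma leftCell_sub {F : OneMor C} (hF : F ∈ Q) : F.leftCell ⊆ Q := fun _ hG =>
  hs.mem_Q_of_leLR hF hF hG.1 hG.2.1.leLR hG.2.2.leLR

/-- Two elements of the right cell which are in the same left cell are isomorphic. -/
lemma isom_of_leL {F G : OneMor C} (hF : F ∈ R) (hG : G ∈ R) (h : LeL F G) : Isom F G := by
  obtain ⟨X, -, hX⟩ := hs.reg.inter F.leftCell R ⟨F, hs.indec hF, rfl⟩ hs.isRightCell
    (hs.leftCell_sub (hs.sub hF)) hs.sub
  have h1 := hX F ⟨⟨hs.indec hF, .refl _, .refl _⟩, hF⟩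
  have h2 := hX G ⟨⟨hs.indec hG, h, hs.leL_symm (hs.sub hF) (hs.sub hG) h⟩, hG⟩
  cases h1 with | mk e => cases h2 with | mk e' => exact .mk (e.symm ≪≫ e')

lemma exists_mem_leL {F : OneMor C} (hF : F ∈ Q) : ∃ H ∈ R, LeL H F ∧ LeL F H := by
  obtain ⟨X, hX, -⟩ := hs.reg.inter F.leftCell R ⟨F, hs.indec_Q hF, rfl⟩ hs.isRightCell
    (hs.leftCell_sub hF) hs.sub
  exact ⟨X, hX.2, hX.1.2.2, hX.1.2.1⟩

end CellSetup

end Setup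

/-! ### Exact functors -/

section ExactFunctors

variable {D D' : Type*} [Category* D] [Category* D'] [Abelian D] [Abelian D'] (F : D ⥤ D')
  [F.Additive]

lemma isZero_map_cokernel [PreservesFiniteColimits F] {M N : D} (f : M ⟶ N) [Epi (F.map f)] :
    IsZero (F.obj (cokernel f)) := by
  rw [IsZero.iff_id_eq_zero, ← cancel_epi (F.map (cokernel.π f)), ← cancel_epi (F.map f)]
  rw [Category.comp_id, ← F.map_comp, cokernel.condition, F.map_zero]
  simp

lemma isZero_of_isZero_map_kernel [PreservesFiniteColimits F] {M N : D} (f : M ⟶ N) [Epi f]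
    [Epi (F.map (kernel.ι f))] : IsZero (F.obj N) := by
  rw [IsZero.iff_id_eq_zero, ← cancel_epi (F.map f), ← cancel_epi (F.map (kernel.ι f))]
  rw [Category.comp_id, ← F.map_comp, kernel.condition, F.map_zero]
  simp

lemma epi_map_of_isZero_cokernel [PreservesFiniteColimits F] {M N : D} (f : M ⟶ N)
    (h : IsZero (F.obj (cokernel f))) : Epi (F.map f) := by
  refine Preadditive.epi_of_isZero_cokernel _ (h.of_iso ?_)
  exact (PreservesCokernel.iso F f).symm

lemma isIso_map_of_isZero_cokernel [PreservesFiniteLimits F] [PreservesFiniteColimits F] {M N : D}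
    (f : M ⟶ N) [Mono f] (h : IsZero (F.obj (cokernel f))) : IsIso (F.map f) := by
  have := epi_map_of_isZero_cokernel F f h
  exact isIso_of_mono_of_epi _

/-- The cokernel of `ker f → M` is the coimage of `f`, a subobject of `N`, so `F` kills it. -/
lemma epi_map_kernel_ι [PreservesFiniteLimits F] [PreservesFiniteColimits F] {M N : D}
    (f : M ⟶ N) (h : IsZero (F.obj N)) : Epi (F.map (kernel.ι f)) := by
  refine epi_map_of_isZero_cokernel F _ ?_
  rw [IsZero.iff_id_eq_zero]
  have : Mono (F.map (Abelian.coimageImageComparison f)) := inferInstance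
  have h1 : Mono (F.map (Abelian.factorThruCoimage f)) := inferInstance
  change 𝟙 (F.obj (Abelian.coimage f)) = 0
  rw [← cancel_mono (F.map (Abelian.factorThruCoimage f))]
  exact h.eq_of_tgt _ _

lemma epi_desc_map {X Y Z : D} (f : X ⟶ Z) (g : Y ⟶ Z) [Epi (F.map (biprod.desc f g))] :
    Epi (biprod.desc (F.map f) (F.map g)) := by
  have h : biprod.lift (F.map biprod.fst) (F.map biprod.snd) ≫ biprod.desc (F.map f) (F.map g) =
      F.map (biprod.desc f g) := by
    rw [biprod.lift_desc, ← F.map_comp, ← F.map_comp, ← F.map_add]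
    congr 1
    ext <;> simp
  have : Epi (biprod.lift (F.map biprod.fst) (F.map biprod.snd) ≫
    biprod.desc (F.map f) (F.map g)) := by rw [h]; infer_instance
  exact epi_of_epi (biprod.lift (F.map biprod.fst) (F.map biprod.snd)) _

lemma isSubquotient_cokernel {S M N : D} (i : N ⟶ M) (h : IsSubquotient S (cokernel i)) :
    IsSubquotient S M := by
  obtain ⟨M', m, e, hm, he⟩ := h
  exact ⟨pullback m (cokernel.π i), pullback.snd _ _, pullback.fst _ _ ≫ e, inferInstance,
    epi_comp _ _⟩

lemma isZero_map_of_isSubquotient [PreservesFiniteLimits F] [PreservesFiniteColimits F] {S N : D}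
    (h : IsSubquotient S N) (hN : IsZero (F.obj N)) : IsZero (F.obj S) := by
  obtain ⟨M, m, e, hm, he⟩ := h
  have h1 : IsZero (F.obj M) := by
    rw [IsZero.iff_id_eq_zero, ← cancel_mono (F.map m)]
    exact hN.eq_of_tgt _ _
  rw [IsZero.iff_id_eq_zero, ← cancel_epi (F.map e)]
  exact h1.eq_of_src _ _

end ExactFunctors

/-- An exact functor annihilates an object if it annihilates its simple subquotients. -/
lemma IsProjGenerator.isZero_map {k : Type*} [Field k] {D : Type*} [Category.{w} D] [Abelian D]
    [Linear k D] {X : D} (hX : IsProjGenerator k X) {D' : Type*} [Category* D'] [Abelian D']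
    (F : D ⥤ D') [F.Additive] [PreservesFiniteLimits F] [PreservesFiniteColimits F] (M : D)
    (h : ∀ S : D, Simple S → IsSubquotient S M → IsZero (F.obj S)) : IsZero (F.obj M) := by
  revert h
  refine hX.devissage
    (fun M => (∀ S : D, Simple S → IsSubquotient S M → IsZero (F.obj S)) → IsZero (F.obj M))
    (fun M hM _ => F.map_isZero hM) (fun S M i hS hi ih h => ?_) M
  have h1 := ih fun T hT hT' => h T hT (isSubquotient_cokernel i hT')
  have := isIso_map_of_isZero_cokernel F i h1
  exact (h S hS ⟨S, i, 𝟙 S, hi, inferInstance⟩).of_iso (asIso (F.map i)).symm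

/-- A 2-category acting by exact functors on its principal 2-representations, which are abelian. -/
class HasExactAction (C : Type u) [Bicategory.{w, v} C] [∀ i j : C, Preadditive (i ⟶ j)]
    [∀ i j : C, IsAbelianCat (RightFreyd (i ⟶ j))] [BiadditiveComp C] : Prop where
  preservesFiniteLimits (i : C) {j l : C} (F : j ⟶ l) : PreservesFiniteLimits (prinMap i F)
  preservesFiniteColimits (i : C) {j l : C} (F : j ⟶ l) : PreservesFiniteColimits (prinMap i F)

attribute [instance] HasExactAction.preservesFiniteLimits HasExactAction.preservesFiniteColimits

/-! ### Existence of the simple top of `K_R`. -/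

section CellTop

variable {k : Type*} [Field k] {C : Type u} [Bicategory.{w, v} C]
  [∀ i j : C, Preadditive (i ⟶ j)] [∀ i j : C, Linear k (i ⟶ j)]
  [∀ i j : C, HasFiniteBiproducts (i ⟶ j)] [BiadditiveComp C]
  [∀ i j : C, IsAbelianCat (RightFreyd (i ⟶ j))] [HasExactAction C]

lemma nonempty_prinMap_projObj_id (i : C) {j : C} (F : i ⟶ j) :
    Nonempty ((prinMap i F).obj (projObj (𝟙 i)) ≅ projObj F) := by
  obtain ⟨e⟩ := nonempty_prinMap_projObj (𝟙 i) F
  exact ⟨e ≪≫ (RightFreyd.functor _).mapIso (λ_ F)⟩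

/-- The data attached to the simple top `L` of the subobject `K` of `P_{𝟙 i}` given by the right
cell `R`. -/
structure CellTopData (R : Set (OneMor C)) (i : C) (L : RightFreyd (i ⟶ i)) where
  K : RightFreyd (i ⟶ i)
  e : K ⟶ L
  isSimpleTop_e : IsSimpleTop e
  G : i ⟶ i
  p : projObj G ⟶ L
  indecomposable : Indecomposable G
  isSimpleTop_p : IsSimpleTop p
  nonempty_iso {j : C} (F : i ⟶ j) (hF : ⟨i, j, F⟩ ∈ R) :
    Nonempty ((prinMap i F).obj K ≅ projObj F)
  not_isZero {j : C} (F : i ⟶ j) (hF : ⟨i, j, F⟩ ∈ R) : ¬ IsZero ((prinMap i F).obj L)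

lemma IsFinitary.decomposition_projObj (hC : IsFinitary k C) {i j : C} (F : i ⟶ j) :
    addClosure (fun P : RightFreyd (i ⟶ j) => ∃ G : i ⟶ j, Indecomposable G ∧ P = projObj G)
      (projObj F) :=
  (hC.decomposition F).map (RightFreyd.functor (i ⟶ j)) fun G hG => ⟨G, hG.1, rfl⟩

/-- Some indecomposable summand of a projective cover of `L` by `P_X` maps nontrivially to `L`, and
it is hollow. -/
lemma IsFinitary.exists_isSimpleTop (hC : IsFinitary k C) {i j : C} (L : RightFreyd (i ⟶ j))
    [Simple L] : ∃ (G : i ⟶ j) (p : projObj G ⟶ L), Indecomposable G ∧ IsSimpleTop p := by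
  obtain ⟨X, f, hf⟩ := exists_epi_projObj L
  have hf0 : f ≠ 0 := fun h => Simple.not_isZero L
    ((IsZero.iff_id_eq_zero L).2 (by rw [← cancel_epi f, h]; simp))
  obtain ⟨_, ⟨G, hG, rfl⟩, b, hb⟩ := (hC.decomposition_projObj X).exists_summand hf0
  have hl := hC.isLocalObj_projObj hG
  exact ⟨G, _, hG, (hl.isHollow (𝟙 (projObj G)) hl.not_isZero).isSimpleTop hb⟩

namespace CellSetup

open OneMor

variable {τ : Involution C} {Q R : Set (OneMor C)} {i : C} (hs : CellSetup k τ Q R i)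

include hs

lemma isZero_of_isZero {j l : C} {F : i ⟶ j} {F' : i ⟶ l} (hF : ⟨i, j, F⟩ ∈ R)
    (hF' : ⟨i, l, F'⟩ ∈ R) {M : RightFreyd (i ⟶ i)} (h : IsZero ((prinMap i F).obj M)) :
    IsZero ((prinMap i F').obj M) := by
  obtain ⟨H, ⟨r⟩⟩ := leR_iff.1 (hs.leR hF hF')
  exact prinMap_isZero_of_retract r (((prinMap i H).map_isZero h).of_iso (actComp i F H M))

/-- By dévissage `F` kills `P_1 / K`, so exactness turns the inclusion into an isomorphism `F K ≅ F
P_1 ≅ P_F`. -/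
lemma nonempty_cellTopData {L : RightFreyd (i ⟶ i)} (h : IsCellTop R i L) :
    Nonempty (CellTopData R i L) := by
  obtain ⟨K, N, ι, π, hw, hι, ⟨hcol⟩, hN, ⟨e, he⟩, ⟨G, p, hG, hp⟩, hL⟩ := h
  refine ⟨⟨K, e, he, G, p, hG, hp, fun {j} F hF => ?_, fun {j} F hF => hL j F hF⟩⟩
  obtain ⟨Z, hZ⟩ := hs.fin.exists_projGenerator i i
  have h1 : IsZero ((prinMap i F).obj N) :=
    hZ.isZero_map (prinMap i F) N fun S hS hSN => hN S hS hSN j F hF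
  have h2 : IsZero ((prinMap i F).obj (cokernel ι)) := h1.of_iso ((prinMap i F).mapIso
    ((cokernelIsCokernel ι).coconePointUniqueUpToIso hcol))
  have := isIso_map_of_isZero_cokernel (prinMap i F) ι h2
  obtain ⟨e'⟩ := nonempty_prinMap_projObj_id i F
  exact ⟨asIso ((prinMap i F).map ι) ≪≫ e'⟩

/-- `K` is a subobject of `P_1` of minimal size with `F₀ K = F₀ P_1`. One element `F₀` of `R`
suffices, since all elements of `R` annihilate the same objects. -/
lemma exists_isCellTop : ∃ L, IsCellTop R i L := by
  obtain ⟨⟨i, j₀, F₀⟩, hF₀, rfl⟩ := hs.src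
  obtain ⟨Z, hZ⟩ := hs.fin.exists_projGenerator i i
  classical
  have hex : ∃ n : ℕ, ∃ (K : RightFreyd (i ⟶ i)) (ι : K ⟶ projObj (𝟙 i)), Mono ι ∧
      Epi ((prinMap i F₀).map ι) ∧ Module.finrank k (projObj Z ⟶ K) = n :=
    ⟨_, _, 𝟙 _, inferInstance, inferInstance, rfl⟩
  obtain ⟨K, ι, hι, hepi, hK⟩ := Nat.find_spec hex
  have hmin := fun m => @Nat.find_min _ _ hex m
  rw [← hK] at hmin
  obtain ⟨e₁⟩ := nonempty_prinMap_projObj_id i F₀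
  have := isIso_of_mono_of_epi ((prinMap i F₀).map ι)
  let eK : projObj F₀ ⟶ (prinMap i F₀).obj K := e₁.inv ≫ inv ((prinMap i F₀).map ι)
  have : IsIso eK := inferInstanceAs (IsIso (e₁.inv ≫ inv ((prinMap i F₀).map ι)))
  have hl := hs.fin.isLocalObj_projObj (hs.indec hF₀)
  have hK0 : ¬ IsZero ((prinMap i F₀).obj K) := fun h => hl.not_isZero (h.of_iso (asIso eK))
  have hhol : IsHollow ((prinMap i F₀).obj K) := hl.isHollow eK hK0
  -- If `F₀` killed a simple quotient of `K`, the kernel would be a smaller subobject with the same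
  -- image under `F₀`.
  have key : ∀ (T : RightFreyd (i ⟶ i)) [Simple T] (g : K ⟶ T), g ≠ 0 →
      ¬ IsZero ((prinMap i F₀).obj T) := by
    intro T _ g hg h
    have := epi_map_kernel_ι (prinMap i F₀) g h
    refine hmin _ (hZ.finrank_lt_of_mono (kernel.ι g) fun h' => not_epi_kernel_ι hg inferInstance)
      ⟨kernel g, kernel.ι g ≫ ι, mono_comp _ _, ?_, rfl⟩
    rw [Functor.map_comp]
    exact epi_comp _ _
  obtain ⟨L, e, hL, he⟩ := hZ.exists_simple_quotient (M := K)
    fun h => hK0 ((prinMap i F₀).map_isZero h)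
  have he0 : e ≠ 0 := fun h => Simple.not_isZero L
    ((IsZero.iff_id_eq_zero L).2 (by rw [← cancel_epi e, h]; simp))
  have hker : ∀ (T : RightFreyd (i ⟶ i)) [Simple T] (g : K ⟶ T), g ≠ 0 →
      ¬ Epi ((prinMap i F₀).map (kernel.ι g)) := by
    intro T _ g hg h
    have := epi_of_nonzero_to_simple hg
    exact key T g hg (isZero_of_isZero_map_kernel (prinMap i F₀) g)
  obtain ⟨G, p, hG, hp⟩ := hs.fin.exists_isSimpleTop L
  refine ⟨L, K, cokernel ι, ι, cokernel.π ι, cokernel.condition ι, hι, ⟨cokernelIsCokernel ι⟩,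
    fun S hS hSN j F hF => ?_, ⟨e, hL, he, fun T hT g => ?_⟩, ⟨G, p, hG, hp⟩,
    fun j F hF h => key L e he0 (hs.isZero_of_isZero hF hF₀ h)⟩
  · exact hs.isZero_of_isZero hF₀ hF (isZero_map_of_isSubquotient (prinMap i F₀) hSN
      (isZero_map_cokernel (prinMap i F₀) ι))
  · by_cases hg : g = 0
    · exact ⟨0, by simp [hg]⟩
    -- Two essentially different simple quotients would have kernels summing to `K`. Their images
    -- under `F₀` would then sum to `F₀ K ≅ P_{F₀}`, although both are proper and `P_{F₀}` is
    -- hollow.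
    refine exists_factor_of_not_epi he0 fun h => ?_
    rcases hhol.epi_or_epi _ _ (epi_desc_map (prinMap i F₀) (kernel.ι e) (kernel.ι g)) with h | h
    · exact hker L e he0 h
    · exact hker T g hg h

lemma isCellTop_cellTop : IsCellTop R i (cellTop R i) := by
  have h := hs.exists_isCellTop
  rw [cellTop, dif_pos h]
  exact h.choose_spec

end CellSetup

end CellTop

section Adjunctions

variable {D D' : Type*} [Category* D] [Category* D'] [Preadditive D] [Preadditive D'] {F : D ⥤ D'}
  {G : D' ⥤ D} (adj : F ⊣ G)

lemma homEquiv_symm_ne_zero [G.Additive] {X : D} {Y : D'} {f : X ⟶ G.obj Y} (hf : f ≠ 0) :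
    (adj.homEquiv X Y).symm f ≠ 0 := fun h => hf (by
  rw [← (adj.homEquiv X Y).apply_symm_apply f, h, adj.homEquiv_unit, G.map_zero, comp_zero])

end Adjunctions

lemma epi_ne_zero {D : Type*} [Category* D] [HasZeroMorphisms D] {X Y : D} (f : X ⟶ Y) [Epi f]
    (h : ¬ IsZero Y) : f ≠ 0 := fun h0 =>
  h ((IsZero.iff_id_eq_zero Y).2 (by rw [← cancel_epi f, h0]; simp))

/-! ### The 1-morphism `G` and the action of the right cell on `L`. -/

section CellFacts

variable {k : Type*} [Field k] {C : Type u} [Bicategory.{w, v} C]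
  [∀ i j : C, Preadditive (i ⟶ j)] [∀ i j : C, Linear k (i ⟶ j)]
  [∀ i j : C, HasFiniteBiproducts (i ⟶ j)] [BiadditiveComp C]
  [∀ i j : C, IsAbelianCat (RightFreyd (i ⟶ j))] [HasExactAction C]
  {τ : Involution C} {Q R : Set (OneMor C)} {i : C}

lemma exists_lift_projObj {i j : C} {F : i ⟶ j} {M N : RightFreyd (i ⟶ j)} (f : projObj F ⟶ N)
    (g : M ⟶ N) [Epi g] : ∃ f', f' ≫ g = f :=
  ⟨Projective.factorThru (P := projObj F) f g, Projective.factorThru_comp (P := projObj F) f g⟩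

lemma retract_of_epi_projObj {i j : C} {F G : i ⟶ j} (x : projObj F ⟶ projObj G) [Epi x] :
    Nonempty (Retract G F) := by
  obtain ⟨s, hs⟩ := exists_lift_projObj (𝟙 (projObj G)) x
  obtain ⟨s, rfl⟩ := (RightFreyd.functor (i ⟶ j)).map_surjective s
  obtain ⟨x, rfl⟩ := (RightFreyd.functor (i ⟶ j)).map_surjective x
  refine ⟨⟨s, x, (RightFreyd.functor (i ⟶ j)).map_injective ?_⟩⟩
  rw [Functor.map_comp, CategoryTheory.Functor.map_id]
  exact hs

namespace CellTopData

open OneMor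

variable {L : RightFreyd (i ⟶ i)} (d : CellTopData R i L) (hs : CellSetup k τ Q R i)


include d in
lemma simple : Simple L := d.isSimpleTop_e.simple

include d hs

lemma isHollow_projObj : IsHollow (projObj d.G) :=
  have hl := hs.fin.isLocalObj_projObj d.indecomposable
  hl.isHollow (𝟙 _) hl.not_isZero

/-- `f` lifts through the projective cover `p : P_G → L`; the lift is epi because `ker p` is
superfluous, and splits because `P_G` is projective. -/
lemma retract_of_hom {H : i ⟶ i} {f : projObj H ⟶ L} (hf : f ≠ 0) :
    Nonempty (Retract d.G H) := by
  have := d.simple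
  have := d.isSimpleTop_p.epi
  obtain ⟨x, hx⟩ := exists_lift_projObj f d.p
  have : Epi x := (d.isHollow_projObj hs).epi_of_comp_ne_zero (s := d.p) _ (by rw [hx]; exact hf)
  exact retract_of_epi_projObj x

/-- The transpose of `f` under `X* ⊣ X` is a nonzero morphism `P_{X* Y} → L`. This turns
nonvanishing of the action into relations between cells. -/
lemma retract_of_hom_act {l : C} {X Y : i ⟶ l} {f : projObj Y ⟶ (prinMap i X).obj L}
    (hf : f ≠ 0) : Nonempty (Retract d.G (Y ≫ τ.star X)) := by
  obtain ⟨adj⟩ := nonempty_star_adj τ hs.adj i X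
  obtain ⟨e⟩ := nonempty_prinMap_projObj Y (τ.star X)
  refine d.retract_of_hom hs (f := e.inv ≫ (adj.homEquiv _ _).symm f) fun h => ?_
  apply homEquiv_symm_ne_zero adj hf
  rw [← cancel_epi e.inv, h, comp_zero]

lemma exists_epi_act {j : C} {F : i ⟶ j} (hF : ⟨i, j, F⟩ ∈ R) :
    ∃ f : projObj F ⟶ (prinMap i F).obj L, Epi f := by
  obtain ⟨e⟩ := d.nonempty_iso F hF
  have := d.isSimpleTop_e.epi
  exact ⟨e.inv ≫ (prinMap i F).map d.e, epi_comp _ _⟩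

lemma retract_comp_star {j : C} {F : i ⟶ j} (hF : ⟨i, j, F⟩ ∈ R) :
    Nonempty (Retract d.G (F ≫ τ.star F)) := by
  obtain ⟨f, hf⟩ := d.exists_epi_act hs hF
  exact d.retract_of_hom_act hs (epi_ne_zero f (d.not_isZero F hF))

lemma retract_G_comp {j : C} {F : i ⟶ j} (hF : ⟨i, j, F⟩ ∈ R) :
    Nonempty (Retract F (d.G ≫ F)) := by
  have := d.isSimpleTop_p.epi
  have := d.isSimpleTop_e.epi
  have := d.simple
  obtain ⟨Z, hZ⟩ := hs.fin.exists_projGenerator i i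
  obtain ⟨y, h1⟩ := exists_lift_projObj d.p d.e
  -- A simple quotient of the cokernel of `y` would factor through the top `e` of `K`, yet vanish on
  -- `p = y ≫ e`. Applying `F` to the resulting epimorphism `P_G → K` gives a split epimorphism onto
  -- `P_F`.
  have h2 : Epi y := by
    refine Preadditive.epi_of_isZero_cokernel _ (by_contra fun h => ?_)
    obtain ⟨S, q, hS, hq⟩ := hZ.exists_simple_quotient h
    obtain ⟨g, hg⟩ := d.isSimpleTop_e.factors S hS (cokernel.π _ ≫ q)
    have h3 : d.p ≫ g = 0 := by
      rw [← h1, Category.assoc, ← hg, cokernel.condition_assoc, zero_comp]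
    have h4 : g = 0 := by rw [← cancel_epi d.p, h3, comp_zero]
    rw [h4, comp_zero] at hg
    exact epi_ne_zero (cokernel.π y ≫ q) (Simple.not_isZero S) hg
  obtain ⟨e₁⟩ := nonempty_prinMap_projObj d.G F
  obtain ⟨e₂⟩ := d.nonempty_iso F hF
  let x : projObj (d.G ≫ F) ⟶ projObj F :=
    e₁.inv ≫ (prinMap i F).map y ≫ e₂.hom
  have : Epi x := inferInstanceAs (Epi (e₁.inv ≫ (prinMap i F).map y ≫
    e₂.hom))
  exact retract_of_epi_projObj x

/-- `G` is a summand of `F* F` and `F` is a summand of `F G`, so `F` and `G` are right equivalent.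
-/
lemma G_mem : (⟨i, i, d.G⟩ : OneMor C) ∈ R := by
  obtain ⟨⟨i', j, F⟩, hF, hi⟩ := hs.src
  cases hi
  obtain ⟨r⟩ := d.retract_comp_star hs hF
  obtain ⟨r'⟩ := d.retract_G_comp hs hF
  exact hs.mem_of_leR_leR hF d.indecomposable (.mk _ _ _ r) (.mk _ _ _ r')

lemma leL_star_G {j : C} {F : i ⟶ j} (hF : ⟨i, j, F⟩ ∈ R) :
    LeL ⟨j, i, τ.star F⟩ ⟨i, i, d.G⟩ := by
  obtain ⟨r⟩ := d.retract_comp_star hs hF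
  exact .mk _ _ _ r

/-- `G* G` is self-dual and contains `G`, hence also `G*`; so `G ≤_R G*`, and within `Q` this is an
equivalence. -/
lemma star_G_mem : (⟨i, i, τ.star d.G⟩ : OneMor C) ∈ R := by
  have hG := d.G_mem hs
  obtain ⟨r⟩ := d.retract_comp_star hs hG
  refine hs.mem_of_leR hG (hs.star_mem_Q (hs.sub hG)) (.mk _ _ _ ((τ.starRetract r).trans
    (Retract.ofIso (τ.starComp _ _ ≪≫ whiskerRightIso (τ.starStar d.G) _))))

/-- Both 1-morphisms lie in `R` and in one left cell, whose intersection has a single element. -/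
lemma nonempty_iso_star : Nonempty (d.G ≅ τ.star d.G) := by
  have hG := d.G_mem hs
  have hG' := d.star_G_mem hs
  have h1 := d.leL_star_G hs hG
  have h2 := hs.isom_of_leL hG hG' (hs.leL_symm (hs.star_mem_Q (hs.sub hG)) (hs.sub hG) h1)
  cases h2 with | mk e => exact ⟨e⟩

/-- An indecomposable 1-morphism which is `≥_R R` and does not annihilate `L` is in `R`. -/
lemma mem_of_not_isZero {j l : C} {F : i ⟶ j} {X : i ⟶ l} (hF : ⟨i, j, F⟩ ∈ R)
    (hX : Indecomposable X) (h : LeR ⟨i, j, F⟩ ⟨i, l, X⟩) (h0 : ¬ IsZero ((prinMap i X).obj L)) :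
    ⟨i, l, X⟩ ∈ R := by
  obtain ⟨Y, f, hf⟩ := exists_epi_projObj ((prinMap i X).obj L)
  obtain ⟨r⟩ := d.retract_of_hom_act hs (epi_ne_zero f h0)
  refine hs.mem_of_leR_leR hF hX h (LeR.trans (G := ⟨i, i, τ.star d.G⟩) (.mk _ (τ.star Y) _
    ((τ.starRetract r).trans (Retract.ofIso (τ.starComp _ _ ≪≫
      whiskerRightIso (τ.starStar X) _)))) (hs.leR (d.star_G_mem hs) hF))

/-- Since `X` does not kill `L`, it lies in `R`. Moreover `G ≤_L F* ≤_L X`, and elements of `R`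
comparable for `≤_L` are isomorphic. -/
lemma nonempty_iso_G {j : C} {F H : i ⟶ j} {X : i ⟶ i} (hF : ⟨i, j, F⟩ ∈ R) (hH : ⟨i, j, H⟩ ∈ R)
    (hX : Indecomposable X) (r : Retract X (H ≫ τ.star F)) (h0 : ¬ IsZero ((prinMap i X).obj L)) :
    Nonempty (X ≅ d.G) := by
  have hG := d.G_mem hs
  have hX' := d.mem_of_not_isZero hs hH hX (.mk _ _ _ r) h0
  have h2 : LeL ⟨i, i, d.G⟩ ⟨j, i, τ.star F⟩ :=
    hs.leL_symm (hs.star_mem_Q (hs.sub hF)) (hs.sub hG) (d.leL_star_G hs hF)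
  have h3 := hs.isom_of_leL hG hX' (h2.trans (.mk _ _ _ r))
  cases h3 with | mk e => exact ⟨e.symm⟩

/-- `G L` is a quotient of `P_G`, so its simple quotients are quotients of `P_G`, which has `L` as
its only top. -/
lemma exists_hom_G : ∃ f : (prinMap i d.G).obj L ⟶ L, f ≠ 0 := by
  have := d.simple
  have hG := d.G_mem hs
  obtain ⟨Z, hZ⟩ := hs.fin.exists_projGenerator i i
  obtain ⟨f, hf⟩ := d.exists_epi_act hs hG
  obtain ⟨S, q, hS, hq⟩ := hZ.exists_simple_quotient (d.not_isZero d.G hG)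
  obtain ⟨g, hg⟩ := d.isSimpleTop_p.factors S hS (f ≫ q)
  have hg0 : g ≠ 0 := fun h => epi_ne_zero (f ≫ q) (Simple.not_isZero S) (by rw [hg, h, comp_zero])
  have := isIso_of_hom_simple hg0
  refine ⟨q ≫ inv g, fun h => epi_ne_zero q (Simple.not_isZero S) ?_⟩
  rw [← cancel_mono (inv g), h, zero_comp]

/-- Transposing under `G* ⊣ G`, `f` becomes a morphism `G* K → L` on the hollow object `G* K ≅
P_{G*}`. It is proportional to a fixed nonzero morphism `G* K → G* L → L`, which exists because `G*
≅ G` and which factors through `G* e`. -/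
lemma factor_G (f : d.K ⟶ (prinMap i d.G).obj L) : ∃ c, f = d.e ≫ c := by
  have := d.simple
  have := d.isSimpleTop_e.epi
  obtain ⟨adj⟩ := nonempty_star_adj τ hs.adj i d.G
  obtain ⟨e⟩ := d.nonempty_iso_star hs
  obtain ⟨t, ht⟩ := d.exists_hom_G hs
  let t' : (prinMap i (τ.star d.G)).obj L ⟶ L := (prinIso i e).inv.app L ≫ t
  have ht' : (prinMap i (τ.star d.G)).map d.e ≫ t' ≠ 0 := fun h => ht (by
    rw [← cancel_epi ((prinIso i e).inv.app L),
      ← cancel_epi ((prinMap i (τ.star d.G)).map d.e)]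
    rw [comp_zero, comp_zero]
    exact h)
  obtain ⟨e₂⟩ := d.nonempty_iso _ (d.star_G_mem hs)
  have hl := hs.fin.isLocalObj_projObj (hs.indec (d.star_G_mem hs))
  have hhol : IsHollow ((prinMap i (τ.star d.G)).obj d.K) :=
    hl.isHollow e₂.inv fun h => hl.not_isZero (h.of_iso e₂.symm)
  obtain ⟨c, hc⟩ := hhol.exists_factor ht' ((adj.homEquiv _ _).symm f)
  refine ⟨adj.homEquiv _ _ (t' ≫ c), ?_⟩
  rw [← adj.homEquiv_naturality_left, ← Category.assoc, ← hc, Equiv.apply_symm_apply]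

/-- The decomposition of the action of a composite on `L`. -/
lemma addClosure_act_comp {j l : C} {F : i ⟶ j} (hF : ⟨i, j, F⟩ ∈ R) (H : j ⟶ l) :
    addClosure (fun Y : RightFreyd (i ⟶ l) => ∃ X : i ⟶ l, ⟨i, l, X⟩ ∈ R ∧
      Nonempty (Retract X (F ≫ H)) ∧ Y = (prinMap i X).obj L)
      ((prinMap i H).obj ((prinMap i F).obj L)) := by
  refine .of_iso (actComp i F H L).symm ?_
  refine ((hs.fin.decomposition (F ≫ H)).map (actOn L l)
    (T := fun Y => ∃ X : i ⟶ l, Indecomposable X ∧ Nonempty (Retract X (F ≫ H)) ∧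
      Y = (prinMap i X).obj L) fun X hX => ⟨X, hX.1, hX.2, rfl⟩).trans ?_
  rintro _ ⟨X, hX, ⟨r⟩, rfl⟩
  -- The summands `X` outside `R` contribute nothing, because they annihilate `L`.
  by_cases h0 : IsZero ((prinMap i X).obj L)
  · exact .of_isZero h0
  · exact .of_mem ⟨X, d.mem_of_not_isZero hs hF hX (.mk _ _ _ r) h0, ⟨r⟩, rfl⟩

lemma addClosure_act_star {j : C} {F H : i ⟶ j} (hF : ⟨i, j, F⟩ ∈ R) (hH : ⟨i, j, H⟩ ∈ R) :
    addClosure (fun Y => Y = (prinMap i d.G).obj L)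
      ((prinMap i (τ.star F)).obj ((prinMap i H).obj L)) := by
  refine (d.addClosure_act_comp hs hH (τ.star F)).trans ?_
  rintro _ ⟨X, hX, ⟨r⟩, rfl⟩
  obtain ⟨e⟩ := d.nonempty_iso_G hs hF hH (hs.indec hX) r (d.not_isZero X hX)
  exact .of_iso ((prinIso i e).app L) (.of_mem rfl)

/-- For `F`, `H` in the right cell, the morphisms from `F K ≅ P_F` to `H L` factor through `F L`. -/
lemma factor {j : C} {F H : i ⟶ j} (hF : ⟨i, j, F⟩ ∈ R) (hH : ⟨i, j, H⟩ ∈ R)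
    (f : (prinMap i F).obj d.K ⟶ (prinMap i H).obj L) : ∃ c, f = (prinMap i F).map d.e ≫ c := by
  obtain ⟨adj⟩ := nonempty_adj_star τ hs.adj i F
  -- The transpose `K → F* H L` lands in `add (G L)`, where `factor_G` applies to each coordinate.
  obtain ⟨c, hc⟩ := (d.addClosure_act_star hs hF hH).map_eq d.e
    (fun Z hZ f => by subst hZ; exact d.factor_G hs f) (adj.homEquiv _ _ f)
  refine ⟨(adj.homEquiv _ _).symm c, ?_⟩
  rw [← adj.homEquiv_naturality_left_symm, ← hc, Equiv.symm_apply_apply]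

end CellTopData

end CellFacts

/-! ### Progenerators of abelian categories -/

section Progenerator

variable {k : Type*} [Field k] {D : Type*} [Category.{w} D]

lemma IsProgenerator.isAbelianCat [Preadditive D] [Linear k D] {X : D} (hX : IsProgenerator k X) :
    IsAbelianCat D := by
  have := hX.finiteDimensional_end
  have : IsNoetherianRing (End X)ᵐᵒᵖ := IsNoetherianRing.of_finite k _
  have : HasFiniteProducts D :=
    ⟨fun n => Adjunction.hasLimitsOfShape_of_equivalence hX.functor⟩
  exact .of_equivalence hX.functor

lemma FGModuleCat.surjective_of_epi {A : Type*} [Ring A] [IsNoetherianRing A]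
    {M N : FGModuleCat.{w} A} (f : M ⟶ N) [Epi f] : Function.Surjective f.hom := by
  have : Epi ((forget₂ (FGModuleCat.{w} A) (ModuleCat.{w} A)).map f) := inferInstance
  exact (ModuleCat.epi_iff_surjective _).1 this

lemma FGModuleCat.injective_of_mono {A : Type*} [Ring A] [IsNoetherianRing A]
    {M N : FGModuleCat.{w} A} (f : M ⟶ N) [Mono f] : Function.Injective f.hom := by
  have : Mono ((forget₂ (FGModuleCat.{w} A) (ModuleCat.{w} A)).map f) := inferInstance
  exact (ModuleCat.mono_iff_injective _).1 this

lemma IsProgenerator.isProjGenerator [Abelian D] [Linear k D] {X : D} (hX : IsProgenerator k X) :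
    IsProjGenerator k X where
  finiteDimensional := hX.finiteDimensional
  projective := by
    have := hX.finiteDimensional_end
    have : IsNoetherianRing (End X)ᵐᵒᵖ := IsNoetherianRing.of_finite k _
    refine ⟨fun {E Y} f e _ => ?_⟩
    obtain ⟨g, hg⟩ := FGModuleCat.surjective_of_epi (hX.functor.map e) f
    exact ⟨g, hg⟩
  isZero M h := by
    obtain ⟨n, g, -, h2, -⟩ := hX.presentation M
    exact (IsZero.iff_id_eq_zero M).2 (h2 _ _ _ fun t => by rw [h (g t)]; simp)

end Progenerator

lemma projective_of_mono_of_cokernel {D : Type*} [Category* D] [Abelian D] {X Y : D} (f : X ⟶ Y)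
    [Mono f] [Projective X] [Projective (cokernel f)] : Projective Y := by
  have hS : (ShortComplex.mk f (cokernel.π f) (cokernel.condition f)).ShortExact :=
    { exact := ShortComplex.exact_cokernel f }
  have : Projective (ShortComplex.mk f (cokernel.π f) (cokernel.condition f)).X₃ :=
    inferInstanceAs (Projective (cokernel f))
  have s := hS.splittingOfProjective
  exact Projective.of_iso s.isoBinaryBiproduct.symm (inferInstanceAs (Projective (X ⊞ cokernel f)))

lemma indecomposable_of_iso {V : Type*} [Category* V] [Preadditive V] [HasBinaryBiproducts V]
    {X Y : V} (e : X ≅ Y) (h : Indecomposable X) : Indecomposable Y :=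
  ⟨fun h0 => h.1 (h0.of_iso e), fun Z W e' => h.2 Z W (e ≪≫ e')⟩

/-! ### The categories `C_R(j)`: stability, progenerators, cokernels. -/

section CellCat

variable {k : Type*} [Field k] {C : Type u} [Bicategory.{w, v} C]
  [∀ i j : C, Preadditive (i ⟶ j)] [∀ i j : C, Linear k (i ⟶ j)]
  [∀ i j : C, HasFiniteBiproducts (i ⟶ j)] [BiadditiveComp C]

/-- The category `C_R(j)`. -/
abbrev CellCat (R : Set (OneMor C)) (i j : C) := (cellObjects R i j).FullSubcategory

lemma cellObjects_of_addClosure {R : Set (OneMor C)} {i j : C} {X : RightFreyd (i ⟶ j)}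
    (h : addClosure (cellGenerators R i j) X) : cellObjects R i j X := by
  refine ⟨X, X, 0, 𝟙 X, zero_comp, h, h, ⟨?_⟩⟩
  exact CokernelCofork.IsColimit.ofId 0 rfl

variable [∀ i j : C, IsAbelianCat (RightFreyd (i ⟶ j))] [HasExactAction C]
  {τ : Involution C} {Q R : Set (OneMor C)} {i : C}

namespace CellTopData

open OneMor

variable (d : CellTopData R i (cellTop R i)) (hs : CellSetup k τ Q R i)

include d hs

lemma addClosure_prinMap {j l : C} {X : RightFreyd (i ⟶ j)}
    (hX : addClosure (cellGenerators R i j) X) (H : j ⟶ l) :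
    addClosure (cellGenerators R i l) ((prinMap i H).obj X) := by
  refine (hX.map (prinMap i H) (T := addClosure (cellGenerators R i l)) ?_).trans fun _ h => h
  rintro _ ⟨F, hF, rfl⟩
  exact (d.addClosure_act_comp hs hF H).mono
    fun Y ⟨X, hX, h⟩ => ⟨X, hX, h.2⟩

/-- Objects of `add C_R`-generators are projective relative to quotients of such objects. -/
lemma exists_lift_generators {j : C} {X Y M : RightFreyd (i ⟶ j)}
    (hX : addClosure (cellGenerators R i j) X) (hY : addClosure (cellGenerators R i j) Y)
    (g : Y ⟶ M) [Epi g] (f : X ⟶ M) : ∃ f', f' ≫ g = f := by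
  have := d.isSimpleTop_e.epi
  refine hX.hom_lift g ?_ f
  rintro _ ⟨F, hF, rfl⟩ f
  obtain ⟨e⟩ := d.nonempty_iso F hF
  obtain ⟨y, hy⟩ := exists_lift_projObj (e.inv ≫ (prinMap i F).map d.e ≫ f) g
  -- The lift exists on the projective object `F K ≅ P_F`, and `factor` lets it descend to `F L`.
  obtain ⟨c, hc⟩ := hY.map_eq ((prinMap i F).map d.e) (by
    rintro _ ⟨H, hH, rfl⟩ f
    exact d.factor hs hF hH f) (e.hom ≫ y)
  refine ⟨c, ?_⟩
  rw [← cancel_epi ((prinMap i F).map d.e), ← Category.assoc, ← hc, Category.assoc, hy]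
  simp

lemma cellObjects_prinMap {j l : C} {M : RightFreyd (i ⟶ j)} (hM : cellObjects R i j M)
    (F : j ⟶ l) : cellObjects R i l ((prinMap i F).obj M) := by
  obtain ⟨X₁, X₀, f, g, hw, h₁, h₀, ⟨hc⟩⟩ := hM
  exact ⟨(prinMap i F).obj X₁, (prinMap i F).obj X₀, (prinMap i F).map f, (prinMap i F).map g,
    by rw [← Functor.map_comp, hw, Functor.map_zero], d.addClosure_prinMap hs h₁ F,
    d.addClosure_prinMap hs h₀ F, ⟨CokernelCofork.mapIsColimit _ hc (prinMap i F)⟩⟩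

lemma isClosedUnderMapObj : (cellProp R i).IsClosedUnderMapObj where
  map_obj hM F := d.cellObjects_prinMap hs hM F

lemma exists_generator (j : C) : ∃ X : RightFreyd (i ⟶ j),
    addClosure (cellGenerators R i j) X ∧ ∀ Y, cellGenerators R i j Y →
      addClosure (fun Z => Z = X) Y := by
  obtain ⟨S, hS, h⟩ := hs.fin.finite_indecomposables i j
  let T := {F : S // ⟨i, j, F.1⟩ ∈ R}
  have := hS.to_subtype
  let _ : Fintype T := Fintype.ofFinite T
  let eT := Fintype.equivFin T
  let Y : Fin (Fintype.card T) → RightFreyd (i ⟶ j) := fun t =>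
    (prinMap i (eT.symm t).1.1).obj (cellTop R i)
  refine ⟨⨁ Y, .of_fintype Y (biproduct.π Y) (biproduct.ι Y)
    (fun t => ⟨(eT.symm t).1.1, (eT.symm t).2, rfl⟩) biproduct.total, ?_⟩
  rintro _ ⟨F, hF, rfl⟩
  obtain ⟨G, hG, ⟨e⟩⟩ := h F (hs.indec hF)
  have hG' : ⟨i, j, G⟩ ∈ R := hs.mem_of_leR_leR hF (indecomposable_of_iso e (hs.indec hF))
    (Isom.mk e).leR (Isom.mk e).symm.leR
  have hY : Y (eT ⟨⟨G, hG⟩, hG'⟩) = (prinMap i G).obj (cellTop R i) := by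
    simp only [Y, Equiv.symm_apply_apply]
  refine .of_iso ((prinIso i e).app _) ?_
  change addClosure _ ((prinMap i G).obj (cellTop R i))
  rw [← hY]
  exact .retract ⟨biproduct.ι Y _, biproduct.π Y _, by simp⟩ (.of_mem rfl)

lemma exists_isProgenerator (j : C) : ∃ X : CellCat R i j,
    addClosure (cellGenerators R i j) X.obj ∧
      (∀ Y, cellGenerators R i j Y → addClosure (fun Z => Z = X.obj) Y) ∧ IsProgenerator k X := by
  obtain ⟨X, hX, hX'⟩ := d.exists_generator hs j
  have h1 : ∀ Y, addClosure (cellGenerators R i j) Y ↔ addClosure (fun Z => Z = X) Y := fun Y =>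
    ⟨fun h => h.trans hX', fun h => h.trans fun Z hZ => by rw [hZ]; exact hX⟩
  refine ⟨⟨X, cellObjects_of_addClosure hX⟩, hX, hX', IsProgenerator.of_presentations X _ _
    (fun M N => hs.fin.finiteDimensional_hom M N) ?_ ?_ ?_⟩
  · rintro M ⟨X₁, X₀, f, g, hw, h₁, h₀, hc⟩
    exact ⟨X₁, X₀, f, g, hw, (h1 _).1 h₁, (h1 _).1 h₀, hc⟩
  · intro X₁ X₀ f h₁ h₀
    exact ⟨X₁, X₀, f, cokernel.π f, cokernel.condition f, (h1 _).2 h₁, (h1 _).2 h₀,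
      ⟨cokernelIsCokernel f⟩⟩
  · intro X₁ X₀ M f g hw h₁ h₀ hc
    have hg : Epi g := epi_of_isColimit_cofork hc
    refine ⟨fun x => d.exists_lift_generators hs hX ((h1 _).2 h₀) g x, fun y hy => ?_⟩
    -- `ker g` need not lie in `C_R(j)`, but it is a quotient of `X₁`, which is all that relative
    -- projectivity requires.
    have hex : (ShortComplex.mk f g hw).Exact := ShortComplex.exact_of_g_is_cokernel _ hc
    have : Epi (kernel.lift g f hw) := hex.epi_kernelLift
    obtain ⟨z, hz⟩ := d.exists_lift_generators hs hX ((h1 _).2 h₁) (kernel.lift g f hw)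
      (kernel.lift g y hy)
    refine ⟨z, ?_⟩
    have := congrArg (fun t => t ≫ kernel.ι g) hz
    simpa using this

lemma isAbelianCat_cellCat (j : C) : IsAbelianCat (CellCat R i j) := by
  obtain ⟨X, -, -, hX⟩ := d.exists_isProgenerator hs j
  exact hX.isAbelianCat

/-- The category `C_R(j)` is closed under cokernels. -/
lemma cellObjects_cokernel {j : C} {M' M : RightFreyd (i ⟶ j)} (hM' : cellObjects R i j M')
    (hM : cellObjects R i j M) (h : M' ⟶ M) : cellObjects R i j (cokernel h) := by
  obtain ⟨X₁', X₀', f', g', hw', h₁', h₀', ⟨hc'⟩⟩ := hM'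
  obtain ⟨X₁, X₀, f, g, hw, h₁, h₀, ⟨hc⟩⟩ := hM
  have hg : Epi g := epi_of_isColimit_cofork hc
  have hg' : Epi g' := epi_of_isColimit_cofork hc'
  -- Once `h` is lifted to the covers, the images of `X₁` and of `X₀'` together give the relations
  -- of the cokernel.
  obtain ⟨b, hb⟩ := d.exists_lift_generators hs h₀' h₀ g (g' ≫ h)
  have key : ∀ {T : RightFreyd (i ⟶ j)} (p : X₀ ⟶ T), biprod.desc f b ≫ p = 0 →
      f ≫ p = 0 ∧ b ≫ p = 0 := fun p hp =>
    ⟨by rw [← biprod.inl_desc f b, Category.assoc, hp, comp_zero],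
      by rw [← biprod.inr_desc f b, Category.assoc, hp, comp_zero]⟩
  refine ⟨X₁ ⊞ X₀', X₀, biprod.desc f b, g ≫ cokernel.π h, ?_, h₁.biprod h₀', h₀, ⟨?_⟩⟩
  · ext
    · simp [reassoc_of% hw]
    · simp [reassoc_of% hb]
  · refine Cofork.IsColimit.ofExistsUnique fun s => ?_
    have hs := CokernelCofork.condition s
    obtain ⟨hs1, hs2⟩ := key s.π hs
    let a : M ⟶ s.pt := hc.desc (CokernelCofork.ofπ s.π hs1)
    have ha : g ≫ a = s.π := hc.fac (CokernelCofork.ofπ s.π hs1) WalkingParallelPair.one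
    have ha' : h ≫ a = 0 := by
      rw [← cancel_epi g', ← Category.assoc, ← hb, Category.assoc, ha, hs2, comp_zero]
    refine ⟨cokernel.desc h a ha', ?_, fun m hm => ?_⟩
    · simpa using ha
    · rw [← cancel_epi (cokernel.π h), ← cancel_epi g, cokernel.π_desc, ha, ← hm]
      simp

/-- The cokernel taken in `P_i(j)` already lies in `C_R(j)`, so epimorphisms of the subcategory are
epimorphisms of the ambient category. -/
lemma epi_hom {j : C} {M N : CellCat R i j} (f : M ⟶ N) [Epi f] : Epi f.hom := by
  refine Preadditive.epi_of_cokernel_zero ?_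
  let c : N ⟶ ⟨cokernel f.hom, d.cellObjects_cokernel hs M.property N.property f.hom⟩ :=
    ObjectProperty.homMk (cokernel.π f.hom)
  have h1 : f ≫ c = 0 := ObjectProperty.hom_ext _ (cokernel.condition f.hom)
  have h2 : c = 0 := by rw [← cancel_epi f, h1, comp_zero]
  exact congrArg (fun t => t.hom) h2

end CellTopData

end CellCat

lemma addClosure_fullSubcategory {P : Type*} [Category* P] [Preadditive P] {W : ObjectProperty P}
    {S : ObjectProperty W.FullSubcategory} {M : W.FullSubcategory}
    (h : addClosure (fun Y => ∃ Z : W.FullSubcategory, S Z ∧ Y = Z.obj) M.obj) :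
    addClosure S M := by
  obtain ⟨n, Y, a, b, hY, hab⟩ := h
  choose Z hZ hYZ using hY
  obtain rfl : Y = fun t => (Z t).obj := funext hYZ
  refine ⟨n, Z, fun t => ObjectProperty.homMk (a t), fun t => ObjectProperty.homMk (b t), hZ,
    ObjectProperty.hom_ext _ ((hom_sum _ _).trans hab)⟩

lemma IsLocalObj.of_epi {D : Type*} [Category* D] [Abelian D] {P N : D} [Projective P]
    (hP : IsLocalObj P) (p : P ⟶ N) [Epi p] (hN : ¬ IsZero N)
    (hfin : ∀ f : N ⟶ N, Epi f → IsIso f) : IsLocalObj N := by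
  refine ⟨hN, fun f => ?_⟩
  have hy := Projective.factorThru_comp (p ≫ f) p
  set y := Projective.factorThru (p ≫ f) p
  rcases hP.isIso_or_isNilpotent y with h | ⟨n, hn⟩
  · left
    have : Epi (p ≫ f) := by rw [← hy]; infer_instance
    exact hfin f (epi_of_epi p f)
  · right
    have key : ∀ m : ℕ, End.asHom (End.of y ^ m) ≫ p = p ≫ End.asHom (End.of f ^ m) := by
      intro m
      induction m with
      | zero => exact (Category.id_comp p).trans (Category.comp_id p).symm
      | succ m ih =>
        rw [pow_succ, pow_succ]
        change (y ≫ End.asHom (End.of y ^ m)) ≫ p = p ≫ f ≫ End.asHom (End.of f ^ m)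
        rw [Category.assoc, ih, ← Category.assoc, hy, Category.assoc]
    refine ⟨n, ?_⟩
    have h1 := key n
    rw [hn] at h1
    change End.asHom (End.of f ^ n) = 0
    rw [← cancel_epi p, ← h1]
    exact zero_comp.trans comp_zero.symm

lemma IsProjGenerator.isIso_of_epi {k : Type*} [Field k] {D : Type*} [Category.{w} D] [Abelian D]
    [Linear k D] {X : D} (hX : IsProjGenerator k X) {N : D} (f : N ⟶ N) (hf : Epi f) : IsIso f :=
  by_contra fun h => (hX.finrank_lt_of_epi f h).false

lemma isLocalObj_fullSubcategory {P : Type*} [Category* P] [Preadditive P] {W : ObjectProperty P}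
    {M : W.FullSubcategory} (h : IsLocalObj M.obj) : IsLocalObj M := by
  refine ⟨fun h0 => h.not_isZero ?_, fun f => ?_⟩
  · rw [IsZero.iff_id_eq_zero] at h0 ⊢
    exact congrArg (fun t => t.hom) h0
  · rcases h.isIso_or_isNilpotent f.hom with h1 | ⟨n, hn⟩
    · have : IsIso (W.ι.map f) := h1
      exact .inl (isIso_of_reflects_iso f W.ι)
    · refine .inr ⟨n, ?_⟩
      have h2 : W.ι.mapEnd M (End.of f ^ n) = W.ι.mapEnd M 0 := by
        rw [map_pow]
        exact hn.trans (W.ι.map_zero M M).symm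
      exact W.ι.map_injective h2

/-! ### Projectivity, injectivity and socles in the cell 2-representation. -/

section CellAction

variable {k : Type*} [Field k] {C : Type u} [Bicategory.{w, v} C]
  [∀ i j : C, Preadditive (i ⟶ j)] [∀ i j : C, Linear k (i ⟶ j)]
  [∀ i j : C, HasFiniteBiproducts (i ⟶ j)] [BiadditiveComp C]

section

variable {R : Set (OneMor C)} {i : C}

/-- The object `F L` of `C_R(j)`. -/
def cellGen {j : C} (F : i ⟶ j) (hF : ⟨i, j, F⟩ ∈ R) : CellCat R i j :=
  ⟨(prinMap i F).obj (cellTop R i), cellObjects_of_addClosure (.of_mem ⟨F, hF, rfl⟩)⟩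

/-- Isomorphic 1-morphisms give isomorphic objects. -/
def cellGenIso {j : C} {F G : i ⟶ j} (hF : ⟨i, j, F⟩ ∈ R) (hG : ⟨i, j, G⟩ ∈ R) (e : F ≅ G) :
    cellGen F hF ≅ cellGen G hG :=
  ObjectProperty.isoMk _ ((prinIso i e).app (cellTop R i))

instance (j : C) [IsAbelianCat (CellCat R i j)] : Abelian (CellCat R i j) := IsAbelianCat.abelian _

variable [(cellProp R i).IsClosedUnderMapObj]

variable (R i) in
/-- The action of a 1-morphism on the cell 2-representation. -/
abbrev cellMap {j l : C} (F : j ⟶ l) : CellCat R i j ⥤ CellCat R i l := (cellProp R i).map F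

instance {j l : C} (F : j ⟶ l) : (cellMap R i F).Additive where
  map_add {_ _ f g} := ObjectProperty.hom_ext _ ((prinMap i F).map_add (f := f.hom) (g := g.hom))

/-- The action of an adjunction on the cell 2-representation. -/
def cellAdj {j l : C} {F : j ⟶ l} {G : l ⟶ j} (adj : prinMap i F ⊣ prinMap i G) :
    cellMap R i F ⊣ cellMap R i G :=
  adj.restrictFullyFaithful (cellObjects R i j).fullyFaithfulι (cellObjects R i l).fullyFaithfulι
    (Iso.refl _) (Iso.refl _)

/-- A retract of a 1-morphism acts as a retract. -/
lemma nonempty_retract_cellMap {j l : C} {F G : j ⟶ l} (r : Retract F G) (M : CellCat R i j) :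
    Nonempty (Retract ((cellMap R i F).obj M) ((cellMap R i G).obj M)) := by
  have r' := r.map (actOn M.obj l)
  exact ⟨⟨ObjectProperty.homMk r'.i, ObjectProperty.homMk r'.r,
    ObjectProperty.hom_ext _ r'.retract⟩⟩

end

variable [∀ i j : C, IsAbelianCat (RightFreyd (i ⟶ j))] [HasExactAction C]
  {τ : Involution C} {Q R : Set (OneMor C)} {i : C}

namespace CellTopData

open OneMor

variable (d : CellTopData R i (cellTop R i)) (hs : CellSetup k τ Q R i)

include d hs in
lemma isLocalObj_cellGen {j : C} {F : i ⟶ j} (hF : ⟨i, j, F⟩ ∈ R) : IsLocalObj (cellGen F hF) := by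
  obtain ⟨x, hx⟩ := d.exists_epi_act hs hF
  obtain ⟨Z, hZ⟩ := hs.fin.exists_projGenerator i j
  exact isLocalObj_fullSubcategory ((hs.fin.isLocalObj_projObj (hs.indec hF)).of_epi
    (P := projObj F) (N := (prinMap i F).obj (cellTop R i)) x (d.not_isZero F hF) hZ.isIso_of_epi)

include d hs in
-- `T` is meant to be the simple top of `G L` inside `C_R(i)`, which need not be simple in `P_i(i)`.
-- The nonzero `t : G L → L` kills the superfluous `ker q` and so induces `u : T → L`, which behaves
-- like an isomorphism as seen from `G L`.
lemma exists_hom_of_top {T : RightFreyd (i ⟶ i)} (q : (prinMap i d.G).obj (cellTop R i) ⟶ T) [Epi q]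
    (hT : ¬ IsZero T) (hT' : ∀ φ : (prinMap i d.G).obj (cellTop R i) ⟶ T, φ ≠ 0 → Epi φ) :
    ∃ u : T ⟶ cellTop R i,
      (∀ φ : (prinMap i d.G).obj (cellTop R i) ⟶ T, φ ≫ u = 0 → φ = 0) ∧
      ∀ ψ : (prinMap i d.G).obj (cellTop R i) ⟶ cellTop R i, ∃ φ, φ ≫ u = ψ := by
  have := d.simple
  have := d.isSimpleTop_e.epi
  obtain ⟨t, ht⟩ := d.exists_hom_G hs
  have := epi_of_nonzero_to_simple ht
  obtain ⟨x, hx⟩ := d.exists_epi_act hs (d.G_mem hs)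
  have hhol : IsHollow ((prinMap i d.G).obj (cellTop R i)) :=
    (hs.fin.isLocalObj_projObj d.indecomposable).isHollow (P := projObj d.G) x
      (d.not_isZero _ (d.G_mem hs))
  have hkq : kernel.ι q ≫ t = 0 := by
    by_contra h
    have := hhol.epi_of_comp_ne_zero (s := t) (kernel.ι q) h
    exact epi_ne_zero q hT (by rw [← cancel_epi (kernel.ι q), kernel.condition, comp_zero])
  have hu : q ≫ Abelian.epiDesc q t hkq = t := Abelian.comp_epiDesc _ _ _
  refine ⟨Abelian.epiDesc q t hkq, fun φ hφ => ?_, fun ψ => ?_⟩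
  · by_contra h0
    have := hT' φ h0
    have h3 : Abelian.epiDesc q t hkq = 0 := by rw [← cancel_epi φ, hφ, comp_zero]
    exact ht (by rw [← hu, h3, comp_zero])
  · obtain ⟨e⟩ := d.nonempty_iso d.G (d.G_mem hs)
    obtain ⟨y, hy⟩ := exists_lift_projObj (e.inv ≫ (prinMap i d.G).map d.e ≫ ψ) t
    obtain ⟨c, hc⟩ := d.factor hs (d.G_mem hs) (d.G_mem hs) (e.hom ≫ y)
    refine ⟨c ≫ q, ?_⟩
    rw [Category.assoc, hu, ← cancel_epi ((prinMap i d.G).map d.e), ← Category.assoc, ← hc,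
      Category.assoc, hy]
    simp

include d hs in
-- By adjunction, morphisms from `X L` to `H T` or to `H L` correspond to morphisms from `H* X L ∈
-- add (G L)` to `T` or to `L`, where `u` induces bijections. Lifting the identity gives a section
-- of `H u`; testing on the generators `X L` shows that it is also a retraction.
lemma nonempty_iso_of_hom {T : RightFreyd (i ⟶ i)} (u : T ⟶ cellTop R i)
    (hinj : ∀ φ : (prinMap i d.G).obj (cellTop R i) ⟶ T, φ ≫ u = 0 → φ = 0)
    (hsurj : ∀ ψ : (prinMap i d.G).obj (cellTop R i) ⟶ cellTop R i, ∃ φ, φ ≫ u = ψ)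
    {j : C} {H : i ⟶ j} (hH : ⟨i, j, H⟩ ∈ R) (hT : cellObjects R i j ((prinMap i H).obj T)) :
    Nonempty ((prinMap i H).obj T ≅ (prinMap i H).obj (cellTop R i)) := by
  obtain ⟨adj⟩ := nonempty_star_adj τ hs.adj i H
  have hinj' : ∀ (X : i ⟶ j) (_ : ⟨i, j, X⟩ ∈ R)
      (f : (prinMap i X).obj (cellTop R i) ⟶ (prinMap i H).obj T),
      f ≫ (prinMap i H).map u = 0 → f = 0 := by
    intro X hX f hf
    by_contra h0
    refine homEquiv_symm_ne_zero adj h0 ((d.addClosure_act_star hs hH hX).hom_ext ?_)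
    rintro _ b rfl
    rw [comp_zero]
    refine hinj _ ?_
    rw [Category.assoc, ← adj.homEquiv_naturality_right_symm, hf, adj.homEquiv_counit,
      Functor.map_zero, zero_comp, comp_zero]
  obtain ⟨f', hf'⟩ := (d.addClosure_act_star hs hH hH).hom_lift u
    (by rintro _ rfl f; exact hsurj f) ((adj.homEquiv _ _).symm (𝟙 _))
  have hs1 : adj.homEquiv _ _ f' ≫ (prinMap i H).map u = 𝟙 _ := by
    rw [← adj.homEquiv_naturality_right, hf', Equiv.apply_symm_apply]
  obtain ⟨X₁, X₀, a, b, hw, h₁, h₀, ⟨hc⟩⟩ := hT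
  have : Epi b := epi_of_isColimit_cofork hc
  refine ⟨⟨(prinMap i H).map u, adj.homEquiv _ _ f', ?_, hs1⟩⟩
  rw [← cancel_epi b]
  refine h₀.hom_ext ?_
  rintro _ c ⟨X, hX, rfl⟩
  rw [← sub_eq_zero]
  refine hinj' X hX _ ?_
  rw [Preadditive.sub_comp]
  simp [hs1]

variable [(cellProp R i).IsClosedUnderMapObj] [∀ j, IsAbelianCat (CellCat R i j)]

omit [(cellProp R i).IsClosedUnderMapObj]  in
include d hs in
-- An epimorphism of `C_R(j)` stays epi in `P_i(j)`. Preceded by a cover of `E` by generators, it is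
-- covered by relative projectivity.
lemma projective_cellGen {j : C} {F : i ⟶ j} (hF : ⟨i, j, F⟩ ∈ R) : Projective (cellGen F hF) where
  factors {E Y} f e _ := by
    obtain ⟨X₁, X₀, a, b, hw, h₁, h₀, ⟨hc⟩⟩ := E.property
    have : Epi b := epi_of_isColimit_cofork hc
    have : Epi e.hom := d.epi_hom hs e
    obtain ⟨g, hg⟩ := d.exists_lift_generators hs (.of_mem ⟨F, hF, rfl⟩) h₀ (b ≫ e.hom) f.hom
    refine ⟨ObjectProperty.homMk (g ≫ b), ObjectProperty.hom_ext _ ?_⟩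
    exact (Category.assoc _ _ _).trans hg

include d hs

lemma isHollow_cellGen {j : C} {F : i ⟶ j} (hF : ⟨i, j, F⟩ ∈ R) : IsHollow (cellGen F hF) :=
  have := d.projective_cellGen hs hF
  have h := d.isLocalObj_cellGen hs hF
  h.isHollow (𝟙 _) h.not_isZero

lemma exists_projGenerator (j : C) : ∃ X : CellCat R i j, IsProjGenerator k X ∧
    addClosure (fun Y : CellCat R i j => ∃ F hF, Y = cellGen F hF) X := by
  obtain ⟨X, h, -, hX⟩ := d.exists_isProgenerator hs j
  refine ⟨X, hX.isProjGenerator, addClosure_fullSubcategory (h.mono ?_)⟩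
  rintro _ ⟨F, hF, rfl⟩
  exact ⟨_, ⟨F, hF, rfl⟩, rfl⟩

lemma exists_hom_cellGen {j : C} {M : CellCat R i j} (hM : ¬ IsZero M) :
    ∃ (F : i ⟶ j) (hF : _) (f : cellGen F hF ⟶ M), f ≠ 0 := by
  obtain ⟨X, hX, h⟩ := d.exists_projGenerator hs j
  by_contra! H
  refine hM (hX.isZero M fun f => h.hom_ext ?_)
  rintro _ b ⟨F, hF, rfl⟩
  rw [H F hF (b ≫ f), comp_zero]

lemma addClosure_cellMap {j l : C} {F : i ⟶ j} (hF : ⟨i, j, F⟩ ∈ R) (H : j ⟶ l) :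
    addClosure (fun Y : CellCat R i l => ∃ X hX, Nonempty (Retract X (F ≫ H)) ∧ Y = cellGen X hX)
      ((cellMap R i H).obj (cellGen F hF)) := by
  refine addClosure_fullSubcategory ((d.addClosure_act_comp hs hF H).mono ?_)
  rintro _ ⟨X, hX, hr, rfl⟩
  exact ⟨_, ⟨X, hX, hr, rfl⟩, rfl⟩

/-- `F M` is tested by morphisms from the objects `X L`. They correspond under `F* ⊣ F` to morphisms
from `F* X L` to `M`, and `F* X L` is built from the objects `Y L` in the hypothesis. -/
lemma isZero_cellMap {j l : C} (F : j ⟶ l) {M : CellCat R i j}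
    (h : ∀ (X : i ⟶ l) (_ : ⟨i, l, X⟩ ∈ R) (Y : i ⟶ j) (hY : ⟨i, j, Y⟩ ∈ R),
      Retract Y (X ≫ τ.star F) → ∀ f : cellGen Y hY ⟶ M, f = 0) :
    IsZero ((cellMap R i F).obj M) := by
  by_contra h0
  obtain ⟨X, hX, f, hf⟩ := d.exists_hom_cellGen hs h0
  obtain ⟨adj⟩ := nonempty_star_adj τ hs.adj i F
  obtain ⟨_, ⟨Y, hY, ⟨r⟩, rfl⟩, b, hb⟩ := (d.addClosure_cellMap hs hX (τ.star F)).exists_summand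
    (homEquiv_symm_ne_zero (cellAdj adj) hf)
  exact hb (h X hX Y hY r _)

omit [(cellProp R i).IsClosedUnderMapObj] [∀ j, IsAbelianCat (CellCat R i j)] in
lemma hom_cellGen_eq_zero {j : C} {F G : i ⟶ j} (hF : ⟨i, j, F⟩ ∈ R) (hG : ⟨i, j, G⟩ ∈ R)
    (e : F ≅ G) {M : CellCat R i j} (h : ∀ f : cellGen G hG ⟶ M, f = 0) (f : cellGen F hF ⟶ M) :
    f = 0 := by
  rw [← cancel_epi (cellGenIso hF hG e).inv, h (_ ≫ f), comp_zero]

lemma isZero_cellMap_of_mem_cell {j : C} {H : i ⟶ j} (hH : ⟨i, j, H⟩ ∈ R) {M : CellCat R i i}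
    (h : ∀ f : cellGen d.G (d.G_mem hs) ⟶ M, f = 0) : IsZero ((cellMap R i H).obj M) := by
  refine d.isZero_cellMap hs H fun X hX Y hY r => ?_
  obtain ⟨e⟩ := d.nonempty_iso_G hs hH hX (hs.indec hY) r (d.not_isZero Y hY)
  exact d.hom_cellGen_eq_zero hs hY (d.G_mem hs) e h

/-- `Y` is the common element of `R` and the left cell of `F*`: summands of `F* X` in `R` lie in
that left cell, hence are isomorphic to `Y`. Thus the top of `Y L` is the only simple object that
`F` may fail to kill. -/
lemma exists_cell_source {j l : C} {F : j ⟶ l} (hF : ⟨j, l, F⟩ ∈ Q) :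
    ∃ (Y : i ⟶ j) (hY : ⟨i, j, Y⟩ ∈ R), ∀ M : CellCat R i j,
      (∀ f : cellGen Y hY ⟶ M, f = 0) → IsZero ((cellMap R i F).obj M) := by
  obtain ⟨⟨i', j', Y⟩, hY, h1, h2⟩ := hs.exists_mem_leL (hs.star_mem_Q hF)
  obtain rfl : i' = i := hs.src_eq hY
  obtain rfl : j' = j := by cases h1; rfl
  refine ⟨Y, hY, fun M hM => d.isZero_cellMap hs F fun X hX Z hZ r => ?_⟩
  have h3 := hs.isom_of_leL hY hZ (h1.trans (.mk _ _ _ r))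
  cases h3 with | mk e => exact d.hom_cellGen_eq_zero hs hZ hY e.symm hM

/-- The simple top of `G L` in `C_R(i)`. -/
lemma exists_top : ∃ (T : CellCat R i i) (q : cellGen d.G (d.G_mem hs) ⟶ T), Simple T ∧ Epi q ∧
    ∀ {j : C} (H : i ⟶ j) (hH : ⟨i, j, H⟩ ∈ R),
      Nonempty ((cellMap R i H).obj T ≅ cellGen H hH) := by
  have hGl := d.isLocalObj_cellGen hs (d.G_mem hs)
  obtain ⟨X, hX, -⟩ := d.exists_projGenerator hs i
  obtain ⟨T, q, hT, hq⟩ := hX.exists_simple_quotient hGl.not_isZero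
  refine ⟨T, q, hT, hq, fun {j} H hH => ?_⟩
  obtain ⟨q', rfl⟩ : ∃ q' : (prinMap i d.G).obj (cellTop R i) ⟶ T.obj,
    q = ObjectProperty.homMk q' := ⟨q.hom, rfl⟩
  have hq' : Epi q' := d.epi_hom hs (ObjectProperty.homMk q' : cellGen d.G (d.G_mem hs) ⟶ T)
  have hT0 : ¬ IsZero T.obj := fun h => Simple.not_isZero T ((IsZero.iff_id_eq_zero T).2
    (ObjectProperty.hom_ext _ ((IsZero.iff_id_eq_zero T.obj).1 h)))
  obtain ⟨u, hinj, hsurj⟩ := d.exists_hom_of_top hs q' hT0 fun φ hφ => by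
    let φ' : cellGen d.G (d.G_mem hs) ⟶ T := ObjectProperty.homMk φ
    have h1 : φ' ≠ 0 := fun h => hφ (congrArg (fun t => t.hom) h)
    have := epi_of_nonzero_to_simple h1
    exact d.epi_hom hs φ'
  obtain ⟨e⟩ := d.nonempty_iso_of_hom hs u hinj hsurj hH
    (d.cellObjects_prinMap hs T.property H)
  exact ⟨ObjectProperty.isoMk _ e⟩

lemma preservesFiniteLimits_cellMap {j l : C} (F : j ⟶ l) :
    PreservesFiniteLimits (cellMap R i F) := by
  obtain ⟨adj⟩ := nonempty_star_adj τ hs.adj i F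
  have := (cellAdj (R := R) adj).rightAdjoint_preservesLimits
  exact PreservesLimits.preservesFiniteLimits _

lemma preservesFiniteColimits_cellMap {j l : C} (F : j ⟶ l) :
    PreservesFiniteColimits (cellMap R i F) := by
  obtain ⟨adj⟩ := nonempty_adj_star τ hs.adj i F
  have := (cellAdj (R := R) adj).leftAdjoint_preservesColimits
  exact PreservesColimits.preservesFiniteColimits _

/-- Dévissage: a simple object is either killed by `H` or isomorphic to `T`, with `H T ≅ H L`
projective, and extensions of projective objects are projective. -/
lemma projective_cellMap_of_mem_cell {j : C} {H : i ⟶ j} (hH : ⟨i, j, H⟩ ∈ R) (M : CellCat R i i) :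
    Projective ((cellMap R i H).obj M) := by
  have := d.preservesFiniteLimits_cellMap hs H
  have := d.preservesFiniteColimits_cellMap hs H
  obtain ⟨X, hX, -⟩ := d.exists_projGenerator hs i
  obtain ⟨T, q, hT, hq, hTH⟩ := d.exists_top hs
  refine hX.devissage (fun M => Projective ((cellMap R i H).obj M))
    (fun M hM => ((cellMap R i H).map_isZero hM).projective) (fun S M f hS hf ih => ?_) M
  have : Projective ((cellMap R i H).obj S) := by
    by_cases h : ∀ g : cellGen d.G (d.G_mem hs) ⟶ S, g = 0
    · exact (d.isZero_cellMap_of_mem_cell hs hH h).projective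
    · push Not at h
      obtain ⟨g, hg⟩ := h
      have hq0 : q ≠ 0 := epi_ne_zero q (Simple.not_isZero T)
      obtain ⟨c, hc⟩ := (d.isHollow_cellGen hs (d.G_mem hs)).exists_factor hq0 g
      have hc0 : c ≠ 0 := fun h => hg (by rw [hc, h, comp_zero])
      have := isIso_of_hom_simple hc0
      obtain ⟨e⟩ := hTH H hH
      have := d.projective_cellGen hs hH
      exact Projective.of_iso (e.symm ≪≫ (cellMap R i H).mapIso (asIso c)) this
  have : Projective (cokernel ((cellMap R i H).map f)) :=
    Projective.of_iso (PreservesCokernel.iso (cellMap R i H) f) ih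
  exact projective_of_mono_of_cokernel ((cellMap R i H).map f)

/-- The left cell of `F` contains an element `H` of `R`, so `F` is a summand of some `H Z`, and `F
M` is a summand of the projective object `H (Z M)`. -/
lemma projective_cellMap {j l : C} {F : j ⟶ l} (hF : ⟨j, l, F⟩ ∈ Q) (M : CellCat R i j) :
    Projective ((cellMap R i F).obj M) := by
  obtain ⟨⟨i', l', H⟩, hH, h1, -⟩ := hs.exists_mem_leL hF
  obtain rfl : i' = i := hs.src_eq hH
  obtain rfl : l' = l := by cases h1; rfl
  obtain ⟨Z, ⟨r⟩⟩ := leL_iff.1 h1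
  obtain ⟨r'⟩ := nonempty_retract_cellMap (R := R) r M
  have e := ((cellProp R i').mapComp Z H).app M
  have := d.projective_cellMap_of_mem_cell hs hH ((cellMap R i' Z).obj M)
  have : Projective ((cellMap R i' (Z ≫ H)).obj M) := Projective.of_iso e.symm this
  exact r'.projective

/-- The objects `H L` are injective in `C_R(j)`. -/
lemma injective_cellGen {j : C} {H : i ⟶ j} (hH : ⟨i, j, H⟩ ∈ R) : Injective (cellGen H hH) := by
  obtain ⟨T, q, hT, hq, hTH⟩ := d.exists_top hs
  obtain ⟨e⟩ := hTH H hH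
  refine Injective.of_iso e ⟨fun {M N} g f _ => ?_⟩
  obtain ⟨adj⟩ := nonempty_star_adj τ hs.adj i H
  have := d.preservesFiniteLimits_cellMap hs (τ.star H)
  have := d.preservesFiniteColimits_cellMap hs (τ.star H)
  have hQ : ⟨j, i, τ.star H⟩ ∈ Q := hs.star_mem_Q (hs.sub hH)
  -- This cokernel is `H*` applied to `coker f`, projective because `H* ∈ Q`. Hence `H* f` splits,
  -- the transpose `H* M → T` of `g` extends, and transposing back extends `g`.
  have hp : Projective (cokernel ((cellMap R i (τ.star H)).map f)) :=
    Projective.of_iso (PreservesCokernel.iso (cellMap R i (τ.star H)) f)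
      (d.projective_cellMap hs hQ _)
  have hS : (ShortComplex.mk ((cellMap R i (τ.star H)).map f) (cokernel.π _)
      (cokernel.condition _)).ShortExact := { exact := ShortComplex.exact_cokernel _ }
  have : Projective (ShortComplex.mk ((cellMap R i (τ.star H)).map f) (cokernel.π _)
      (cokernel.condition _)).X₃ := hp
  have s := hS.splittingOfProjective
  have hr : (cellMap R i (τ.star H)).map f ≫ s.r = 𝟙 _ := s.f_r
  refine ⟨(cellAdj adj).homEquiv _ _ (s.r ≫ ((cellAdj adj).homEquiv _ _).symm g), ?_⟩
  rw [← Adjunction.homEquiv_naturality_left, reassoc_of% hr, Equiv.apply_symm_apply]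

/-- The simple subobjects of `H L` are quotients of `H L`. -/
lemma exists_hom_of_simple_sub {j : C} {H : i ⟶ j} (hH : ⟨i, j, H⟩ ∈ R) {S : CellCat R i j}
    {f : S ⟶ cellGen H hH} (hf : f ≠ 0) : ∃ g : cellGen H hH ⟶ S, g ≠ 0 := by
  obtain ⟨T, q, hT, hq, hTH⟩ := d.exists_top hs
  obtain ⟨e⟩ := hTH H hH
  obtain ⟨adj⟩ := nonempty_star_adj τ hs.adj i H
  obtain ⟨adj'⟩ := nonempty_adj_star τ hs.adj i H
  have h1 : f ≫ e.inv ≠ 0 := fun h => hf (by rw [← cancel_mono e.inv, h, zero_comp])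
  -- Both adjunctions are used: `H* ⊣ H` makes `H* S` nonzero, and `H ⊣ H*` turns a nonzero `Y L →
  -- H* S` into a nonzero `H Y L → S`. The summands of `H Y` in `R` are isomorphic to `H`.
  have h2 : ¬ IsZero ((cellMap R i (τ.star H)).obj S) := fun h =>
    homEquiv_symm_ne_zero (cellAdj adj) h1 (h.eq_of_src _ _)
  obtain ⟨Y, hY, y, hy⟩ := d.exists_hom_cellGen hs h2
  obtain ⟨_, ⟨X, hX, ⟨r⟩, rfl⟩, b, hb⟩ := (d.addClosure_cellMap hs hY H).exists_summand
    (homEquiv_symm_ne_zero (cellAdj adj') hy)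
  have h3 := hs.isom_of_leL hH hX (.mk _ _ _ r)
  cases h3 with | mk e' =>
  by_contra! H'
  exact hb (d.hom_cellGen_eq_zero hs hX hH e'.symm H' _)

/-- The socle of `H L` is simple. -/
lemma exists_smul_eq [IsAlgClosed k] {j : C} {H : i ⟶ j} (hH : ⟨i, j, H⟩ ∈ R) {S : CellCat R i j}
    [Simple S] {f : S ⟶ cellGen H hH} (hf : f ≠ 0) (g : S ⟶ cellGen H hH) : ∃ c : k, g = c • f := by
  have hI := d.injective_cellGen hs hH
  have hl := d.isLocalObj_cellGen hs hH
  have ext : ∀ {f : S ⟶ cellGen H hH} (_ : f ≠ 0) (g : S ⟶ cellGen H hH), ∃ φ, f ≫ φ = g := by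
    intro f hf g
    have := mono_of_nonzero_from_simple hf
    exact ⟨Injective.factorThru g f, Injective.comp_factorThru g f⟩
  obtain ⟨φ, rfl⟩ := ext hf g
  have hfd : FiniteDimensional k (cellGen H hH ⟶ cellGen H hH) := by
    have : FiniteDimensional k ((cellObjects R i j).ι.obj (cellGen H hH) ⟶
        (cellObjects R i j).ι.obj (cellGen H hH)) :=
      hs.fin.finiteDimensional_hom (cellGen H hH).obj (cellGen H hH).obj
    exact Module.Finite.of_injective ((cellObjects R i j).ι.mapLinearMap k)
      (cellObjects R i j).ι.map_injective
  have : FiniteDimensional k (End (cellGen H hH)) := hfd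
  have : Nontrivial (End (cellGen H hH)) :=
    ⟨1, 0, fun h => hl.not_isZero ((IsZero.iff_id_eq_zero _).2 h)⟩
  -- The scalar is an eigenvalue of an endomorphism extending `g` along `f`.
  obtain ⟨c, hc⟩ := spectrum.nonempty_of_isAlgClosed_of_finiteDimensional k (End.of φ)
  refine ⟨c, ?_⟩
  let ψ : cellGen H hH ⟶ cellGen H hH := c • 𝟙 _ - φ
  have hψ : ¬ IsIso ψ := fun h => hc ((isUnit_iff_isIso (End.of ψ)).2 h)
  -- Otherwise injectivity gives `χ` with `f ≫ ψ ≫ χ = f`. Then `ψ ≫ χ` is not nilpotent, hence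
  -- invertible, and so is `ψ`, as one-sided inverses in a Noetherian ring are two-sided.
  have hfψ : f ≫ ψ = 0 := by
    by_contra h
    obtain ⟨χ, hχ⟩ := ext h f
    rcases hl.isIso_or_isNilpotent (ψ ≫ χ) with h1 | ⟨n, hn⟩
    · have : IsNoetherianRing (End (cellGen H hH)) := IsNoetherianRing.of_finite k _
      refine hψ ((isUnit_iff_isIso (End.of ψ)).1
        (IsUnit.of_mul_eq_one_right (End.of (χ ≫ inv (ψ ≫ χ))) ?_))
      change ψ ≫ χ ≫ inv (ψ ≫ χ) = 𝟙 _
      rw [← Category.assoc, IsIso.hom_inv_id]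
    · have key : ∀ m : ℕ, f ≫ End.asHom (End.of (ψ ≫ χ) ^ m) = f := by
        intro m
        induction m with
        | zero => exact Category.comp_id f
        | succ m ih =>
          rw [pow_succ]
          change f ≫ (ψ ≫ χ) ≫ End.asHom (End.of (ψ ≫ χ) ^ m) = f
          rw [← Category.assoc, ← Category.assoc, hχ, ih]
      refine hf ?_
      rw [← key n, hn]
      exact comp_zero
  rw [Preadditive.comp_sub, sub_eq_zero, Linear.comp_smul, Category.comp_id] at hfψ
  exact hfψ.symm

end CellTopData

end CellAction

/-! ### Modules: projective-injective covers imply weak symmetry. -/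

section SymmetricCovers

variable {A : Type*} [Ring A]

lemma Submodule.map_socle_le {M N : Type*} [AddCommGroup M] [Module A M] [AddCommGroup N]
    [Module A N] (f : M →ₗ[A] N) : (socle A M).map f ≤ socle A N := by
  rw [socle, sSup_eq_iSup, Submodule.map_iSup]
  refine iSup_le fun T => ?_
  rw [Submodule.map_iSup]
  refine iSup_le fun (hT : IsSimpleModule A T) => ?_
  rcases (f ∘ₗ T.subtype).injective_or_eq_zero with h | h
  · refine le_sSup ?_
    have e : T ≃ₗ[A] T.map f := (LinearEquiv.ofInjective _ h).trans
      (LinearEquiv.ofEq _ _ (by rw [LinearMap.range_comp, Submodule.range_subtype]))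
    exact IsSimpleModule.congr e.symm
  · have : T.map f = ⊥ := by
      rw [← T.range_subtype, ← LinearMap.range_comp, h, LinearMap.range_zero]
    rw [this]
    exact bot_le

/-- A self-injective module with an endomorphism whose kernel is the radical and whose image
is the socle. -/
structure IsInjectiveSymm (A M : Type*) [Ring A] [AddCommGroup M] [Module A M] : Prop where
  baer : Module.Baer A M
  exists_hom : ∃ φ : M →ₗ[A] M,
    LinearMap.ker φ = Module.jacobson A M ∧ LinearMap.range φ = socle A M

namespace IsInjectiveSymm

variable {M N : Type*} [AddCommGroup M] [Module A M] [AddCommGroup N] [Module A N]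

lemma of_subsingleton [Subsingleton M] : IsInjectiveSymm A M where
  baer _ _ := ⟨0, fun _ _ => Subsingleton.elim _ _⟩
  exists_hom := ⟨0, Subsingleton.elim _ _, Subsingleton.elim _ _⟩

lemma of_equiv (h : IsInjectiveSymm A M) (e : M ≃ₗ[A] N) : IsInjectiveSymm A N where
  baer := Module.Baer.of_equiv e h.baer
  exists_hom := by
    obtain ⟨φ, h1, h2⟩ := h.exists_hom
    refine ⟨e.toLinearMap ∘ₗ φ ∘ₗ e.symm.toLinearMap, ?_, ?_⟩
    · rw [LinearEquiv.ker_comp, LinearMap.ker_comp, h1]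
      exact Module.comap_jacobson_of_bijective (f := e.symm.toLinearMap) e.symm.bijective
    · rw [LinearMap.range_comp, LinearEquiv.range_comp, h2]
      refine le_antisymm (Submodule.map_socle_le _) ?_
      intro x hx
      exact ⟨e.symm x, Submodule.map_socle_le e.symm.toLinearMap ⟨x, hx, rfl⟩, e.apply_symm_apply x⟩

lemma prod (hM : IsInjectiveSymm A M) (hN : IsInjectiveSymm A N) : IsInjectiveSymm A (M × N) where
  baer I g := by
    obtain ⟨a, ha⟩ := hM.baer I (LinearMap.fst A M N ∘ₗ g)
    obtain ⟨b, hb⟩ := hN.baer I (LinearMap.snd A M N ∘ₗ g)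
    exact ⟨a.prod b, fun x hx => Prod.ext (ha x hx) (hb x hx)⟩
  exists_hom := by
    obtain ⟨φ, h1, h2⟩ := hM.exists_hom
    obtain ⟨ψ, h3, h4⟩ := hN.exists_hom
    refine ⟨φ.prodMap ψ, ?_, ?_⟩
    · rw [LinearMap.ker_prodMap, h1, h3]
      refine le_antisymm (le_sInf fun T hT => ?_) fun x hx => ?_
      · intro x hx
        have h5 := Module.le_comap_jacobson (LinearMap.inl A M N) hx.1
        have h6 := Module.le_comap_jacobson (LinearMap.inr A M N) hx.2
        have : x = LinearMap.inl A M N x.1 + LinearMap.inr A M N x.2 := by simp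
        rw [this]
        exact T.add_mem (Submodule.mem_sInf.1 h5 T hT) (Submodule.mem_sInf.1 h6 T hT)
      · exact ⟨Module.le_comap_jacobson (LinearMap.fst A M N) hx,
          Module.le_comap_jacobson (LinearMap.snd A M N) hx⟩
    · rw [LinearMap.range_prodMap, h2, h4]
      refine le_antisymm (fun x hx => ?_) fun x hx => ?_
      · have h5 := Submodule.map_socle_le (LinearMap.inl A M N) ⟨x.1, hx.1, rfl⟩
        have h6 := Submodule.map_socle_le (LinearMap.inr A M N) ⟨x.2, hx.2, rfl⟩
        have : x = LinearMap.inl A M N x.1 + LinearMap.inr A M N x.2 := by simp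
        rw [this]
        exact Submodule.add_mem _ h5 h6
      · exact ⟨Submodule.map_socle_le (LinearMap.fst A M N) ⟨x, hx, rfl⟩,
          Submodule.map_socle_le (LinearMap.snd A M N) ⟨x, hx, rfl⟩⟩

lemma nonempty_equiv (h : IsInjectiveSymm A M) :
    Nonempty ((M ⧸ Module.jacobson A M) ≃ₗ[A] socle A M) := by
  obtain ⟨φ, h1, h2⟩ := h.exists_hom
  exact ⟨(Submodule.quotEquivOfEq _ _ h1.symm).trans
    (φ.quotKerEquivRange.trans (LinearEquiv.ofEq _ _ h2))⟩

end IsInjectiveSymm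

/-- `π` exhibits `S` as the top, and `ι` exhibits it as the socle, of a finitely generated
projective and injective module with simple top and simple socle. -/
structure IsSymmCoverModule {P S : Type*} [AddCommGroup P] [Module A P] [AddCommGroup S]
    [Module A S] (π : P →ₗ[A] S) (ι : S →ₗ[A] P) : Prop where
  exists_split : ∃ (n : ℕ) (i : P →ₗ[A] (Fin n → A)) (s : (Fin n → A) →ₗ[A] P), s ∘ₗ i = .id
  baer : Module.Baer A P
  top_ne_zero : π ≠ 0
  socle_ne_zero : ι ≠ 0
  le_ker (N : Submodule A P) : N ≠ ⊤ → N ≤ LinearMap.ker π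
  range_le (N : Submodule A P) : N ≠ ⊥ → LinearMap.range ι ≤ N

/-- A simple module is the top and the socle of an indecomposable projective and injective
module. -/
def HasSymmCover (A : Type*) [Ring A] (S : Type*) [AddCommGroup S] [Module A S] : Prop :=
  ∃ (P : Type t) (_ : AddCommGroup P) (_ : Module A P) (π : P →ₗ[A] S) (ι : S →ₗ[A] P),
    IsSymmCoverModule π ι

namespace IsSymmCoverModule

variable {P S : Type*} [AddCommGroup P] [Module A P] [AddCommGroup S]
    [Module A S] {π : P →ₗ[A] S} {ι : S →ₗ[A] P}

lemma finite (h : IsSymmCoverModule π ι) : Module.Finite A P := by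
  obtain ⟨n, i, s, his⟩ := h.exists_split
  exact Module.Finite.of_surjective s fun x => ⟨i x, LinearMap.congr_fun his x⟩

lemma projective (h : IsSymmCoverModule π ι) : Module.Projective A P := by
  obtain ⟨n, i, s, his⟩ := h.exists_split
  exact Module.Projective.of_split i s his

/-- The endomorphism is `ι ∘ π`: `ker π` is the unique maximal submodule and `range ι` the unique
minimal one. -/
lemma isInjectiveSymm [IsSimpleModule A S] (h : IsSymmCoverModule π ι) : IsInjectiveSymm A P where
  baer := h.baer
  exists_hom := by
    have hι := ι.injective_of_ne_zero h.socle_ne_zero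
    have hπ := π.surjective_of_ne_zero h.top_ne_zero
    have e : IsSimpleModule A (LinearMap.range ι) :=
      IsSimpleModule.congr (LinearEquiv.ofInjective ι hι).symm
    refine ⟨ι ∘ₗ π, ?_, ?_⟩
    · rw [LinearMap.ker_comp, LinearMap.ker_eq_bot.2 hι, Submodule.comap_bot]
      have hc : IsCoatom (LinearMap.ker π) := isSimpleModule_iff_isCoatom.1
        (IsSimpleModule.congr (π.quotKerEquivOfSurjective hπ))
      refine le_antisymm (le_sInf fun T hT => ?_) (sInf_le hc)
      exact ((hT.le_iff.1 (h.le_ker T hT.1)).resolve_left hc.1).le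
    · rw [LinearMap.range_comp, LinearMap.range_eq_top.2 hπ, Submodule.map_top]
      refine le_antisymm (le_sSup e) (sSup_le fun T hT => ?_)
      have hT' := isSimpleModule_iff_isAtom.1 hT
      have := h.range_le T hT'.1
      rcases hT'.le_iff.1 this with h1 | h1
      · exact absurd (LinearMap.range_eq_bot.1 h1) h.socle_ne_zero
      · exact h1.ge

end IsSymmCoverModule

/-- If every simple module has a projective-injective cover of which it is also the socle, then all
finitely generated projective modules are injective with isomorphic top and socle. -/
lemma isInjectiveSymm_of_hasSymmCover {A : Type*} [Ring A] [IsArtinianRing A]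
    (hA : ∀ (S : Type v) [AddCommGroup S] [Module A S], IsSimpleModule A S → HasSymmCover.{t} A S)
    (M : Type v) [AddCommGroup M] [Module A M] [Module.Finite A M] [Module.Projective A M] :
    IsInjectiveSymm A M := by
  induction hn : Module.length A M using WellFoundedLT.induction generalizing M with
  | _ n ih =>
  subst hn
  rcases subsingleton_or_nontrivial M with hM | hM
  · exact .of_subsingleton
  obtain ⟨N, hN, -⟩ := (eq_top_or_exists_le_coatom (⊥ : Submodule A M)).resolve_left bot_ne_top
  have hS : IsSimpleModule A (M ⧸ N) := isSimpleModule_iff_isCoatom.2 hN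
  obtain ⟨P, _, _, π, ι, h⟩ := hA (M ⧸ N) hS
  have := h.finite
  have := h.projective
  obtain ⟨a, ha⟩ := Module.projective_lifting_property N.mkQ π N.mkQ_surjective
  obtain ⟨b, hb⟩ := Module.projective_lifting_property π N.mkQ
    (π.surjective_of_ne_zero h.top_ne_zero)
  -- Hence the range of `b ∘ a` is not contained in `ker π`, which forces it to be all of `P`. So
  -- `P` splits off `M`, with the shorter complement `ker b`.
  have hba : π ∘ₗ b ∘ₗ a = π := by rw [← LinearMap.comp_assoc, hb, ha]
  have hs : Function.Surjective (b ∘ₗ a) := by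
    rw [← LinearMap.range_eq_top]
    by_contra h1
    refine h.top_ne_zero ?_
    rw [← hba]
    exact LinearMap.range_le_ker_iff.1 (h.le_ker _ h1)
  let e := LinearEquiv.ofBijective (b ∘ₗ a)
    (IsNoetherian.bijective_of_surjective_endomorphism _ hs)
  have hsec : b ∘ₗ (a ∘ₗ e.symm.toLinearMap) = .id := LinearMap.ext fun x => e.apply_symm_apply x
  let p : M →ₗ[A] LinearMap.ker b := LinearMap.codRestrict _
    (LinearMap.id - a ∘ₗ e.symm.toLinearMap ∘ₗ b) fun x => by
      rw [LinearMap.mem_ker]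
      exact (map_sub b _ _).trans (sub_eq_zero.2 (LinearMap.congr_fun hsec (b x)).symm)
  have hp : p ∘ₗ (LinearMap.ker b).subtype = .id := by
    ext x
    have := LinearMap.mem_ker.1 x.2
    simp [p, this]
  have : Module.Projective A (LinearMap.ker b) := .of_split _ _ hp
  let f : M ≃ₗ[A] P × LinearMap.ker b := LinearEquiv.ofLinear (b.prod p)
    ((a ∘ₗ e.symm.toLinearMap).coprod (LinearMap.ker b).subtype) (by
      have h1 : ∀ x, b (a (e.symm x)) = x := LinearMap.congr_fun hsec
      refine LinearMap.ext fun x => Prod.ext ?_ (Subtype.ext ?_)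
      · simp [h1]
      · simp [p, h1]) (by
      ext x
      simp [p])
  have hP : Nontrivial P := by
    by_contra h1
    rw [not_nontrivial_iff_subsingleton] at h1
    exact h.top_ne_zero (Subsingleton.elim _ _)
  refine (h.isInjectiveSymm.prod (ih _ ?_ (LinearMap.ker b) rfl)).of_equiv f.symm
  rw [f.length_eq, Module.length_prod]
  have h1 : Module.length A P ≠ 0 := fun h0 => not_subsingleton P (Module.length_eq_zero_iff.1 h0)
  have h2 : Module.length A (LinearMap.ker b) ≠ ⊤ := Module.length_ne_top
  exact lt_of_le_of_ne le_add_self fun h3 => h1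
    (WithTop.add_right_cancel h2 ((zero_add _).trans h3)).symm

section Pi

variable {J : Type*} [DecidableEq J] {A : J → Type*} [∀ j, Ring (A j)]

/-- The restriction of a module over a product of rings along a factor. -/
abbrev moduleOfSingle (j : J) (S : Type*) [AddCommGroup S] [Module (∀ j, A j) S]
    (h : ∀ s : S, (Pi.single j 1 : ∀ j, A j) • s = s) : Module (A j) S where
  smul a s := (Pi.single j a : ∀ j, A j) • s
  one_smul := h
  mul_smul a b s := by
    change (Pi.single j (a * b) : ∀ j, A j) • s = (Pi.single j a : ∀ j, A j) •
      (Pi.single j b : ∀ j, A j) • s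
    rw [← mul_smul, ← Pi.single_mul]
  smul_zero a := smul_zero _
  smul_add a := smul_add _
  add_smul a b s := by
    change (Pi.single j (a + b) : ∀ j, A j) • s = _
    rw [Pi.single_add, add_smul]
    rfl
  zero_smul s := by
    change (Pi.single j 0 : ∀ j, A j) • s = 0
    rw [Pi.single_zero, zero_smul]

/-- The central idempotents of the factors sum to `1`. One of them acts nontrivially on `S`, hence
surjectively by simplicity, hence as the identity. -/
lemma exists_single_smul_eq [Finite J] (S : Type*) [AddCommGroup S] [Module (∀ j, A j) S]
    [IsSimpleModule (∀ j, A j) S] : ∃ j, ∀ s : S, (Pi.single j 1 : ∀ j, A j) • s = s := by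
  have := Fintype.ofFinite J
  have hS : Nontrivial S := IsSimpleModule.nontrivial (∀ j, A j) S
  obtain ⟨s, hs⟩ := exists_ne (0 : S)
  obtain ⟨j, hj⟩ : ∃ j, (Pi.single j 1 : ∀ j, A j) • s ≠ 0 := by
    by_contra! H
    refine hs ?_
    rw [← one_smul (∀ j, A j) s, ← Finset.univ_sum_single (1 : ∀ j, A j), Finset.sum_smul]
    exact Finset.sum_eq_zero fun j _ => H j
  have hc : ∀ r : ∀ j, A j, (Pi.single j 1 : ∀ j, A j) * r = r * Pi.single j 1 := fun r => by
    ext l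
    rcases eq_or_ne l j with rfl | h
    · simp
    · simp [h]
  have hi : (Pi.single j 1 : ∀ j, A j) * Pi.single j 1 = Pi.single j 1 := by
    rw [← Pi.single_mul, one_mul]
  let f : S →ₗ[∀ j, A j] S :=
    { toFun := fun s => (Pi.single j 1 : ∀ j, A j) • s
      map_add' := smul_add _
      map_smul' := fun r s => by rw [RingHom.id_apply, ← mul_smul, ← mul_smul, hc] }
  have hf : f ≠ 0 := fun h => hj (LinearMap.congr_fun h s)
  refine ⟨j, fun x => ?_⟩
  obtain ⟨y, rfl⟩ := f.surjective_of_ne_zero hf x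
  exact (mul_smul _ _ y).symm.trans (congrArg (· • y) hi)

lemma IsSymmCoverModule.compHom {j : J} {P S : Type*} [AddCommGroup P] [AddCommGroup S]
    [Module (A j) P] [Module (A j) S] [Module (∀ j, A j) P] [Module (∀ j, A j) S]
    (hP : ∀ (r : ∀ j, A j) (x : P), r • x = r j • x)
    (hS : ∀ (r : ∀ j, A j) (x : S), r • x = r j • x)
    {π : P →ₗ[A j] S} {ι : S →ₗ[A j] P} (h : IsSymmCoverModule π ι) :
    ∃ (π' : P →ₗ[∀ j, A j] S) (ι' : S →ₗ[∀ j, A j] P), IsSymmCoverModule π' ι' := by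
  let π' : P →ₗ[∀ j, A j] S :=
    { toFun := π, map_add' := π.map_add, map_smul' := fun r x => by
        rw [hP, π.map_smul, RingHom.id_apply, hS] }
  let ι' : S →ₗ[∀ j, A j] P :=
    { toFun := ι, map_add' := ι.map_add, map_smul' := fun r x => by
        rw [hS, ι.map_smul, RingHom.id_apply, hP] }
  have hsub : ∀ N : Submodule (∀ j, A j) P, ∃ N' : Submodule (A j) P, ∀ x, x ∈ N' ↔ x ∈ N := by
    intro N
    refine ⟨{ N with smul_mem' := fun a x hx => ?_ }, fun x => Iff.rfl⟩
    have := N.smul_mem (Pi.single j a) hx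
    rwa [hP, Pi.single_eq_same] at this
  refine ⟨π', ι', ?_, fun I g => ?_, ?_, ?_, fun N hN x hx => ?_, fun N hN => ?_⟩
  · obtain ⟨n, i, s, his⟩ := h.exists_split
    refine ⟨n, ⟨⟨fun p t => Pi.single j (i p t), fun p q => ?_⟩, fun r p => ?_⟩,
      ⟨⟨fun f => s fun t => f t j, fun p q => ?_⟩, fun r p => ?_⟩, LinearMap.ext fun p => ?_⟩
    · ext1 t
      rw [i.map_add, Pi.add_apply, Pi.single_add]
      rfl
    · ext1 t
      ext l
      rcases eq_or_ne l j with rfl | h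
      · simp [hP]
      · simp [h]
    · exact s.map_add _ _
    · rw [RingHom.id_apply, hP, ← s.map_smul]
      rfl
    · have := LinearMap.congr_fun his p
      simpa using this
  -- Baer's criterion reduces to the factor `A j`: a map from an ideal `I` to `P` only depends on
  -- the `j`-th components of the elements of `I`.
  · let I' : Ideal (A j) :=
      { carrier := {a | Pi.single j a ∈ I}
        add_mem' := fun {a b} ha hb => by
          simpa only [Set.mem_setOf_eq, Pi.single_add] using I.add_mem ha hb
        zero_mem' := by simp
        smul_mem' := fun a b hb => by
          simpa only [Set.mem_setOf_eq, smul_eq_mul, Pi.single_mul] using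
            I.mul_mem_left (Pi.single j a) hb }
    let g' : I' →ₗ[A j] P :=
      { toFun := fun a => g ⟨Pi.single j a.1, a.2⟩
        map_add' := fun a b => by
          rw [← g.map_add]
          exact congrArg g (Subtype.ext (Pi.single_add _ _ _))
        map_smul' := fun a b => by
          have := g.map_smul (Pi.single j a) ⟨Pi.single j b.1, b.2⟩
          rw [hP, Pi.single_eq_same] at this
          rw [RingHom.id_apply, ← this]
          exact congrArg g (Subtype.ext (Pi.single_mul _ _ _)) }
    obtain ⟨φ, hφ⟩ := h.baer I' g'
    refine ⟨⟨⟨fun r => φ (r j), fun p q => φ.map_add _ _⟩, fun r p => ?_⟩, fun x hx => ?_⟩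
    · rw [RingHom.id_apply, hP, ← φ.map_smul]
      rfl
    · have hm : Pi.single j (x j) ∈ I := by
        have := I.mul_mem_left (Pi.single j 1) hx
        convert this using 1
        ext l
        rcases eq_or_ne l j with rfl | h
        · simp
        · simp [h]
      refine (hφ (x j) hm).trans ?_
      have h1 := g.map_smul (Pi.single j 1) ⟨x, hx⟩
      rw [hP, Pi.single_eq_same, one_smul] at h1
      rw [← h1]
      refine congrArg g (Subtype.ext ?_)
      ext l
      rcases eq_or_ne l j with rfl | h
      · simp
      · simp [h]
  · exact fun h0 => h.top_ne_zero (LinearMap.ext fun x => LinearMap.congr_fun h0 x)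
  · exact fun h0 => h.socle_ne_zero (LinearMap.ext fun x => LinearMap.congr_fun h0 x)
  · obtain ⟨N', hN'⟩ := hsub N
    refine h.le_ker N' (fun h0 => hN ?_) ((hN' x).2 hx)
    exact Submodule.eq_top_iff'.2 fun y => (hN' y).1 (h0 ▸ Submodule.mem_top)
  · obtain ⟨N', hN'⟩ := hsub N
    rintro _ ⟨y, rfl⟩
    refine (hN' _).1 (h.range_le N' (fun h0 => hN ?_) ⟨y, rfl⟩)
    exact (Submodule.eq_bot_iff _).2 fun y hy => (Submodule.eq_bot_iff _).1 h0 y ((hN' y).2 hy)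

lemma hasSymmCover_pi [Finite J]
    (hA : ∀ (j : J) (S : Type v) [AddCommGroup S] [Module (A j) S], IsSimpleModule (A j) S →
      HasSymmCover.{t} (A j) S)
    (S : Type v) [AddCommGroup S] [Module (∀ j, A j) S] (hS : IsSimpleModule (∀ j, A j) S) :
    HasSymmCover.{t} (∀ j, A j) S := by
  obtain ⟨j, hj⟩ := exists_single_smul_eq (A := A) S
  letI := moduleOfSingle j S hj
  have h1 : ∀ (r : ∀ j, A j) (x : S), r • x = r j • x := fun r x => by
    change r • x = (Pi.single j (r j) : ∀ j, A j) • x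
    conv_lhs => rw [← hj x]
    rw [← mul_smul]
    congr 1
    ext l
    rcases eq_or_ne l j with rfl | h
    · simp
    · simp [h]
  have h2 : IsSimpleModule (A j) S := by
    have : RingHomSurjective (Pi.evalRingHom A j) := ⟨Function.surjective_eval j⟩
    let f : S →ₛₗ[Pi.evalRingHom A j] S :=
      { toFun := id, map_add' := fun _ _ => rfl, map_smul' := h1 }
    exact (f.isSimpleModule_iff_of_bijective Function.bijective_id).1 hS
  obtain ⟨P, _, _, π, ι, h⟩ := hA j S h2
  letI : Module (∀ j, A j) P := Module.compHom P (Pi.evalRingHom A j)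
  obtain ⟨π', ι', h'⟩ := h.compHom (fun _ _ => rfl) h1
  exact ⟨P, _, _, π', ι', h'⟩

end Pi

end SymmetricCovers

/-! ### Covers in categories and their transfer to modules. -/

section CategoricalCovers

/-- `π` exhibits `S` as the top, and `ι` exhibits it as the socle, of a projective and injective
object with simple top and simple socle. -/
structure IsSymmCover {D : Type*} [Category* D] [HasZeroMorphisms D] {P S : D} (π : P ⟶ S)
    (ι : S ⟶ P) : Prop where
  projective : Projective P
  injective : Injective P
  top_ne_zero : π ≠ 0
  socle_ne_zero : ι ≠ 0
  epi_of_comp_ne_zero {M : D} (f : M ⟶ P) : f ≫ π ≠ 0 → Epi f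
  exists_factor {M : D} (f : M ⟶ P) : Mono f → f ≠ 0 → ∃ g : S ⟶ M, g ≫ f = ι

lemma IsSymmCover.map {D D' : Type*} [Category* D] [Category* D'] [Preadditive D]
    [Preadditive D'] (E : D ⥤ D') [E.IsEquivalence] [E.Additive] {P S : D} {π : P ⟶ S}
    {ι : S ⟶ P} (h : IsSymmCover π ι) : IsSymmCover (E.map π) (E.map ι) where
  projective := (E.asEquivalence.map_projective_iff P).2 h.projective
  injective := (E.asEquivalence.map_injective_iff P).2 h.injective
  top_ne_zero h0 := h.top_ne_zero (E.map_injective (by rw [h0, E.map_zero]))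
  socle_ne_zero h0 := h.socle_ne_zero (E.map_injective (by rw [h0, E.map_zero]))
  epi_of_comp_ne_zero {M} f hf := by
    have h1 : E.map (E.preimage ((E.objObjPreimageIso M).hom ≫ f)) =
      (E.objObjPreimageIso M).hom ≫ f := E.map_preimage _
    have h2 : Epi (E.preimage ((E.objObjPreimageIso M).hom ≫ f)) := by
      refine h.epi_of_comp_ne_zero _ fun h0 => hf ?_
      have h3 := congrArg E.map h0
      rw [E.map_comp, h1, E.map_zero, Category.assoc] at h3
      rw [← cancel_epi (E.objObjPreimageIso M).hom, h3, comp_zero]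
    have : Epi ((E.objObjPreimageIso M).hom ≫ f) := by
      rw [← h1]
      infer_instance
    exact epi_of_epi (E.objObjPreimageIso M).hom f
  exists_factor {M} f hm hf := by
    have h1 : E.map (E.preimage ((E.objObjPreimageIso M).hom ≫ f)) =
      (E.objObjPreimageIso M).hom ≫ f := E.map_preimage _
    obtain ⟨g, hg⟩ := h.exists_factor (E.preimage ((E.objObjPreimageIso M).hom ≫ f))
      (E.mono_of_mono_map (by rw [h1]; infer_instance)) fun h0 => hf (by
        rw [← cancel_epi (E.objObjPreimageIso M).hom, ← h1, h0, E.map_zero, comp_zero])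
    refine ⟨E.map g ≫ (E.objObjPreimageIso M).hom, ?_⟩
    rw [Category.assoc, ← h1, ← E.map_comp, hg]

lemma IsSymmCover.of_iso {D : Type*} [Category* D] [HasZeroMorphisms D] {P S S' : D} {π : P ⟶ S}
    {ι : S ⟶ P} (h : IsSymmCover π ι) (e : S ≅ S') : IsSymmCover (π ≫ e.hom) (e.inv ≫ ι) where
  projective := h.projective
  injective := h.injective
  top_ne_zero h0 := h.top_ne_zero (by rw [← cancel_mono e.hom, h0, zero_comp])
  socle_ne_zero h0 := h.socle_ne_zero (by rw [← cancel_epi e.inv, h0, comp_zero])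
  epi_of_comp_ne_zero f hf := h.epi_of_comp_ne_zero f fun h0 => hf (by
    rw [← Category.assoc, h0, zero_comp])
  exists_factor f hm hf := by
    obtain ⟨g, hg⟩ := h.exists_factor f hm hf
    exact ⟨e.inv ≫ g, by rw [Category.assoc, hg]⟩

lemma simple_of_equivalence {D D' : Type*} [Category* D] [Category* D'] [Preadditive D]
    [Preadditive D'] (E : D ⥤ D') [E.IsEquivalence] [E.Additive] {S : D} (h : Simple (E.obj S)) :
    Simple S where
  mono_isIso_iff_nonzero {Y} f _ := by
    rw [← isIso_iff_of_reflects_iso f E, Simple.mono_isIso_iff_nonzero]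
    exact ⟨fun h h0 => h (by rw [h0, E.map_zero]), fun h h0 => h (E.map_injective (by
      rw [h0, E.map_zero]))⟩

variable {A : Type t} [Ring A] [IsNoetherianRing A]

omit [IsNoetherianRing A] in
lemma FGModuleCat.mono_of_injective {M N : FGModuleCat.{t} A} (f : M ⟶ N)
    (h : Function.Injective f.hom.hom) : Mono f :=
  (forget₂ (FGModuleCat.{t} A) (ModuleCat.{t} A)).mono_of_mono_map
    ((ModuleCat.mono_iff_injective _).2 h)

omit [IsNoetherianRing A] in
lemma FGModuleCat.epi_of_surjective {M N : FGModuleCat.{t} A} (f : M ⟶ N)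
    (h : Function.Surjective f.hom.hom) : Epi f :=
  (forget₂ (FGModuleCat.{t} A) (ModuleCat.{t} A)).epi_of_epi_map
    ((ModuleCat.epi_iff_surjective _).2 h)

lemma FGModuleCat.simple_of_isSimpleModule (S : FGModuleCat.{t} A) [IsSimpleModule A S] :
    Simple S where
  mono_isIso_iff_nonzero {Y} f _ := by
    have hi : Function.Injective f.hom.hom := FGModuleCat.injective_of_mono f
    refine ⟨fun h h0 => ?_, fun h => ?_⟩
    · have : Nontrivial S := IsSimpleModule.nontrivial A S
      obtain ⟨s, hs⟩ := exists_ne (0 : S)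
      obtain ⟨x, hx⟩ := FGModuleCat.surjective_of_epi f s
      refine hs (hx.symm.trans ?_)
      rw [h0]
      rfl
    · have hs : Function.Surjective f.hom.hom :=
        LinearMap.surjective_of_ne_zero fun h0 => h (FGModuleCat.hom_ext h0)
      have : IsIso ((forget₂ (FGModuleCat.{t} A) (ModuleCat.{t} A)).map f) :=
        (ConcreteCategory.isIso_iff_bijective _).2 ⟨hi, hs⟩
      exact isIso_of_reflects_iso f (forget₂ (FGModuleCat.{t} A) (ModuleCat.{t} A))

lemma IsSymmCover.isSymmCoverModule {P S : FGModuleCat.{t} A} {π : P ⟶ S} {ι : S ⟶ P}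
    (h : IsSymmCover π ι) : IsSymmCoverModule π.hom.hom ι.hom.hom where
  exists_split := by
    obtain ⟨n, s, hs⟩ := Module.Finite.exists_fin' A P
    have := h.projective
    let s' : FGModuleCat.of A (Fin n → A) ⟶ P := FGModuleCat.ofHom s
    have : Epi s' := FGModuleCat.epi_of_surjective _ hs
    refine ⟨n, (Projective.factorThru (𝟙 P) s').hom.hom, s, ?_⟩
    exact congrArg (fun t => t.hom.hom) (Projective.factorThru_comp (𝟙 P) s')
  baer I g := by
    have := h.injective
    let j : FGModuleCat.of A I ⟶ FGModuleCat.of A A := FGModuleCat.ofHom I.subtype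
    have : Mono j := FGModuleCat.mono_of_injective _ I.injective_subtype
    let g' : FGModuleCat.of A I ⟶ P := FGModuleCat.ofHom g
    refine ⟨(Injective.factorThru g' j).hom.hom, fun x hx => ?_⟩
    exact LinearMap.congr_fun (congrArg (fun t => t.hom.hom) (Injective.comp_factorThru g' j))
      ⟨x, hx⟩
  top_ne_zero h0 := h.top_ne_zero (FGModuleCat.hom_ext h0)
  socle_ne_zero h0 := h.socle_ne_zero (FGModuleCat.hom_ext h0)
  le_ker N hN := by
    by_contra h1
    have : Module.Finite A N := Module.Finite.of_fg (IsNoetherian.noetherian N)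
    let f : FGModuleCat.of A N ⟶ P := FGModuleCat.ofHom N.subtype
    have : Epi f := h.epi_of_comp_ne_zero f fun h0 => h1 fun x hx => by
      have h2 := congrArg (fun t => t.hom.hom) h0
      exact LinearMap.congr_fun h2 ⟨x, hx⟩
    refine hN (Submodule.eq_top_iff'.2 fun x => ?_)
    obtain ⟨y, rfl⟩ := FGModuleCat.surjective_of_epi f x
    exact y.2
  range_le N hN := by
    have : Module.Finite A N := Module.Finite.of_fg (IsNoetherian.noetherian N)
    let f : FGModuleCat.of A N ⟶ P := FGModuleCat.ofHom N.subtype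
    obtain ⟨g, hg⟩ := h.exists_factor f (FGModuleCat.mono_of_injective _ N.injective_subtype)
      fun h0 => hN ((Submodule.eq_bot_iff _).2 fun x hx =>
        LinearMap.congr_fun (congrArg (fun t => t.hom.hom) h0) ⟨x, hx⟩)
    rintro _ ⟨x, rfl⟩
    have : ι.hom.hom x = (g.hom.hom x).1 :=
      LinearMap.congr_fun (congrArg (fun t => t.hom.hom) hg.symm) x
    rw [this]
    exact (g.hom.hom x).2

lemma hasSymmCover_of_isSymmCover
    (h : ∀ S : FGModuleCat.{t} A, Simple S → ∃ (P : FGModuleCat.{t} A) (π : P ⟶ S) (ι : S ⟶ P),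
      IsSymmCover π ι)
    (S : Type v) [AddCommGroup S] [Module A S] (hS : IsSimpleModule A S) :
    HasSymmCover.{t} A S := by
  -- `S` may live in another universe than `A`; it is replaced by a quotient `A ⧸ m`.
  obtain ⟨m, hm, ⟨e⟩⟩ := isSimpleModule_iff_quot_maximal.1 hS
  have : IsSimpleModule A (A ⧸ m) := IsSimpleModule.congr e.symm
  have := FGModuleCat.simple_of_isSimpleModule (FGModuleCat.of A (A ⧸ m))
  obtain ⟨P, π, ι, h⟩ := h (FGModuleCat.of A (A ⧸ m)) this
  have h' := h.isSymmCoverModule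
  refine ⟨P, inferInstance, inferInstance, e.symm.toLinearMap ∘ₗ π.hom.hom,
    ι.hom.hom ∘ₗ e.toLinearMap, h'.exists_split, h'.baer, fun h0 => h'.top_ne_zero ?_,
    fun h0 => h'.socle_ne_zero ?_, fun N hN => ?_, fun N hN => ?_⟩
  · exact LinearMap.ext fun x => e.symm.injective
      ((LinearMap.congr_fun h0 x).trans e.symm.map_zero.symm)
  · refine LinearMap.ext fun x => ?_
    have := LinearMap.congr_fun h0 (e.symm x)
    rwa [LinearMap.comp_apply, LinearEquiv.coe_coe, e.apply_symm_apply] at this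
  · rw [LinearEquiv.ker_comp]
    exact h'.le_ker N hN
  · rw [LinearMap.range_comp, LinearEquiv.range, Submodule.map_top]
    exact h'.range_le N hN

end CategoricalCovers

/-! ### Self-injectivity and weak symmetry of the cell algebras. -/

section CellCovers

variable {k : Type*} [Field k] {C : Type u} [Bicategory.{w, v} C]
  [∀ i j : C, Preadditive (i ⟶ j)] [∀ i j : C, Linear k (i ⟶ j)]
  [∀ i j : C, HasFiniteBiproducts (i ⟶ j)] [BiadditiveComp C]
  [∀ i j : C, IsAbelianCat (RightFreyd (i ⟶ j))] [HasExactAction C]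
  {τ : Involution C} {Q R : Set (OneMor C)} {i : C}
  (d : CellTopData R i (cellTop R i)) (hs : CellSetup k τ Q R i)
  [(cellProp R i).IsClosedUnderMapObj] [∀ j, IsAbelianCat (CellCat R i j)]

include d hs in
-- The cover is an object `H L` with top `S`. Every simple subobject of `H L` is a quotient of `H
-- L`, hence isomorphic to `S`; the morphisms `S → H L` are multiples of a single one, so it factors
-- through each nonzero subobject.
lemma CellTopData.exists_isSymmCover [IsAlgClosed k] {j : C} (S : CellCat R i j) [Simple S] :
    ∃ (P : CellCat R i j) (π : P ⟶ S) (ι : S ⟶ P), IsSymmCover π ι := by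
  obtain ⟨H, hH, π, hπ⟩ := d.exists_hom_cellGen hs (Simple.not_isZero S)
  have hh := d.isHollow_cellGen hs hH
  obtain ⟨X, hX, -⟩ := d.exists_projGenerator hs j
  have key : ∀ {N : CellCat R i j} (f : N ⟶ cellGen H hH), Mono f → f ≠ 0 →
      ∃ g : S ⟶ N, g ≫ f ≠ 0 := by
    intro N f _ hf
    have hN : ¬ IsZero N := fun h => hf (h.eq_of_src _ _)
    obtain ⟨T, a, _, _⟩ := hX.exists_simple_sub hN
    have ha : a ≫ f ≠ 0 := fun h => Simple.not_isZero T (IsZero.of_mono_eq_zero _ h)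
    obtain ⟨g, hg⟩ := d.exists_hom_of_simple_sub hs hH ha
    obtain ⟨c, hc⟩ := hh.exists_factor hπ g
    have hc0 : c ≠ 0 := fun h => hg (by rw [hc, h, comp_zero])
    have := isIso_of_hom_simple hc0
    refine ⟨c ≫ a, fun h => ha ?_⟩
    rw [← cancel_epi c, ← Category.assoc, h, comp_zero]
  obtain ⟨ι, hι⟩ := key (𝟙 (cellGen H hH)) inferInstance fun h =>
    hh.not_isZero ((IsZero.iff_id_eq_zero _).2 h)
  rw [Category.comp_id] at hι
  refine ⟨cellGen H hH, π, ι, d.projective_cellGen hs hH, d.injective_cellGen hs hH, hπ, hι,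
    fun f hf => hh.epi_of_comp_ne_zero f hf, fun f hm hf => ?_⟩
  obtain ⟨g, hg⟩ := key f hm hf
  obtain ⟨c, hc⟩ := d.exists_smul_eq hs hH hg ι
  exact ⟨c • g, by rw [Linear.smul_comp, hc]⟩

include d hs in
/-- The algebras of a cell 2-representation are self-injective and weakly symmetric. -/
lemma CellTopData.injective_and_isWeaklySymmetric [IsAlgClosed k] (A : C → Type t)
    [∀ j, Ring (A j)] [∀ j, Algebra k (A j)] [∀ j, FiniteDimensional k (A j)]
    (E : ∀ j, CellCat R i j ⥤ FGModuleCat.{t} (A j)) [∀ j, (E j).IsEquivalence]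
    [∀ j, (E j).Additive] :
    Module.Injective (∀ j, A j) (∀ j, A j) ∧ IsWeaklySymmetric (∀ j, A j) := by
  classical
  have := hs.fin.finite_obj
  have (j : C) : IsNoetherianRing (A j) := IsNoetherianRing.of_finite k (A j)
  have : IsArtinianRing (∀ j, A j) := IsArtinianRing.of_finite k _
  -- A product indexed by the objects of `C` lives in the universe `max u t`, and so must the
  -- modules tested here.
  have key (S : Type (max u t)) [AddCommGroup S] [Module (∀ j, A j) S] :
      IsSimpleModule (∀ j, A j) S → HasSymmCover.{t} (∀ j, A j) S := by
    refine hasSymmCover_pi (A := A) (fun j => hasSymmCover_of_isSymmCover fun S hS => ?_) S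
    have : Simple ((E j).objPreimage S) := simple_of_equivalence (E j)
      (Simple.of_iso ((E j).objObjPreimageIso S))
    obtain ⟨P, π, ι, h⟩ := d.exists_isSymmCover hs ((E j).objPreimage S)
    exact ⟨_, _, _, (h.map (E j)).of_iso ((E j).objObjPreimageIso S)⟩
  have key' := isInjectiveSymm_of_hasSymmCover key
  exact ⟨(key' (∀ j, A j)).baer.injective, fun P _ _ _ _ => (key' P).nonempty_equiv⟩

end CellCovers

/-! ### Exact functors supported on a single simple object. -/

section EvaluationMap

open scoped TensorProduct ModuleCat

variable {k : Type*} [Field k] {D : Type*} [Category* D] [Preadditive D] [Linear k D] {B : Type t}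
  [Ring B] [Algebra k B] (Ψ : D ⥤ FGModuleCat.{t} B) [Ψ.Additive] [Ψ.Linear k]

/-- The restriction of scalars to `k` of a morphism of modules over a `k`-algebra. -/
def restrictHom {M N : FGModuleCat.{t} B} (f : M ⟶ N) : M →ₗ[k] N where
  toFun := f.hom.hom
  map_add' := f.hom.hom.map_add
  map_smul' a x := f.hom.hom.map_smul (algebraMap k B a) x

/-- The map `v ⊗ h ↦ Ψ(h)(c(v))`. -/
def evalMap {V : FGModuleCat.{t} B} {P : D} (c : V ⟶ Ψ.obj P) (M : D) :
    V ⊗[k] (P ⟶ M) →ₗ[k] Ψ.obj M :=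
  TensorProduct.lift (LinearMap.mk₂ k (fun v h => (Ψ.map h).hom.hom (c.hom.hom v))
    (fun v w h => by rw [map_add, map_add])
    (fun a v h => ((restrictHom (k := k) (c ≫ Ψ.map h)).map_smul a v))
    (fun v h h' => by rw [Ψ.map_add]; rfl)
    (fun a v h => by rw [Ψ.map_smul]; rfl))

lemma evalMap_tmul {V : FGModuleCat.{t} B} {P : D} (c : V ⟶ Ψ.obj P) {M : D} (v : V) (h : P ⟶ M) :
    evalMap (k := k) Ψ c M (v ⊗ₜ h) = (Ψ.map h).hom.hom (c.hom.hom v) := rfl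

lemma evalMap_comp {V : FGModuleCat.{t} B} {P : D} (c : V ⟶ Ψ.obj P) {M N : D} (f : M ⟶ N) :
    evalMap (k := k) Ψ c N ∘ₗ (Linear.rightComp k P f).lTensor V =
      restrictHom (Ψ.map f) ∘ₗ evalMap Ψ c M := by
  refine TensorProduct.ext' fun v h => ?_
  change (Ψ.map (h ≫ f)).hom.hom (c.hom.hom v) = _
  rw [Ψ.map_comp]
  rfl

lemma bijective_evalMap_of_iso {V : FGModuleCat.{t} B} {P : D} (c : V ⟶ Ψ.obj P) {M N : D}
    (e : M ≅ N) (h : Function.Bijective (evalMap (k := k) Ψ c M)) :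
    Function.Bijective (evalMap (k := k) Ψ c N) := by
  have h1 := evalMap_comp (k := k) Ψ c e.hom
  have h2 : Function.Bijective ((Linear.rightComp k P e.hom).lTensor V) := by
    refine ⟨Module.Flat.lTensor_preserves_injective_linearMap _ fun f g hfg => ?_,
      LinearMap.lTensor_surjective _ fun f => ⟨f ≫ e.inv, ?_⟩⟩
    · exact (cancel_mono e.hom).1 hfg
    · exact (Category.assoc _ _ _).trans (by rw [e.inv_hom_id, Category.comp_id])
  have h3 : Function.Bijective (restrictHom (k := k) (Ψ.map e.hom)) :=
    (FGModuleCat.isoToLinearEquiv (Ψ.mapIso e)).bijective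
  refine (Function.Bijective.of_comp_iff _ h2).1 ?_
  have h4 := h3.comp h
  rwa [← LinearMap.coe_comp, ← h1, LinearMap.coe_comp] at h4

variable {D : Type*} [Category* D] [Abelian D] [Linear k D] [IsNoetherianRing B]
  (Ψ : D ⥤ FGModuleCat.{t} B) [Ψ.Additive] [Ψ.Linear k] [PreservesFiniteLimits Ψ]
  [PreservesFiniteColimits Ψ]

/-- Five lemma: `V ⊗ Hom(P, -)` is exact because `P` is projective and `k` is a field, and `Ψ` is
exact by assumption. -/
lemma bijective_evalMap_of_shortExact {V : FGModuleCat.{t} B} {P : D} [Projective P]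
    (c : V ⟶ Ψ.obj P) {S : ShortComplex D} (hS : S.ShortExact)
    (h₁ : Function.Bijective (evalMap (k := k) Ψ c S.X₁))
    (h₃ : Function.Bijective (evalMap (k := k) Ψ c S.X₃)) :
    Function.Bijective (evalMap (k := k) Ψ c S.X₂) := by
  have := hS.mono_f
  have := hS.epi_g
  have hi : Function.Injective (Linear.rightComp k P S.f) := fun f g h => (cancel_mono S.f).1 h
  have hs : Function.Surjective (Linear.rightComp k P S.g) := fun f =>
    ⟨Projective.factorThru f S.g, Projective.factorThru_comp f S.g⟩
  have he : Function.Exact (Linear.rightComp k P S.f) (Linear.rightComp k P S.g) := by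
    intro f
    refine ⟨fun h => ⟨hS.exact.lift f h, hS.exact.lift_f f h⟩, ?_⟩
    rintro ⟨g, rfl⟩
    change (g ≫ S.f) ≫ S.g = 0
    rw [Category.assoc, S.zero, comp_zero]
  have hS' := (hS.map_of_exact Ψ).map_of_exact
    (forget₂ (FGModuleCat.{t} B) (ModuleCat.{t} B))
  have hi' : Function.Injective (restrictHom (k := k) (Ψ.map S.f)) := hS'.moduleCat_injective_f
  have hs' : Function.Surjective (restrictHom (k := k) (Ψ.map S.g)) := hS'.moduleCat_surjective_g
  have he' : Function.Exact (restrictHom (k := k) (Ψ.map S.f)) (restrictHom (k := k) (Ψ.map S.g)) :=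
    (ShortComplex.ShortExact.moduleCat_exact_iff_function_exact _).1 hS'.exact
  refine LinearMap.bijective_of_surjective_of_bijective_of_bijective_of_injective
    (0 : PUnit →ₗ[k] V ⊗[k] (P ⟶ S.X₁)) ((Linear.rightComp k P S.f).lTensor V)
    ((Linear.rightComp k P S.g).lTensor V) (0 : _ →ₗ[k] PUnit)
    (0 : PUnit →ₗ[k] Ψ.obj S.X₁) (restrictHom (Ψ.map S.f)) (restrictHom (Ψ.map S.g))
    (0 : _ →ₗ[k] PUnit) 0 (evalMap Ψ c S.X₁) (evalMap Ψ c S.X₂) (evalMap Ψ c S.X₃) 0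
    (by simp) (evalMap_comp Ψ c S.f).symm (evalMap_comp Ψ c S.g).symm (by simp) ?_
    (lTensor_exact _ he hs) ?_ ?_ he' ?_ (fun _ => ⟨0, Subsingleton.elim _ _⟩) h₁ h₃
    (Function.injective_of_subsingleton _)
  · rw [LinearMap.exact_zero_iff_injective]
    exact Module.Flat.lTensor_preserves_injective_linearMap _ hi
  · rw [LinearMap.exact_zero_iff_surjective]
    exact LinearMap.lTensor_surjective _ hs
  · rwa [LinearMap.exact_zero_iff_injective]
  · rwa [LinearMap.exact_zero_iff_surjective]

/-- An exact functor which annihilates all simple objects but the top of a projective object `P`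
is determined by its value at this top. -/
lemma bijective_evalMap {X : D} (hX : IsProjGenerator k X) {P S₀ : D} [Projective P]
    (hP : IsHollow P) [Simple S₀] {π : P ⟶ S₀} (hπ : π ≠ 0)
    (hπ' : ∀ φ : P ⟶ S₀, ∃ a : k, φ = a • π)
    (h₀ : ∀ S, Simple S → (∀ f : P ⟶ S, f = 0) → IsZero (Ψ.obj S))
    (c : Ψ.obj S₀ ⟶ Ψ.obj P) (hc : c ≫ Ψ.map π = 𝟙 _) (M : D) :
    Function.Bijective (evalMap (k := k) Ψ c M) := by
  have hz : ∀ M : D, (∀ f : P ⟶ M, f = 0) → IsZero (Ψ.obj M) →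
      Function.Bijective (evalMap (k := k) Ψ c M) := by
    intro M h1 h2
    have h3 : Subsingleton (P ⟶ M) := ⟨fun f g => (h1 f).trans (h1 g).symm⟩
    have h4 : Subsingleton (Ψ.obj M) := by
      have h5 := (IsZero.iff_id_eq_zero _).1 h2
      refine ⟨fun x y => ?_⟩
      have h6 : ∀ x : Ψ.obj M, x = 0 := fun x =>
        LinearMap.congr_fun (congrArg (fun t => t.hom.hom) h5) x
      rw [h6 x, h6 y]
    have h5 : ∀ x : Ψ.obj S₀ ⊗[k] (P ⟶ M), x = 0 := fun x => by
      induction x with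
      | zero => rfl
      | tmul v f => rw [h1 f, TensorProduct.tmul_zero]
      | add x y hx hy => rw [hx, hy, add_zero]
    exact ⟨fun x y _ => (h5 x).trans (h5 y).symm, fun x => ⟨0, Subsingleton.elim _ _⟩⟩
  refine hX.devissage (fun M => Function.Bijective (evalMap (k := k) Ψ c M))
    (fun M hM => hz M (fun f => hM.eq_of_tgt _ _) (Ψ.map_isZero hM)) (fun S M f hS hf ih => ?_) M
  refine bijective_evalMap_of_shortExact Ψ c (S := ShortComplex.mk f (cokernel.π f)
    (cokernel.condition f)) { exact := ShortComplex.exact_cokernel _ } ?_ ih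
  by_cases h : ∀ g : P ⟶ S, g = 0
  -- For a simple object other than the top of `P`, both sides vanish.
  · exact hz S h (h₀ S hS h)
  push Not at h
  obtain ⟨g, hg⟩ := h
  obtain ⟨b, rfl⟩ := hP.exists_factor hπ g
  have := isIso_of_hom_simple fun h : b = 0 => hg (by rw [h, comp_zero])
  refine bijective_evalMap_of_iso Ψ c (asIso b) ?_
  -- On the top, `Hom(P, S₀)` is the line spanned by `π`, and evaluation becomes `V ⊗ k ≅ V` because
  -- `c` is a section of `Ψ π`.
  let e : k ≃ₗ[k] (P ⟶ S₀) := LinearEquiv.ofBijective (LinearMap.toSpanSingleton k _ π)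
    ⟨LinearMap.ker_eq_bot.1 (LinearMap.ker_toSpanSingleton k hπ),
      fun φ => (hπ' φ).imp fun a ha => ha.symm⟩
  have h1 : evalMap (k := k) Ψ c S₀ ∘ₗ (e.lTensor (Ψ.obj S₀)).toLinearMap =
      (TensorProduct.rid k (Ψ.obj S₀)).toLinearMap := by
    refine TensorProduct.ext' fun v a => ?_
    change (Ψ.map (a • π)).hom.hom (c.hom.hom v) = a • v
    rw [Ψ.map_smul]
    exact congrArg (a • ·) (LinearMap.congr_fun (congrArg (fun t => t.hom.hom) hc) v)
  refine (Function.Bijective.of_comp_iff _ (e.lTensor (Ψ.obj S₀)).bijective).1 ?_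
  have h2 := (TensorProduct.rid k (Ψ.obj S₀)).bijective
  rwa [← LinearEquiv.coe_coe, ← h1] at h2

end EvaluationMap

section DualBasis

variable {R M : Type*} [Ring R] [AddCommGroup M] [Module R M]

lemma exists_dualBasis [Module.Finite R M] [Module.Projective R M] :
    ∃ (n : ℕ) (f : Fin n → M →ₗ[R] R) (x : Fin n → M), ∀ m, ∑ t, f t m • x t = m := by
  obtain ⟨n, s, hs⟩ := Module.Finite.exists_fin' R M
  obtain ⟨i, hi⟩ := Module.projective_lifting_property s .id hs
  refine ⟨n, fun t => LinearMap.proj t ∘ₗ i, fun t => s (Pi.single t 1), fun m => ?_⟩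
  conv_rhs => rw [← LinearMap.id_apply (R := R) m, ← hi, LinearMap.comp_apply,
    ← Finset.univ_sum_single (i m), map_sum]
  refine Finset.sum_congr rfl fun t _ => ?_
  rw [← map_smul, ← Pi.single_smul, smul_eq_mul, mul_one]
  rfl

lemma finite_and_projective_of_dualBasis {ι : Type*} [Fintype ι] [DecidableEq ι]
    (f : ι → M →ₗ[R] R) (x : ι → M) (h : ∀ m, ∑ t, f t m • x t = m) :
    Module.Finite R M ∧ Module.Projective R M := by
  have h' : Fintype.linearCombination R x ∘ₗ LinearMap.pi f = .id := LinearMap.ext fun m => by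
    simpa [Fintype.linearCombination_apply] using h m
  exact ⟨.of_surjective (Fintype.linearCombination R x) fun m => ⟨_, LinearMap.congr_fun h' m⟩, .of_split _ _ h'⟩

end DualBasis

/-! ### Rewriting `V ⊗ Hom_A(P, -)` as tensoring with a projective bimodule. -/

section ProjectiveFunctors

open scoped TensorProduct ModuleCat
open MulOpposite

section Bimodule

variable (k : Type*) [Field k] (A B V P : Type t) [Ring A] [Ring B] [Algebra k A] [Algebra k B]
  [AddCommGroup V] [Module k V] [Module B V] [IsScalarTower k B V] [AddCommGroup P] [Module A P]

/-- The right action of `A` on `V ⊗ Hom_A(P, A)`. -/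
abbrev rightModule : Module Aᵐᵒᵖ (V ⊗[k] (P →ₗ[A] A)) :=
  Module.compHom _ ((Module.End.lTensorAlgHom k (P →ₗ[A] A) V).comp
    (Algebra.lsmul k k (P →ₗ[A] A) : Aᵐᵒᵖ →ₐ[k] Module.End k (P →ₗ[A] A))).toRingHom

attribute [local instance] rightModule

variable {k A B V P}

lemma op_smul_tmul (a : Aᵐᵒᵖ) (v : V) (h : P →ₗ[A] A) : a • (v ⊗ₜ[k] h) = v ⊗ₜ[k] (a • h) := rfl

instance : IsScalarTower k Aᵐᵒᵖ (V ⊗[k] (P →ₗ[A] A)) where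
  smul_assoc c a x := by
    induction x with
    | zero => simp
    | tmul v h => rw [op_smul_tmul, op_smul_tmul, smul_assoc, TensorProduct.tmul_smul]
    | add x y hx hy => rw [smul_add, hx, hy, smul_add, smul_add]

instance : SMulCommClass B Aᵐᵒᵖ (V ⊗[k] (P →ₗ[A] A)) where
  smul_comm b a x := by
    induction x with
    | zero => simp
    | tmul v h => rw [op_smul_tmul, TensorProduct.smul_tmul', TensorProduct.smul_tmul', op_smul_tmul]
    | add x y hx hy => simp only [smul_add, hx, hy]

/-- A dual basis of `V` over `B` and one of `P` over `A`, the latter with its two roles exchanged,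
combine to a dual basis of `V ⊗ Hom_A(P, A)` over `B ⊗ Aᵒᵖ`. -/
lemma isProjectiveBimodule [Module.Finite A P] [Module.Projective A P] [Module.Finite B V]
    [Module.Projective B V] : IsProjectiveBimodule k A B (V ⊗[k] (P →ₗ[A] A)) := by
  letI : Module (B ⊗[k] Aᵐᵒᵖ) (V ⊗[k] (P →ₗ[A] A)) := TensorProduct.Algebra.module
  obtain ⟨n, f, x, hf⟩ := exists_dualBasis (R := B) (M := V)
  obtain ⟨m, g, y, hg⟩ := exists_dualBasis (R := A) (M := P)
  let ev (p : P) : (P →ₗ[A] A) →ₗ[k] Aᵐᵒᵖ :=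
    { toFun := fun h => op (h p), map_add' := fun _ _ => rfl, map_smul' := fun _ _ => rfl }
  have key (t : Fin n) (s : Fin m) (z : B ⊗[k] Aᵐᵒᵖ) (w : V ⊗[k] (P →ₗ[A] A)) :
      TensorProduct.map ((f t).restrictScalars k) (ev (y s)) (z • w) =
        z * TensorProduct.map ((f t).restrictScalars k) (ev (y s)) w := by
    induction z with
    | zero =>
      refine Eq.trans ?_ (zero_mul _).symm
      exact (congrArg _ (zero_smul (B ⊗[k] Aᵐᵒᵖ) w)).trans (map_zero _)
    | add z z' h h' => rw [add_smul, map_add, h, h', add_mul]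
    | tmul b a =>
      induction w with
      | zero => simp
      | add w w' h h' => rw [smul_add, map_add, h, h', map_add, mul_add]
      | tmul v h =>
        rw [TensorProduct.Algebra.smul_def, op_smul_tmul, TensorProduct.smul_tmul',
          TensorProduct.map_tmul, TensorProduct.map_tmul, Algebra.TensorProduct.tmul_mul_tmul]
        congr 1
        simp
  refine finite_and_projective_of_dualBasis
    (fun ts : Fin n × Fin m => ({
      toFun := TensorProduct.map ((f ts.1).restrictScalars k) (ev (y ts.2))
      map_add' := map_add _
      map_smul' := key ts.1 ts.2 } : _ →ₗ[B ⊗[k] Aᵐᵒᵖ] _))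
    (fun ts => x ts.1 ⊗ₜ g ts.2) fun w => ?_
  induction w with
  | zero =>
    refine Finset.sum_eq_zero fun ts _ => ?_
    rw [map_zero]
    exact zero_smul (B ⊗[k] Aᵐᵒᵖ) (x ts.1 ⊗ₜ[k] g ts.2)
  | add w w' h h' =>
    simp only [map_add, add_smul, Finset.sum_add_distrib, h, h']
  | tmul v h =>
    have h1 : ∑ s, op (h (y s)) • g s = h := by
      ext p
      conv_rhs => rw [← hg p, map_sum]
      simp
    conv_rhs => rw [← hf v, ← h1, TensorProduct.sum_tmul]
    rw [Fintype.sum_prod_type]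
    refine Finset.sum_congr rfl fun t _ => ?_
    rw [TensorProduct.tmul_sum]
    refine Finset.sum_congr rfl fun s _ => ?_
    rfl

end Bimodule

section TensorIso

attribute [local instance] rightModule

variable {k : Type*} [Field k] {A B : Type t} [Ring A] [Ring B] [Algebra k A] [Algebra k B]

/-- The morphism `p ↦ h(p) m`, for `h` in `Hom_A(P, A)`. -/
def rankOne (P : FGModuleCat.{t} A) {M : FGModuleCat.{t} A} (m : M) :
    (P →ₗ[A] A) →ₗ[k] (P ⟶ M) where
  toFun h := ObjectProperty.homMk (ModuleCat.ofHom (LinearMap.toSpanSingleton A M m ∘ₗ h))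
  map_add' h h' := FGModuleCat.hom_ext (LinearMap.ext fun p => add_smul (h p) (h' p) m)
  map_smul' a h := FGModuleCat.hom_ext (LinearMap.ext fun p => smul_assoc a (h p) m)

variable (k) in
/-- The map `(v ⊗ h) ⊗ m ↦ v ⊗ (p ↦ h(p) m)`. -/
def rankOneHom (V : FGModuleCat.{t} B) (P M : FGModuleCat.{t} A) :
    (V ⊗[k] (P →ₗ[A] A)) ⊗[ℤ] M →+ V ⊗[k] (P ⟶ M) :=
  TensorProduct.liftAddHom
    (AddMonoidHom.mk' (fun x => AddMonoidHom.mk' (fun m : M => (rankOne P m).lTensor V x)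
      fun m m' => by
        have : rankOne (k := k) P (m + m') = rankOne P m + rankOne P m' :=
          LinearMap.ext fun h => FGModuleCat.hom_ext (LinearMap.ext fun p => smul_add (h p) m m')
        rw [this, LinearMap.lTensor_add, LinearMap.add_apply])
      fun x y => AddMonoidHom.ext fun m => map_add ((rankOne P m).lTensor V) x y)
    fun a x m => by
      rw [map_zsmul, map_zsmul]
      rfl

lemma rankOneHom_tmul (V : FGModuleCat.{t} B) (P M : FGModuleCat.{t} A) (v : V) (h : P →ₗ[A] A)
    (m : M) : rankOneHom k V P M ((v ⊗ₜ h) ⊗ₜ m) = v ⊗ₜ rankOne (k := k) P m h := rfl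

lemma rankOneHom_op_smul (V : FGModuleCat.{t} B) (P M : FGModuleCat.{t} A)
    (x : V ⊗[k] (P →ₗ[A] A)) (a : A) (m : M) :
    rankOneHom k V P M ((op a • x) ⊗ₜ m) = rankOneHom k V P M (x ⊗ₜ (a • m)) := by
  induction x with
  | zero => rw [smul_zero, TensorProduct.zero_tmul, TensorProduct.zero_tmul]
  | add x y hx hy =>
    rw [smul_add, TensorProduct.add_tmul, TensorProduct.add_tmul, map_add, map_add, hx, hy]
  | tmul v h =>
    rw [op_smul_tmul, rankOneHom_tmul, rankOneHom_tmul]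
    congr 1
    exact FGModuleCat.hom_ext (LinearMap.ext fun p => mul_smul (h p) a m)

variable (Φ : FGModuleCat.{t} A ⥤ FGModuleCat.{t} B) [Φ.Additive] [Φ.Linear k]
  {V : FGModuleCat.{t} B} {P : FGModuleCat.{t} A} (c : V ⟶ Φ.obj P)

lemma evalMap_smul (M : FGModuleCat.{t} A) (b : B) (x : V ⊗[k] (P ⟶ M)) :
    evalMap (k := k) Φ c M (b • x) = b • evalMap (k := k) Φ c M x := by
  induction x with
  | zero => rw [smul_zero, map_zero, smul_zero]
  | add x y hx hy => rw [smul_add, map_add, hx, hy, map_add, smul_add]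
  | tmul v h =>
    rw [TensorProduct.smul_tmul', evalMap_tmul, evalMap_tmul, map_smul, map_smul]

lemma rankOneHom_smul (V : FGModuleCat.{t} B) (P M : FGModuleCat.{t} A) (b : B)
    (x : (V ⊗[k] (P →ₗ[A] A)) ⊗[ℤ] M) :
    rankOneHom k V P M (b • x) = b • rankOneHom k V P M x := by
  induction x with
  | zero => rw [smul_zero, map_zero, smul_zero]
  | add x y hx hy => rw [smul_add, map_add, hx, hy, map_add, smul_add]
  | tmul x m =>
    induction x with
    | zero => rw [TensorProduct.zero_tmul, smul_zero, map_zero, smul_zero]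
    | add x y hx hy => rw [TensorProduct.add_tmul, smul_add, map_add, hx, hy, map_add, smul_add]
    | tmul v h =>
      rw [TensorProduct.smul_tmul', TensorProduct.smul_tmul', rankOneHom_tmul, rankOneHom_tmul,
        TensorProduct.smul_tmul']

/-- The map `(v ⊗ h) ⊗ m ↦ Φ(p ↦ h(p) m)(c(v))`. -/
def tensorToFunctor (M : FGModuleCat.{t} A) :
    (tensorFunctor A B (V ⊗[k] (P →ₗ[A] A))).obj M.obj →ₗ[B] Φ.obj M :=
  Submodule.liftQ _
    { toFun := fun x => evalMap Φ c M (rankOneHom k V P M x)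
      map_add' := fun x y => by rw [map_add, map_add]
      map_smul' := fun b x => by rw [rankOneHom_smul, evalMap_smul, RingHom.id_apply] } (by
    rw [balancedRel, Submodule.span_le]
    rintro _ ⟨x, a, m, rfl⟩
    refine LinearMap.mem_ker.2 ?_
    change evalMap Φ c M (rankOneHom k V P M _) = 0
    rw [map_sub, rankOneHom_op_smul, sub_self, map_zero])

lemma tensorToFunctor_mk (M : FGModuleCat.{t} A) (x : (V ⊗[k] (P →ₗ[A] A)) ⊗[ℤ] M) :
    tensorToFunctor Φ c M (Submodule.Quotient.mk x) = evalMap Φ c M (rankOneHom k V P M x) := rfl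

/-- The map is evaluation preceded by the canonical `Hom_A(P, A) ⊗_A M → Hom_A(P, M)`, tensored with
`V`. For finitely generated projective `P` a dual basis provides the inverse `q` of that map. -/
lemma bijective_tensorToFunctor [Module.Projective A P] (M : FGModuleCat.{t} A)
    (h : Function.Bijective (evalMap (k := k) Φ c M)) :
    Function.Bijective (tensorToFunctor (k := k) Φ c M) := by
  obtain ⟨m, g, y, hg⟩ := exists_dualBasis (R := A) (M := P)
  let ρ := (balancedRel A B (V ⊗[k] (P →ₗ[A] A)) M).mkQ
  have hρ (x : V ⊗[k] (P →ₗ[A] A)) (a : A) (z : M) : ρ (x ⊗ₜ (a • z)) = ρ ((op a • x) ⊗ₜ z) :=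
    ((Submodule.Quotient.eq (balancedRel A B _ M)).2
      (Submodule.subset_span ⟨x, a, z, rfl⟩)).symm
  let q : V ⊗[k] (P ⟶ M) →+ ((V ⊗[k] (P →ₗ[A] A)) ⊗[ℤ] M) ⧸ balancedRel A B _ M :=
    TensorProduct.liftAddHom
      (AddMonoidHom.mk' (fun v : V => AddMonoidHom.mk' (fun f : P ⟶ M =>
        ∑ s, ρ ((v ⊗ₜ g s) ⊗ₜ f.hom.hom (y s))) fun f f' => by
          rw [← Finset.sum_add_distrib]
          refine Finset.sum_congr rfl fun s _ => ?_
          rw [← map_add, ← TensorProduct.tmul_add]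
          rfl) fun v v' => AddMonoidHom.ext fun f => by
        simp only [AddMonoidHom.mk'_apply, AddMonoidHom.add_apply]
        rw [← Finset.sum_add_distrib]
        refine Finset.sum_congr rfl fun s _ => ?_
        rw [TensorProduct.add_tmul, TensorProduct.add_tmul, map_add]) fun a v f => by
      simp only [AddMonoidHom.mk'_apply]
      refine Finset.sum_congr rfl fun s _ => ?_
      have h1 : (a • f).hom.hom (y s) = algebraMap k A a • f.hom.hom (y s) := rfl
      have h2 : op (algebraMap k A a) • g s = a • g s := LinearMap.ext fun p => by
        rw [LinearMap.smul_apply, LinearMap.smul_apply, op_smul_eq_mul, Algebra.smul_def,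
          Algebra.commutes]
      rw [h1, hρ, op_smul_tmul, h2, TensorProduct.smul_tmul]
  have hq : ∀ x, q (rankOneHom k V P M x) = ρ x := by
    intro x
    induction x with
    | zero => rw [map_zero, map_zero, map_zero]
    | add x y hx hy => rw [map_add, map_add, hx, hy, map_add]
    | tmul x z =>
      induction x with
      | zero => rw [TensorProduct.zero_tmul, map_zero, map_zero, map_zero]
      | add x y hx hy => rw [TensorProduct.add_tmul, map_add, map_add, hx, hy, map_add]
      | tmul v h =>
        have h1 : ∑ s, op (h (y s)) • g s = h := by
          ext p
          conv_rhs => rw [← hg p, map_sum]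
          simp
        change ∑ s, ρ ((v ⊗ₜ g s) ⊗ₜ (h (y s) • z)) = _
        conv_rhs => rw [← h1, TensorProduct.tmul_sum, TensorProduct.sum_tmul, map_sum]
        exact Finset.sum_congr rfl fun s _ => hρ _ _ _
  have hs : Function.Surjective (rankOneHom k V P M) := by
    intro x
    induction x with
    | zero => exact ⟨0, map_zero _⟩
    | add x y hx hy =>
      obtain ⟨x, rfl⟩ := hx
      obtain ⟨y, rfl⟩ := hy
      exact ⟨x + y, map_add _ _ _⟩
    | tmul v f =>
      refine ⟨∑ s, (v ⊗ₜ g s) ⊗ₜ f.hom.hom (y s), ?_⟩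
      rw [map_sum]
      simp only [rankOneHom_tmul]
      rw [← TensorProduct.tmul_sum]
      congr 1
      refine FGModuleCat.hom_ext (LinearMap.ext fun p => ?_)
      let ev : (P ⟶ M) →+ M := AddMonoidHom.mk' (fun f => f.hom.hom p) fun _ _ => rfl
      refine (map_sum ev _ _).trans ?_
      conv_rhs => rw [← hg p, map_sum]
      exact Finset.sum_congr rfl fun s _ => (f.hom.hom.map_smul _ _).symm
  refine ⟨?_, fun x => ?_⟩
  · rw [injective_iff_map_eq_zero]
    intro x hx
    obtain ⟨x, rfl⟩ := Submodule.Quotient.mk_surjective _ x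
    rw [tensorToFunctor_mk] at hx
    have h1 := h.injective (hx.trans (map_zero _).symm)
    exact (hq x).symm.trans ((congrArg q h1).trans (map_zero q))
  · obtain ⟨z, rfl⟩ := h.surjective x
    obtain ⟨x, rfl⟩ := hs z
    exact ⟨Submodule.Quotient.mk x, rfl⟩

lemma tensorToFunctor_naturality {M N : FGModuleCat.{t} A} (f : M ⟶ N)
    (x : (tensorFunctor A B (V ⊗[k] (P →ₗ[A] A))).obj M.obj) :
    tensorToFunctor Φ c N (((tensorFunctor A B _).map f.hom).hom x) =
      (Φ.map f).hom.hom (tensorToFunctor (k := k) Φ c M x) := by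
  obtain ⟨x, rfl⟩ := Submodule.Quotient.mk_surjective _ x
  change evalMap Φ c N (rankOneHom k V P N (TensorProduct.AlgebraTensorModule.lTensor B
      (V ⊗[k] (P →ₗ[A] A)) (f.hom.hom.toAddMonoidHom.toIntLinearMap) x)) =
    (Φ.map f).hom.hom (evalMap Φ c M (rankOneHom k V P M x))
  induction x with
  | zero => simp only [map_zero]
  | add x y hx hy => simp only [map_add, hx, hy]
  | tmul x m =>
    induction x with
    | zero => simp only [TensorProduct.zero_tmul, map_zero]
    | add x y hx hy => simp only [TensorProduct.add_tmul, map_add, hx, hy]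
    | tmul v h =>
      change (Φ.map (rankOne (k := k) P (f.hom.hom m) h)).hom.hom (c.hom.hom v) =
        (Φ.map f).hom.hom ((Φ.map (rankOne (k := k) P m h)).hom.hom (c.hom.hom v))
      have h1 : rankOne (k := k) P (f.hom.hom m) h = rankOne (k := k) P m h ≫ f :=
        FGModuleCat.hom_ext (LinearMap.ext fun p => (f.hom.hom.map_smul (h p) m).symm)
      rw [h1, Φ.map_comp]
      rfl

/-- A functor represented by evaluations on a projective object is a projective functor. -/
lemma isProjectiveFunctor_of_bijective [Module.Projective A P] [Module.Projective B V]
    (h : ∀ M, Function.Bijective (evalMap (k := k) Φ c M)) : IsProjectiveFunctor k Φ := by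
  refine ⟨V ⊗[k] (P →ₗ[A] A), inferInstance, inferInstance, inferInstance, inferInstance,
    inferInstance, inferInstance, inferInstance, isProjectiveBimodule, ⟨Iso.symm ?_⟩⟩
  refine NatIso.ofComponents (fun M => (LinearEquiv.ofBijective (tensorToFunctor (k := k) Φ c M)
    (bijective_tensorToFunctor Φ c M (h M))).toModuleIso) fun {M N} f => ?_
  exact ModuleCat.hom_ext (LinearMap.ext fun x => tensorToFunctor_naturality Φ c f x)

end TensorIso

end ProjectiveFunctors

/-! ### A criterion for projective functors. -/

section ProjectiveFunctorCriterion

open scoped TensorProduct ModuleCat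

lemma FGModuleCat.moduleProjective {A : Type t} [Ring A] (P : FGModuleCat.{t} A) [Projective P] :
    Module.Projective A P := by
  obtain ⟨n, s, hs⟩ := Module.Finite.exists_fin' A P
  let s' : FGModuleCat.of A (Fin n → A) ⟶ P := FGModuleCat.ofHom s
  have : Epi s' := FGModuleCat.epi_of_surjective _ hs
  exact Module.Projective.of_split (Projective.factorThru (𝟙 P) s').hom.hom s
    (congrArg (fun t => t.hom.hom) (Projective.factorThru_comp (𝟙 P) s'))

variable {k : Type*} [Field k] {D : Type*} [Category* D] [Abelian D] [Linear k D] {A B : Type t}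
  [Ring A] [Algebra k A] [Ring B] [Algebra k B]

lemma bijective_evalMap_inv (E : D ⥤ FGModuleCat.{t} A) [E.IsEquivalence] [E.Additive] [E.Linear k]
    (Ψ : D ⥤ FGModuleCat.{t} B) [Ψ.Additive] [Ψ.Linear k] [E.inv.Additive] [E.inv.Linear k]
    {V : FGModuleCat.{t} B} {P : D} (c : V ⟶ Ψ.obj P)
    (h : ∀ M, Function.Bijective (evalMap (k := k) Ψ c M)) {P' : FGModuleCat.{t} A}
    (u : P ≅ E.inv.obj P') (N : FGModuleCat.{t} A) :
    Function.Bijective (evalMap (k := k) (P := P') (E.inv ⋙ Ψ) (c ≫ Ψ.map u.hom) N) := by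
  let f : (P' ⟶ N) →ₗ[k] (P ⟶ E.inv.obj N) := Linear.leftComp k _ u.hom ∘ₗ E.inv.mapLinearMap k
  have hf : Function.Bijective f := by
    refine ⟨fun a b hab => ?_, fun a => ⟨E.inv.preimage (u.inv ≫ a), ?_⟩⟩
    · exact E.inv.map_injective ((cancel_epi u.hom).1 hab)
    · change u.hom ≫ E.inv.map (E.inv.preimage (u.inv ≫ a)) = a
      rw [E.inv.map_preimage, Iso.hom_inv_id_assoc]
  have h1 : evalMap (k := k) (P := P') (E.inv ⋙ Ψ) (c ≫ Ψ.map u.hom) N =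
      evalMap (k := k) Ψ c (E.inv.obj N) ∘ₗ f.lTensor V := by
    refine TensorProduct.ext' fun v g => ?_
    change (Ψ.map (E.inv.map g)).hom.hom ((Ψ.map u.hom).hom.hom (c.hom.hom v)) =
      (Ψ.map (u.hom ≫ E.inv.map g)).hom.hom (c.hom.hom v)
    rw [Ψ.map_comp]
    rfl
  rw [h1]
  exact (h _).comp ((LinearEquiv.ofBijective f hf).lTensor V).bijective

variable [IsNoetherianRing B]

/-- An exact functor with projective values which annihilates all simple objects but the top of an
indecomposable projective object is a projective functor. -/
lemma isProjectiveFunctor_of_isHollow {X : D} (hX : IsProjGenerator k X)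
    (E : D ⥤ FGModuleCat.{t} A) [E.IsEquivalence] [E.Additive] [E.Linear k]
    (Ψ : D ⥤ FGModuleCat.{t} B) [Ψ.Additive] [Ψ.Linear k] [PreservesFiniteLimits Ψ]
    [PreservesFiniteColimits Ψ] {P S₀ : D} [Projective P] (hP : IsHollow P) [Simple S₀] {π : P ⟶ S₀}
    (hπ : π ≠ 0) (hπ' : ∀ φ : P ⟶ S₀, ∃ a : k, φ = a • π)
    (h₀ : ∀ S, Simple S → (∀ f : P ⟶ S, f = 0) → IsZero (Ψ.obj S))
    (h₁ : Projective (Ψ.obj S₀)) : IsProjectiveFunctor k (E.inv ⋙ Ψ) := by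
  have : E.asEquivalence.functor.Additive := inferInstanceAs E.Additive
  have : E.inv.Additive := inferInstanceAs E.asEquivalence.inverse.Additive
  have : E.asEquivalence.functor.Linear k := inferInstanceAs (E.Linear k)
  have : E.inv.Linear k := inferInstanceAs (E.asEquivalence.inverse.Linear k)
  have := epi_of_nonzero_to_simple hπ
  have : Epi (Ψ.map π) := inferInstance
  have : Projective (E.obj P) := (E.asEquivalence.map_projective_iff P).2 inferInstance
  have := FGModuleCat.moduleProjective (E.obj P)
  have := FGModuleCat.moduleProjective (Ψ.obj S₀)
  -- The section of `Ψ π` exists because `Ψ S₀` is projective.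
  have h := bijective_evalMap Ψ hX hP hπ hπ' h₀ _ (Projective.factorThru_comp (𝟙 _) (Ψ.map π))
  exact isProjectiveFunctor_of_bijective (P := E.obj P) _ _
    (bijective_evalMap_inv E Ψ _ h (E.asEquivalence.unitIso.app P))

end ProjectiveFunctorCriterion

/-! ### Elements of the two-sided cell act by projective functors. -/

section CellProjective

variable {k : Type*} [Field k] {C : Type u} [Bicategory.{w, v} C]
  [∀ i j : C, Preadditive (i ⟶ j)] [∀ i j : C, Linear k (i ⟶ j)]
  [∀ i j : C, HasFiniteBiproducts (i ⟶ j)] [BiadditiveComp C]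

omit [∀ i j : C, HasFiniteBiproducts (i ⟶ j)] in
lemma prinMap_map_smul
    (h : ∀ {i j l : C} {F G : i ⟶ j} (c : k) (η : F ⟶ G) (H : j ⟶ l), (c • η) ▷ H = c • (η ▷ H))
    (i : C) {j l : C} (F : j ⟶ l) {X Y : RightFreyd (i ⟶ j)} (c : k) (f : X ⟶ Y) :
    (prinMap i F).map (c • f) = c • (prinMap i F).map f := by
  obtain ⟨f, rfl⟩ := (RightFreyd.quotient _).map_surjective f
  exact RightFreyd.quotient_congr (h _ _ _) (h _ _ _)

lemma IsFinitary.linear_cellMap (hC : IsFinitary k C) {R : Set (OneMor C)} {i : C}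
    [(cellProp R i).IsClosedUnderMapObj] {j l : C} (F : j ⟶ l) : (cellMap R i F).Linear k where
  map_smul f c := ObjectProperty.hom_ext _ (prinMap_map_smul hC.smul_whiskerRight i F c f.hom)

variable [∀ i j : C, IsAbelianCat (RightFreyd (i ⟶ j))] [HasExactAction C]
  {τ : Involution C} {Q R : Set (OneMor C)} {i : C}
  (d : CellTopData R i (cellTop R i)) (hs : CellSetup k τ Q R i)
  [(cellProp R i).IsClosedUnderMapObj] [∀ j, IsAbelianCat (CellCat R i j)]

include d hs in
/-- The elements of the two-sided cell act by projective functors. -/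
lemma CellTopData.isProjectiveFunctor [IsAlgClosed k] {A : C → Type t}
    [∀ j, Ring (A j)] [∀ j, Algebra k (A j)] [∀ j, FiniteDimensional k (A j)]
    (E : ∀ j, CellCat R i j ⥤ FGModuleCat.{t} (A j)) [∀ j, (E j).IsEquivalence]
    [∀ j, (E j).Additive] [∀ j, (E j).Linear k] {j l : C} {F : j ⟶ l} (hF : ⟨j, l, F⟩ ∈ Q) :
    IsProjectiveFunctor k ((E j).inv ⋙ cellMap R i F ⋙ E l) := by
  have (j : C) : IsNoetherianRing (A j) := IsNoetherianRing.of_finite k (A j)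
  have := hs.fin.linear_cellMap (R := R) (i := i) F
  have := d.preservesFiniteLimits_cellMap hs F
  have := d.preservesFiniteColimits_cellMap hs F
  obtain ⟨Y, hY, h₀⟩ := d.exists_cell_source hs hF
  obtain ⟨X, hX, -⟩ := d.exists_projGenerator hs j
  have := d.projective_cellGen hs hY
  have hh := d.isHollow_cellGen hs hY
  obtain ⟨S, π, hS, hπ⟩ := hX.exists_simple_quotient hh.not_isZero
  have hπ0 : π ≠ 0 := epi_ne_zero π (Simple.not_isZero S)
  refine isProjectiveFunctor_of_isHollow hX (E j) (cellMap R i F ⋙ E l) hh hπ0 (fun φ => ?_)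
    (fun S _ h => (E l).map_isZero (h₀ S h))
    (((E l).asEquivalence.map_projective_iff _).2 (d.projective_cellMap hs hF S))
  -- `Y L` is hollow, so `φ` is `π` followed by an endomorphism of its simple top, which is a scalar
  -- by Schur's lemma over an algebraically closed field.
  obtain ⟨b, rfl⟩ := hh.exists_factor hπ0 φ
  have : FiniteDimensional k (S ⟶ S) := by
    have : FiniteDimensional k ((cellObjects R i j).ι.obj S ⟶ (cellObjects R i j).ι.obj S) :=
      hs.fin.finiteDimensional_hom S.obj S.obj
    exact Module.Finite.of_injective ((cellObjects R i j).ι.mapLinearMap k)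
      (cellObjects R i j).ι.map_injective
  obtain ⟨a, rfl⟩ := endomorphism_simple_eq_smul_id k b
  exact ⟨a, by rw [Linear.comp_smul, Category.comp_id]⟩

end CellProjective

/-! ### Building 1- and 2-morphisms of `C_A`. -/

namespace ProjTwoCat

variable {k : Type*} [Field k] {I : Type u} {A : I → Type t} [∀ i, Ring (A i)]
  [∀ i, Algebra k (A i)]

/-- The 1-morphism of `C_A` given by a functor. -/
def homOfFunctor {x y : I} (Φ : FGModuleCat.{t} (A x) ⥤ FGModuleCat.{t} (A y))
    (h : ProjGenerated k A Φ) : obj k A x ⟶ obj k A y :=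
  ⟨InducedBicategory.mkHom (C := Cat.{t, t + 1}) (F := fun i : I => Cat.of (FGModuleCat.{t} (A i)))
    Φ.toCatHom, h⟩

/-- The 2-morphism of `C_A` given by a natural transformation. -/
def homOfNatTrans {a b : ProjTwoCat k A} {f g : a ⟶ b} (η : functor f ⟶ functor g) : f ⟶ g :=
  ObjectProperty.homMk (InducedBicategory.Hom₂.mk (Cat.Hom₂.ofNatTrans η))

/-- The 2-isomorphism of `C_A` given by a natural isomorphism. -/
def isoOfNatIso {a b : ProjTwoCat k A} {f g : a ⟶ b} (e : functor f ≅ functor g) : f ≅ g where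
  hom := homOfNatTrans e.hom
  inv := homOfNatTrans e.inv
  hom_inv_id := congrArg homOfNatTrans e.hom_inv_id
  inv_hom_id := congrArg homOfNatTrans e.inv_hom_id

lemma hom₂_ext {a b : ProjTwoCat k A} {f g : a ⟶ b} {η θ : f ⟶ g}
    (h : ∀ N, (natTrans η).app N = (natTrans θ).app N) : η = θ := by
  refine ObjectProperty.hom_ext _ (InducedBicategory.hom₂_ext (Cat.Hom₂.ext ?_))
  exact NatTrans.ext (funext h)

end ProjTwoCat

/-! ### Coherence of a restricted 2-representation, componentwise. -/

section CellActionCoherence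

variable {B : Type*} [Bicategory B] {F : Pseudofunctor B Cat} (P : F.ObjectProperty)
  [P.IsClosedUnderMapObj]

lemma map₂_whiskerLeft_app {a b c : B} (f : a ⟶ b) {g h : b ⟶ c} (η : g ⟶ h) (X : P.Obj a) :
    (P.map₂ (f ◁ η)).app X = (P.mapComp f g).hom.app X ≫
      (P.map₂ η).app ((P.map f).obj X) ≫ (P.mapComp f h).inv.app X :=
  congrArg (fun t => t.toNatTrans.app X) (P.fullsubcategory.map₂_whisker_left f η)

lemma map₂_whiskerRight_app {a b c : B} {f g : a ⟶ b} (η : f ⟶ g) (h : b ⟶ c) (X : P.Obj a) :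
    (P.map₂ (η ▷ h)).app X = (P.mapComp f h).hom.app X ≫
      (P.map h).map ((P.map₂ η).app X) ≫ (P.mapComp g h).inv.app X :=
  congrArg (fun t => t.toNatTrans.app X) (P.fullsubcategory.map₂_whisker_right η h)

lemma map₂_associator_app {a b c d : B} (f : a ⟶ b) (g : b ⟶ c) (h : c ⟶ d) (X : P.Obj a) :
    (P.map₂ (α_ f g h).hom).app X = (P.mapComp (f ≫ g) h).hom.app X ≫
      (P.map h).map ((P.mapComp f g).hom.app X) ≫ (P.mapComp g h).inv.app ((P.map f).obj X) ≫
        (P.mapComp f (g ≫ h)).inv.app X := by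
  refine (congrArg (fun t => t.toNatTrans.app X)
    (P.fullsubcategory.map₂_associator f g h)).trans ?_
  change _ ≫ _ ≫ 𝟙 _ ≫ _ = _
  rw [Category.id_comp]
  rfl

lemma map₂_leftUnitor_app {a b : B} (f : a ⟶ b) (X : P.Obj a) :
    (P.map₂ (λ_ f).hom).app X = (P.mapComp (𝟙 a) f).hom.app X ≫
      (P.map f).map ((P.mapId a).hom.app X) := by
  refine (congrArg (fun t => t.toNatTrans.app X) (P.fullsubcategory.map₂_left_unitor f)).trans ?_
  change _ ≫ _ ≫ 𝟙 _ = _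
  rw [Category.comp_id]
  rfl

lemma map₂_rightUnitor_app {a b : B} (f : a ⟶ b) (X : P.Obj a) :
    (P.map₂ (ρ_ f).hom).app X = (P.mapComp f (𝟙 b)).hom.app X ≫
      (P.mapId b).hom.app ((P.map f).obj X) := by
  refine (congrArg (fun t => t.toNatTrans.app X) (P.fullsubcategory.map₂_right_unitor f)).trans ?_
  change _ ≫ _ ≫ 𝟙 _ = _
  rw [Category.comp_id]
  rfl

end CellActionCoherence

/-! ### The 2-ideal of the cell acts by zero. -/

section CellQuotientAction

variable {k : Type*} [Field k] {C : Type u} [Bicategory.{w, v} C]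
  [∀ i j : C, Preadditive (i ⟶ j)] [∀ i j : C, Linear k (i ⟶ j)]
  [∀ i j : C, HasFiniteBiproducts (i ⟶ j)] [BiadditiveComp C]

section

variable (R : Set (OneMor C)) (i : C) [(cellProp R i).IsClosedUnderMapObj]

/-- The functors by which the 1-morphisms act on the cell 2-representation. -/
def cellAct (j l : C) : (j ⟶ l) ⥤ (CellCat R i j ⥤ CellCat R i l) where
  obj F := cellMap R i F
  map α := (cellProp R i).map₂ α
  map_id F := NatTrans.ext (funext fun M => ObjectProperty.hom_ext _ ((actOn M.obj l).map_id F))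
  map_comp α β := NatTrans.ext (funext fun M =>
    ObjectProperty.hom_ext _ ((actOn M.obj l).map_comp α β))

instance (j l : C) : (cellAct R i j l).Additive where
  map_add {F G α β} := NatTrans.ext (funext fun M =>
    ObjectProperty.hom_ext _ ((actOn M.obj l).map_add (f := α) (g := β)))

end

variable [∀ i j : C, IsAbelianCat (RightFreyd (i ⟶ j))] [HasExactAction C]
  {τ : Involution C} {Q R : Set (OneMor C)} {i : C}

namespace CellTopData

variable (d : CellTopData R i (cellTop R i)) (hs : CellSetup k τ Q R i)
  [(cellProp R i).IsClosedUnderMapObj] [∀ j, IsAbelianCat (CellCat R i j)]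

include d hs

/-- If `H M ≠ 0`, some `Y ∈ R` is a summand of `H* X` with `X ∈ R`; then `H ≤_LR H* ≤_LR Y`, so `H
≤_LR Q`. -/
lemma isZero_cellMap_of_not_leCell {j l : C} {H : j ⟶ l} (hH : ¬ LeCell H Q) (M : CellCat R i j) :
    IsZero ((cellMap R i H).obj M) := by
  refine d.isZero_cellMap hs H fun X hX Y hY r => absurd ⟨_, hs.sub hY, ?_⟩ hH
  have h1 := hs.leLR_star (OneMor.star τ ⟨j, l, H⟩)
  have h2 := (OneMor.star_star_isom (τ := τ) ⟨j, l, H⟩).symm.leR.leLR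
  exact (h2.trans h1).trans (OneMor.LeL.mk _ X Y r).leLR

lemma cellAct_map_eq_zero {j l : C} {F G : j ⟶ l} {η : F ⟶ G}
    (hη : η ∈ (cellIdeal Q).carrier F G) : (cellAct R i j l).map η = 0 := by
  induction hη using AddSubgroup.closure_induction with
  | mem x hx =>
    obtain ⟨H, α, β, hH, rfl⟩ := hx
    rw [CategoryTheory.Functor.map_comp]
    have h : (cellAct R i j l).map α = 0 := NatTrans.ext (funext fun M =>
      (d.isZero_cellMap_of_not_leCell hs hH M).eq_zero_of_tgt _)
    rw [h, zero_comp]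
  | zero => exact Functor.map_zero _ _ _
  | add x y _ _ hx hy => rw [Functor.map_add, hx, hy, add_zero]
  | neg x _ hx => rw [Functor.map_neg, hx, neg_zero]

end CellTopData

end CellQuotientAction

/-! ### Transport of the action to module categories. -/

section Conjugate

variable {C : Type u} [Bicategory.{w, v} C] [∀ i j : C, Preadditive (i ⟶ j)]
  [∀ i j : C, HasFiniteBiproducts (i ⟶ j)] [BiadditiveComp C]
  {R : Set (OneMor C)} {i : C}
  {A : C → Type t} [∀ j, Ring (A j)]
  (E : ∀ j, CellCat R i j ⥤ FGModuleCat.{t} (A j)) [∀ j, (E j).IsEquivalence]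

/-- The unit `M ≅ E⁻¹(E(M))`. -/
def eqvUnit {j : C} (M : CellCat R i j) : M ≅ (E j).inv.obj ((E j).obj M) :=
  (E j).asEquivalence.unitIso.app M

/-- The counit `E(E⁻¹(N)) ≅ N`. -/
def eqvCounit {j : C} (N : FGModuleCat.{t} (A j)) : (E j).obj ((E j).inv.obj N) ≅ N :=
  (E j).asEquivalence.counitIso.app N

lemma eqvUnit_naturality {j : C} {M N : CellCat R i j} (f : M ⟶ N) :
    (eqvUnit E M).hom ≫ (E j).inv.map ((E j).map f) = f ≫ (eqvUnit E N).hom :=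
  ((E j).asEquivalence.unitIso.hom.naturality f).symm

lemma eqvCounit_naturality {j : C} {M N : FGModuleCat.{t} (A j)} (f : M ⟶ N) :
    (E j).map ((E j).inv.map f) ≫ (eqvCounit E N).hom = (eqvCounit E M).hom ≫ f :=
  (E j).asEquivalence.counitIso.hom.naturality f

lemma map_eqvUnit_eqvCounit {j : C} (M : CellCat R i j) :
    (E j).map (eqvUnit E M).hom ≫ (eqvCounit E ((E j).obj M)).hom = 𝟙 _ :=
  (E j).asEquivalence.functor_unitIso_comp M

lemma eqvUnit_map_eqvCounit {j : C} (N : FGModuleCat.{t} (A j)) :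
    (eqvUnit E ((E j).inv.obj N)).hom ≫ (E j).inv.map (eqvCounit E N).hom = 𝟙 _ :=
  (E j).asEquivalence.unit_inverse_comp N

variable [(cellProp R i).IsClosedUnderMapObj]

/-- The action of a 1-morphism on the cell 2-representation, transported along the equivalences
with the categories of modules. -/
abbrev conjMap {j l : C} (F : j ⟶ l) : FGModuleCat.{t} (A j) ⥤ FGModuleCat.{t} (A l) :=
  (E j).inv ⋙ cellMap R i F ⋙ E l

/-- The action of the identity. -/
def conjId (j : C) : conjMap E (𝟙 j) ≅ 𝟭 (FGModuleCat.{t} (A j)) :=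
  NatIso.ofComponents (fun N =>
    (E j).mapIso (((cellProp R i).mapId j).app ((E j).inv.obj N)) ≪≫ eqvCounit E N) fun {M N} f => by
      have h := ((cellProp R i).mapId j).hom.naturality ((E j).inv.map f)
      have h' := ((E j).map_comp _ _).symm.trans ((congrArg (E j).map h).trans ((E j).map_comp _ _))
      refine (Category.assoc _ _ _).symm.trans ((congrArg (· ≫ _) h').trans ?_)
      refine (Category.assoc _ _ _).trans ?_
      refine (congrArg (_ ≫ ·) (eqvCounit_naturality E f)).trans ?_
      exact (Category.assoc _ _ _).symm

/-- The action of a composite. -/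
def conjComp {j l m : C} (F : j ⟶ l) (G : l ⟶ m) :
    conjMap E (F ≫ G) ≅ conjMap E F ⋙ conjMap E G :=
  NatIso.ofComponents (fun N =>
    (E m).mapIso (((cellProp R i).mapComp F G).app ((E j).inv.obj N) ≪≫
      (cellMap R i G).mapIso (eqvUnit E ((cellMap R i F).obj ((E j).inv.obj N))))) fun {M N} f => by
    have h := ((cellProp R i).mapComp F G).hom.naturality ((E j).inv.map f)
    refine ((E m).map_comp _ _).symm.trans (Eq.trans (congrArg (E m).map ?_) ((E m).map_comp _ _))
    refine (Category.assoc _ _ _).symm.trans ((congrArg (· ≫ _) h).trans ?_)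
    refine (Category.assoc _ _ _).trans (Eq.trans (congrArg (_ ≫ ·) ?_) (Category.assoc _ _ _).symm)
    refine ((cellMap R i G).map_comp _ _).symm.trans
      (Eq.trans (congrArg (cellMap R i G).map ?_) ((cellMap R i G).map_comp _ _))
    exact (eqvUnit_naturality E _).symm

/-- The comparison of the action on the cell 2-representation with its transport. -/
def conjUnit {j l : C} (F : j ⟶ l) : cellMap R i F ⋙ E l ≅ E j ⋙ conjMap E F :=
  NatIso.ofComponents (fun M => (E l).mapIso ((cellMap R i F).mapIso (eqvUnit E M))) fun f => by
    refine ((E l).map_comp _ _).symm.trans (Eq.trans (congrArg (E l).map ?_) ((E l).map_comp _ _))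
    refine ((cellMap R i F).map_comp _ _).symm.trans
      (Eq.trans (congrArg (cellMap R i F).map ?_) ((cellMap R i F).map_comp _ _))
    exact (eqvUnit_naturality E f).symm

end Conjugate

/-! ### Coherence of the transported action. -/

section ConjugateCoherence

variable {C : Type u} [Bicategory.{w, v} C] [∀ i j : C, Preadditive (i ⟶ j)]
  [∀ i j : C, HasFiniteBiproducts (i ⟶ j)] [BiadditiveComp C]

section Components

variable (R : Set (OneMor C)) (i : C) [(cellProp R i).IsClosedUnderMapObj]

/-- The component of the isomorphism of the action of an identity with the identity. -/
def cellIdApp {j : C} (X : CellCat R i j) : (cellMap R i (𝟙 j)).obj X ≅ X :=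
  ((cellProp R i).mapId j).app X

/-- The component of the isomorphism of the action of a composite with the composite. -/
def cellCompApp {j l m : C} (F : j ⟶ l) (G : l ⟶ m) (X : CellCat R i j) :
    (cellMap R i (F ≫ G)).obj X ≅ (cellMap R i G).obj ((cellMap R i F).obj X) :=
  ((cellProp R i).mapComp F G).app X

/-- The component of the action of a 2-morphism. -/
def cellApp {j l : C} {F G : j ⟶ l} (η : F ⟶ G) (X : CellCat R i j) :
    (cellMap R i F).obj X ⟶ (cellMap R i G).obj X :=
  ((cellProp R i).map₂ η).app X

lemma cellIdApp_naturality {j : C} {X Y : CellCat R i j} (f : X ⟶ Y) :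
    (cellMap R i (𝟙 j)).map f ≫ (cellIdApp R i Y).hom = (cellIdApp R i X).hom ≫ f :=
  ((cellProp R i).mapId j).hom.naturality f

lemma cellCompApp_naturality {j l m : C} (F : j ⟶ l) (G : l ⟶ m) {X Y : CellCat R i j}
    (f : X ⟶ Y) : (cellMap R i (F ≫ G)).map f ≫ (cellCompApp R i F G Y).hom =
      (cellCompApp R i F G X).hom ≫ (cellMap R i G).map ((cellMap R i F).map f) :=
  ((cellProp R i).mapComp F G).hom.naturality f

lemma cellCompApp_naturality_assoc {j l m : C} (F : j ⟶ l) (G : l ⟶ m) {X Y : CellCat R i j}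
    (f : X ⟶ Y) {Z : CellCat R i m}
    (h : (cellMap R i G).obj ((cellMap R i F).obj Y) ⟶ Z) :
    (cellMap R i (F ≫ G)).map f ≫ (cellCompApp R i F G Y).hom ≫ h =
      (cellCompApp R i F G X).hom ≫ (cellMap R i G).map ((cellMap R i F).map f) ≫ h := by
  rw [← Category.assoc, cellCompApp_naturality, Category.assoc]

lemma cellApp_naturality {j l : C} {F G : j ⟶ l} (η : F ⟶ G) {X Y : CellCat R i j} (f : X ⟶ Y) :
    (cellMap R i F).map f ≫ cellApp R i η Y = cellApp R i η X ≫ (cellMap R i G).map f :=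
  ((cellProp R i).map₂ η).naturality f

lemma cellApp_whiskerLeft {a b c : C} (f : a ⟶ b) {g h : b ⟶ c} (η : g ⟶ h)
    (X : CellCat R i a) : cellApp R i (f ◁ η) X ≫ (cellCompApp R i f h X).hom =
      (cellCompApp R i f g X).hom ≫ cellApp R i η ((cellMap R i f).obj X) :=
  (Iso.eq_comp_inv _).1 ((map₂_whiskerLeft_app (cellProp R i) f η X).trans
    (Category.assoc _ _ _).symm)

lemma cellApp_whiskerRight {a b c : C} {f g : a ⟶ b} (η : f ⟶ g) (h : b ⟶ c)
    (X : CellCat R i a) : cellApp R i (η ▷ h) X ≫ (cellCompApp R i g h X).hom =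
      (cellCompApp R i f h X).hom ≫ (cellMap R i h).map (cellApp R i η X) :=
  (Iso.eq_comp_inv _).1 ((map₂_whiskerRight_app (cellProp R i) η h X).trans
    (Category.assoc _ _ _).symm)

lemma cellApp_leftUnitor {a b : C} (f : a ⟶ b) (X : CellCat R i a) :
    cellApp R i (λ_ f).hom X =
      (cellCompApp R i (𝟙 a) f X).hom ≫ (cellMap R i f).map (cellIdApp R i X).hom :=
  map₂_leftUnitor_app (cellProp R i) f X

lemma cellApp_rightUnitor {a b : C} (f : a ⟶ b) (X : CellCat R i a) :
    cellApp R i (ρ_ f).hom X =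
      (cellCompApp R i f (𝟙 b) X).hom ≫ (cellIdApp R i ((cellMap R i f).obj X)).hom :=
  map₂_rightUnitor_app (cellProp R i) f X

lemma cellApp_associator {a b c d : C} (f : a ⟶ b) (g : b ⟶ c) (h : c ⟶ d) (X : CellCat R i a) :
    cellApp R i (α_ f g h).hom X ≫ (cellCompApp R i f (g ≫ h) X).hom ≫
        (cellCompApp R i g h ((cellMap R i f).obj X)).hom =
      (cellCompApp R i (f ≫ g) h X).hom ≫ (cellMap R i h).map (cellCompApp R i f g X).hom := by
  have h₁ : cellApp R i (α_ f g h).hom X = (cellCompApp R i (f ≫ g) h X).hom ≫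
      (cellMap R i h).map (cellCompApp R i f g X).hom ≫
        (cellCompApp R i g h ((cellMap R i f).obj X)).inv ≫ (cellCompApp R i f (g ≫ h) X).inv :=
    map₂_associator_app (cellProp R i) f g h X
  rw [h₁]
  simp

end Components

variable {R : Set (OneMor C)} {i : C} [(cellProp R i).IsClosedUnderMapObj]
  {A : C → Type t} [∀ j, Ring (A j)]
  (E : ∀ j, CellCat R i j ⥤ FGModuleCat.{t} (A j)) [∀ j, (E j).IsEquivalence]

/-- The action of a 2-morphism, transported. -/
def conjApp {j l : C} {F G : j ⟶ l} (η : F ⟶ G) (N : FGModuleCat.{t} (A j)) :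
    (conjMap E F).obj N ⟶ (conjMap E G).obj N :=
  (E l).map (cellApp R i η ((E j).inv.obj N))

lemma conjId_hom_app {j : C} (N : FGModuleCat.{t} (A j)) : (conjId E j).hom.app N =
    (E j).map (cellIdApp R i ((E j).inv.obj N)).hom ≫ (eqvCounit E N).hom :=
  rfl

lemma conjComp_hom_app {j l m : C} (F : j ⟶ l) (G : l ⟶ m) (N : FGModuleCat.{t} (A j)) :
    (conjComp E F G).hom.app N = (E m).map ((cellCompApp R i F G ((E j).inv.obj N)).hom ≫
      (cellMap R i G).map (eqvUnit E ((cellMap R i F).obj ((E j).inv.obj N))).hom) :=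
  rfl

/-- Like its analogues below, this reduces to coherence in the cell 2-representation and naturality
of the unit. The triangle identities of the equivalences are needed only for the unitors. -/
lemma conjApp_whiskerLeft {a b c : C} (f : a ⟶ b) {g h : b ⟶ c} (η : g ⟶ h)
    (N : FGModuleCat.{t} (A a)) : conjApp E (f ◁ η) N ≫ (conjComp E f h).hom.app N =
      (conjComp E f g).hom.app N ≫ conjApp E η ((conjMap E f).obj N) := by
  rw [conjComp_hom_app, conjComp_hom_app, conjApp, conjApp]
  refine ((E c).map_comp _ _).symm.trans (Eq.trans (congrArg (E c).map ?_) ((E c).map_comp _ _))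
  rw [reassoc_of% cellApp_whiskerLeft R i f η, Category.assoc]
  exact congrArg _ (cellApp_naturality R i η _).symm

lemma conjApp_whiskerRight {a b c : C} {f g : a ⟶ b} (η : f ⟶ g) (h : b ⟶ c)
    (N : FGModuleCat.{t} (A a)) : conjApp E (η ▷ h) N ≫ (conjComp E g h).hom.app N =
      (conjComp E f h).hom.app N ≫ (conjMap E h).map (conjApp E η N) := by
  rw [conjComp_hom_app, conjComp_hom_app, conjApp, conjApp]
  refine ((E c).map_comp _ _).symm.trans (Eq.trans (congrArg (E c).map ?_) ((E c).map_comp _ _))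
  rw [reassoc_of% cellApp_whiskerRight R i η h, Category.assoc, ← CategoryTheory.Functor.map_comp,
    ← CategoryTheory.Functor.map_comp, eqvUnit_naturality]

lemma conjApp_leftUnitor {a b : C} (f : a ⟶ b) (N : FGModuleCat.{t} (A a)) :
    conjApp E (λ_ f).hom N =
      (conjComp E (𝟙 a) f).hom.app N ≫ (conjMap E f).map ((conjId E a).hom.app N) := by
  rw [conjComp_hom_app, conjId_hom_app, conjApp]
  refine Eq.trans (congrArg (E b).map ?_) ((E b).map_comp _ _)
  rw [cellApp_leftUnitor, Category.assoc, ← CategoryTheory.Functor.map_comp,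
    CategoryTheory.Functor.map_comp (E a).inv, reassoc_of% eqvUnit_naturality E, eqvUnit_map_eqvCounit,
    Category.comp_id]

lemma conjApp_rightUnitor {a b : C} (f : a ⟶ b) (N : FGModuleCat.{t} (A a)) :
    conjApp E (ρ_ f).hom N =
      (conjComp E f (𝟙 b)).hom.app N ≫ (conjId E b).hom.app ((conjMap E f).obj N) := by
  rw [conjComp_hom_app, conjId_hom_app, conjApp, cellApp_rightUnitor]
  symm
  refine (Category.assoc _ _ _).symm.trans ?_
  refine (congrArg (· ≫ _) (((E b).map_comp _ _).symm.trans (congrArg (E b).map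
    ((Category.assoc _ _ _).trans (congrArg (_ ≫ ·) (cellIdApp_naturality R i _)))))).trans ?_
  rw [← Category.assoc, CategoryTheory.Functor.map_comp, Category.assoc]
  refine (congrArg (_ ≫ ·) (map_eqvUnit_eqvCounit E _)).trans (Category.comp_id _)

lemma conjApp_associator {a b c d : C} (f : a ⟶ b) (g : b ⟶ c) (h : c ⟶ d)
    (N : FGModuleCat.{t} (A a)) :
    conjApp E (α_ f g h).hom N ≫ (conjComp E f (g ≫ h)).hom.app N ≫
        (conjComp E g h).hom.app ((conjMap E f).obj N) =
      (conjComp E (f ≫ g) h).hom.app N ≫ (conjMap E h).map ((conjComp E f g).hom.app N) := by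
  rw [conjComp_hom_app, conjComp_hom_app, conjComp_hom_app, conjComp_hom_app, conjApp]
  refine (congrArg (_ ≫ ·) ((E d).map_comp _ _).symm).trans ?_
  refine ((E d).map_comp _ _).symm.trans (Eq.trans (congrArg (E d).map ?_) ((E d).map_comp _ _))
  rw [Category.assoc, Category.assoc]
  refine (congrArg (_ ≫ _ ≫ ·) (cellCompApp_naturality_assoc R i g h _ _)).trans ?_
  rw [reassoc_of% cellApp_associator R i f g h, ← CategoryTheory.Functor.map_comp,
    ← CategoryTheory.Functor.map_comp, ← CategoryTheory.Functor.map_comp]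
  refine congrArg (_ ≫ (cellMap R i h).map ·) ?_
  exact (Category.assoc _ _ _).symm.trans (eqvUnit_naturality E _).symm

end ConjugateCoherence

/-! ### The induced 2-functor. -/

section Induced

variable {k : Type*} [Field k] {C : Type u} [Bicategory.{w, v} C]
  [∀ i j : C, Preadditive (i ⟶ j)]
  [∀ i j : C, HasFiniteBiproducts (i ⟶ j)] [BiadditiveComp C]
  {Q R : Set (OneMor C)} {i : C} [(cellProp R i).IsClosedUnderMapObj]
  {A : C → Type t} [∀ j, Ring (A j)] [∀ j, Algebra k (A j)]
  (E : ∀ j, CellCat R i j ⥤ FGModuleCat.{t} (A j)) [∀ j, (E j).IsEquivalence]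

/-- The functors by which the 1-morphisms act, transported. -/
def conjAct (j l : C) : (j ⟶ l) ⥤ (FGModuleCat.{t} (A j) ⥤ FGModuleCat.{t} (A l)) :=
  cellAct R i j l ⋙ (Functor.whiskeringRight _ _ _).obj (E l) ⋙
    (Functor.whiskeringLeft _ _ _).obj (E j).inv

instance [∀ j, (E j).Additive] (j l : C) : (conjAct E j l).Additive where
  map_add {F G α β} := by
    refine NatTrans.ext (funext fun N => ?_)
    refine (congrArg (fun η => (E l).map (NatTrans.app η _))
      ((cellAct R i j l).map_add (f := α) (g := β))).trans ?_
    exact (E l).map_add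

variable [∀ j, (E j).Additive]
  (hI : ∀ {j l : C} {F G : j ⟶ l} {η : F ⟶ G}, η ∈ (cellIdeal Q).carrier F G →
    (cellAct R i j l).map η = 0)

include hI in
lemma conjAct_map_eq {j l : C} {F G : j ⟶ l} {η θ : F ⟶ G} (h : (cellIdeal Q).rel j l η θ) :
    (conjAct E j l).map η = (conjAct E j l).map θ := by
  rw [← sub_eq_zero, ← Functor.map_sub]
  refine NatTrans.ext (funext fun N => ?_)
  refine (congrArg (fun η => (E l).map (NatTrans.app η _)) (hI h)).trans ?_
  exact (E l).map_zero _ _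

/-- The functors by which the 1-morphisms act, on the quotient by the ideal of a cell. -/
def conjQuot (a b : (cellIdeal Q).Quot) :
    (a ⟶ b) ⥤ (FGModuleCat.{t} (A a.as) ⥤ FGModuleCat.{t} (A b.as)) :=
  CategoryTheory.Quotient.lift _ (conjAct E a.as b.as) fun _ _ _ _ h => conjAct_map_eq E hI h

instance (a b : (cellIdeal Q).Quot) : (conjQuot E hI a b).Additive where
  map_add {F G α β} := by
    obtain ⟨α⟩ := α
    obtain ⟨β⟩ := β
    exact (conjAct E a.as b.as).map_add

lemma ProjGenerated.of_iso {j l : C} {Φ Ψ : FGModuleCat.{t} (A j) ⥤ FGModuleCat.{t} (A l)}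
    (e : Φ ≅ Ψ) (h : ProjGenerated k A Ψ) : ProjGenerated k A Φ :=
  .summand Φ Ψ Ψ e.hom e.inv 0 0 h h (by simp)

variable (hP : ∀ {j l : C} {F : j ⟶ l}, ⟨j, l, F⟩ ∈ Q → IsProjectiveFunctor k (conjMap E F))

include hI hP in
-- Zero objects and summands in `CellGenerated` are taken in the quotient `C/I_Q`. The additive
-- functor `conjQuot`, defined on that quotient, carries them to functors between module categories.
lemma projGenerated_conjMap {a b : (cellIdeal Q).Quot} {F : a ⟶ b} (hF : CellGenerated Q F) :
    ProjGenerated k A (conjMap E F.as) := by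
  induction hF with
  | id a => exact .of_iso (conjId E a.as) (.id _)
  | mem F hF => exact .proj _ (hP hF)
  | comp F G _ _ hF hG => exact .of_iso (conjComp E F.as G.as) (.comp _ _ hF hG)
  | zero F hF => exact .zero _ ((conjQuot E hI _ _).map_isZero hF)
  | summand F G H ι₁ π₁ ι₂ π₂ _ _ h hG hH =>
    have h' := congrArg (conjQuot E hI _ _).map h
    rw [Functor.map_add, CategoryTheory.Functor.map_comp, CategoryTheory.Functor.map_comp,
      CategoryTheory.Functor.map_id] at h'
    exact .summand _ _ _ _ _ _ _ hG hH h'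

open CellTwoCat ProjTwoCat

/-- The image of a 1-morphism. -/
def inducedMap {a b : CellTwoCat Q} (F : a ⟶ b) : obj k A a.under ⟶ obj k A b.under :=
  homOfFunctor (conjMap E (rep F)) (projGenerated_conjMap E hI hP F.property)

/-- The image of a 2-morphism. -/
def inducedMap₂ {a b : CellTwoCat Q} {F G : a ⟶ b} (η : F ⟶ G) :
    inducedMap E hI hP F ⟶ inducedMap E hI hP G :=
  homOfNatTrans ((conjQuot E hI _ _).map (OneCellClass.Sub.hom₂ η))

lemma exists_two_eq {a b : CellTwoCat Q} {F G : a ⟶ b} (η : F ⟶ G) :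
    ∃ α : rep F ⟶ rep G, two α = η := by
  obtain ⟨⟨α⟩⟩ := η
  exact ⟨α, rfl⟩

/-- The 2-functor induced by the cell 2-representation. -/
def inducedPseudofunctor : Pseudofunctor (CellTwoCat Q) (ProjTwoCat k A) where
  obj a := obj k A a.under
  map F := inducedMap E hI hP F
  map₂ η := inducedMap₂ E hI hP η
  map₂_id F := congrArg homOfNatTrans ((conjQuot E hI _ _).map_id _)
  map₂_comp η θ := congrArg homOfNatTrans ((conjQuot E hI _ _).map_comp _ _)
  mapId a := isoOfNatIso (conjId E a.under)
  mapComp F G := isoOfNatIso (conjComp E (rep F) (rep G))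
  map₂_whisker_left {a b c} F {G H} η := by
    obtain ⟨α, rfl⟩ := exists_two_eq η
    rw [← Category.assoc, Iso.eq_comp_inv]
    exact hom₂_ext fun N => conjApp_whiskerLeft E (rep F) α N
  map₂_whisker_right {a b c F G} η H := by
    obtain ⟨α, rfl⟩ := exists_two_eq η
    rw [← Category.assoc, Iso.eq_comp_inv]
    exact hom₂_ext fun N => conjApp_whiskerRight E α (rep H) N
  map₂_associator {a b c d} F G H := by
    rw [← Category.assoc, ← Category.assoc, ← Category.assoc, Iso.eq_comp_inv,
      ← whiskerLeftIso_inv, Iso.eq_comp_inv]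
    refine hom₂_ext fun N => ?_
    refine (Category.assoc _ _ _).trans ((conjApp_associator E (rep F) (rep G) (rep H) N).trans ?_)
    exact (Category.comp_id _).symm
  map₂_left_unitor {a b} F := hom₂_ext fun N => (conjApp_leftUnitor E (rep F) N).trans
    (congrArg (_ ≫ ·) (Category.comp_id _).symm)
  map₂_right_unitor {a b} F := hom₂_ext fun N => (conjApp_rightUnitor E (rep F) N).trans
    (congrArg (_ ≫ ·) (Category.comp_id _).symm)

/-- The 2-functor induced by the cell 2-representation, with its comparison. -/
def inducedTwoFunctor : InducedTwoFunctor k R i E Q where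
  Φ := inducedPseudofunctor E hI hP
  -- With equality of objects by `rfl`, the casts in `identification` reduce to identity functors.
  obj_eq _ := rfl
  θ F := conjUnit E (rep F)
  natural {a b F G} η M := by
    refine ((E _).map_comp _ _).symm.trans (Eq.trans (congrArg (E _).map ?_) ((E _).map_comp _ _))
    exact (cellApp_naturality R i η _).symm
  map_id a M := by
    refine (Category.assoc _ _ _).symm.trans ?_
    refine (congrArg (· ≫ _) (((E _).map_comp _ _).symm.trans
      ((congrArg (E _).map (cellIdApp_naturality R i (eqvUnit E M).hom)).trans
        ((E _).map_comp _ _)))).trans ?_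
    refine (Category.assoc _ _ _).trans ?_
    exact (congrArg (_ ≫ ·) (map_eqvUnit_eqvCounit E M)).trans (Category.comp_id _)
  map_comp {a b c} F G M := by
    refine ((E _).map_comp _ _).symm.trans ?_
    refine Eq.trans (congrArg (E _).map ?_)
      (((E _).map_comp _ _).trans (congrArg (_ ≫ ·) ((E _).map_comp _ _)))
    refine (cellCompApp_naturality_assoc R i (rep F) (rep G) (eqvUnit E M).hom _).trans ?_
    refine congrArg (_ ≫ ·) ?_
    refine ((cellMap R i (rep G)).map_comp _ _).symm.trans (Eq.trans
      (congrArg (cellMap R i (rep G)).map ?_) ((cellMap R i (rep G)).map_comp _ _))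
    exact (eqvUnit_naturality E _).symm

end Induced

/-! ### Assembly. -/

section Main

variable {k : Type*} [Field k] [IsAlgClosed k] {C : Type u} [Bicategory.{w, v} C]
  [∀ i j : C, Preadditive (i ⟶ j)] [∀ i j : C, Linear k (i ⟶ j)]
  [∀ i j : C, HasFiniteBiproducts (i ⟶ j)] [BiadditiveComp C]
  [∀ i j : C, IsAbelianCat (RightFreyd (i ⟶ j))] [HasExactAction C]
  {τ : Involution C} {Q R : Set (OneMor C)} {i : C}

/-- The algebras of a cell 2-representation are self-injective and weakly symmetric, and it induces
a 2-functor sending the elements of the two-sided cell to projective functors. -/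
lemma CellTopData.exists_inducedTwoFunctor (d : CellTopData R i (cellTop R i))
    (hs : CellSetup k τ Q R i) [(cellProp R i).IsClosedUnderMapObj] (A : C → Type t)
    [∀ j, Ring (A j)] [∀ j, Algebra k (A j)] [∀ j, FiniteDimensional k (A j)]
    (E : ∀ j, CellCat R i j ⥤ FGModuleCat.{t} (A j)) (hE : ∀ j, (E j).IsEquivalence)
    (hadd : ∀ j, (E j).Additive) (hlin : ∀ j, (E j).Linear k) :
    Module.Injective (∀ j, A j) (∀ j, A j) ∧ IsWeaklySymmetric (∀ j, A j) ∧
      ∃ T : InducedTwoFunctor k R i E Q, ∀ (j l : C) (F : j ⟶ l) (hF : ⟨j, l, F⟩ ∈ Q),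
        IsProjectiveFunctor k (ProjTwoCat.functor (T.Φ.map (CellTwoCat.ofMem F hF))) := by
  have := d.isAbelianCat_cellCat hs
  obtain ⟨h₁, h₂⟩ := d.injective_and_isWeaklySymmetric hs A E
  exact ⟨h₁, h₂, inducedTwoFunctor E (d.cellAct_map_eq_zero hs) (d.isProjectiveFunctor hs E),
    fun j l F hF => d.isProjectiveFunctor hs E hF⟩

end Main

end

end FiatCell

theorem mainTheorem10 {k : Type*} [Field k] [IsAlgClosed k]
    {C : Type u} [Bicategory.{w, v} C] [Bicategory.Strict C]
    [∀ i j : C, Preadditive (i ⟶ j)] [∀ i j : C, Linear k (i ⟶ j)]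
    [∀ i j : C, HasFiniteBiproducts (i ⟶ j)] [BiadditiveComp C]
    (hC : IsFinitary k C) (τ : Involution C) (hτ : τ.HasAdjunctions)
    (Q R : Set (OneMor C)) (hQ : IsStronglyRegular Q) (hR : IsRightCell R) (hRQ : R ⊆ Q)
    (i : C) (hi : ∃ F ∈ R, F.src = i) (h62 : ConstantOnLeftCells τ Q) :
    ∃ _ : (cellProp R i).IsClosedUnderMapObj,
      (∃ (A : C → Type w) (_ : ∀ j, Ring (A j)) (_ : ∀ j, Algebra k (A j))
        (E : ∀ j, (cellProp R i).Obj j ⥤ FGModuleCat.{w} (A j)),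
        ∀ j, FiniteDimensional k (A j) ∧ (E j).IsEquivalence ∧
          ∃ _ : (E j).Additive, (E j).Linear k) ∧
      ∀ (A : C → Type t) [∀ j, Ring (A j)] [∀ j, Algebra k (A j)]
        [∀ j, FiniteDimensional k (A j)]
        (E : ∀ j, (cellProp R i).Obj j ⥤ FGModuleCat.{t} (A j))
        [∀ j, (E j).IsEquivalence] [∀ j, (E j).Additive] [∀ j, (E j).Linear k],
        Module.Injective (∀ j, A j) (∀ j, A j) ∧
        IsWeaklySymmetric (∀ j, A j) ∧
        ∃ T : InducedTwoFunctor k R i E Q,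
          ∀ (j l : C) (F : j ⟶ l) (hF : ⟨j, l, F⟩ ∈ Q),
            IsProjectiveFunctor k (ProjTwoCat.functor (T.Φ.map (CellTwoCat.ofMem F hF))) := by
  have hs : CellSetup k τ Q R i := ⟨hC, hτ, hQ, hR, hRQ, hi⟩
  have (a b : C) : IsAbelianCat (Preadditive.RightFreyd (a ⟶ b)) := hC.isAbelianCat a b
  have : HasExactAction C := ⟨prinMap_preservesFiniteLimits τ hτ,
    prinMap_preservesFiniteColimits τ hτ⟩
  obtain ⟨d⟩ := hs.nonempty_cellTopData hs.isCellTop_cellTop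
  have hcl := d.isClosedUnderMapObj hs
  refine ⟨hcl, ?_, fun A _ _ _ E hE hadd hlin => ?_⟩
  -- The algebra `A_j` is the opposite endomorphism algebra of the progenerator of `C_R(j)`.
  · choose X _ _ hX using d.exists_isProgenerator hs
    exact ⟨fun j => (End (X j))ᵐᵒᵖ, fun j => inferInstance, fun j => inferInstance,
      fun j => (hX j).functor, fun j => ⟨(hX j).finiteDimensional_end,
        inferInstanceAs (hX j).functor.IsEquivalence, inferInstanceAs (hX j).functor.Additive,
        inferInstanceAs ((hX j).functor.Linear k)⟩⟩
  · exact d.exists_inducedTwoFunctor hs A E hE hadd hlin
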